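/- Let $k$ be a field. All operads are non-symmetric (non-$\Sigma$) dg operads over $k$, with components in all arities $N\ge 0$ and differential of degree $+1$. Let $\mathcal{O}'$ be the dg operad with the generators - $m\in\mathcal{O}'(2)^0$ and $j\in\mathcal{O}'(0)^0$; - $p_{n;i_1,\dots,i_t}\in\mathcal{O}'(n-t)^{1-n}$ for $n\ge 1$, $0\le t\le n$, $1\le i_1<\dots<i_t\le n$, written as $p_n(x_1,\dots,x_n)$, where $x_i$ is the formal symbol $1$ for $i\in\{i_1,\dots,i_t\}$, and the other $x_i$ are the $n-t$ operadic arguments in their order; and with the following relations: $m$ is associative; $dm=0$; $dj=0$; $p_1(1)=j$; $p_1(f)=f$ (that is, $p_{1;\varnothing}=\mathrm{id}$); $p_n(f_1,\dots,f_n)=0$ (that is, $p_{n;\varnothing}=0$) for $n\ge 2$; and, for all $n\ge1$ and all $x_1,\dots,x_n$ as above, $$ d\,p_n(x_1,\dots,x_n)=\sum_{\ell=1}^{n-1}(-1)^{\ell-1}\,m\circ\big(p_\ell(x_1,\dots,x_\ell),\,p_{n-\ell}(x_{\ell+1},\dots,x_n)\big)+\sum_{r=1}^{n-1}(-1)^{r}\,p_{n-1}(x_1,\dots,x_r\cdot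 x_{r+1},\dots,x_n), $$ where $1\cdot 1=1$, $1\cdot f=f\cdot 1=f$, and $f\cdot f'=m(f,f')$ for operadic arguments $f,f'$, and where $m\circ(a,b)=(m\circ_1 a)\circ_{s+1}b$ for $a$ of arity $s$. (These relations say that the operations $p_n$ are the Taylor components of an $A_\infty$ morphism $A\oplus k\cdot 1\to A$ which restricts to the identity of $A$. The relations $p_n(1,\dots,1)=0$, $n\ge 2$, and $m(j,j)=j$ are not imposed.) Let $\mathcal{A}ssoc_+$ be the operad of unital associative algebras, regarded as a dg operad with zero differential: $\mathcal{A}ssoc_+(N)=k$, in degree $0$, for every $N\ge 0$, spanned by the $N$-fold product (the unit, for $N=0$). **Theorem.** The map of dg operads $P\colon\mathcal{O}'\to\mathcal{A}ssoc_+$ that sends $m$ to the product, $j$ to the unit, and all $p_{n;i_1,\dots,i_t}$ with $n\ge 2$ to $0$, is a quasi-isomorphism: for every $N\ge 0$, the map of complexes $P(N)\colon\mathcal{O}'(N)\to\mathcal{A}ssoc_+(N)$ induces an isomorphism on cohomology. -/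

import Mathlib

open CategoryTheory

universe u

/-- The sign `(-1)^a`, as an element of the ground ring. -/
def sgn (k : Type u) [CommRing k] (a : ℤ) : k := ((a.negOnePow : ℤ) : k)

/-- A non-symmetric (non-`Σ`) dg operad over `k`, with cohomological grading: `obj n p` is the
module of `n`-ary operations of degree `p`, and the differential has degree `+1`.  The structure is
given by an identity operation and by the partial compositions `a ∘_i b` (inputs are numbered from
`0`).  Arities and degrees of composites are passed through equations, so that no casts are needed.
The signs are the Koszul signs of the endomorphism operad of a complex. -/
structure DGOperad (k : Type u) [CommRing k] where
  obj : ℕ → ℤ → Type u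
  [addCommGroup : ∀ n p, AddCommGroup (obj n p)]
  [module : ∀ n p, Module k (obj n p)]
  d {n : ℕ} {p q : ℤ} (h : p + 1 = q) : obj n p →ₗ[k] obj n q
  one : obj 1 0
  comp {m n r : ℕ} {p q s : ℤ} (i : ℕ) (hi : i < m) (hr : m + n = r + 1) (hs : p + q = s) :
    obj m p →ₗ[k] obj n q →ₗ[k] obj r s
  d_d {n : ℕ} {p q r : ℤ} (h : p + 1 = q) (h' : q + 1 = r) (x : obj n p) : d h' (d h x) = 0
  one_comp {n : ℕ} {p : ℤ} (hi : 0 < 1) (hr : 1 + n = n + 1) (hs : 0 + p = p) (x : obj n p) :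
    comp 0 hi hr hs one x = x
  comp_one {n : ℕ} {p : ℤ} (i : ℕ) (hi : i < n) (hr : n + 1 = n + 1) (hs : p + 0 = p)
    (x : obj n p) : comp i hi hr hs x one = x
  /-- sequential associativity: `(a ∘_i b) ∘_{i+j} c = a ∘_i (b ∘_j c)` -/
  comp_seq {l m n r s t : ℕ} {p q p' e f g : ℤ} (i j : ℕ) (hi : i < l) (hj : j < m)
    (hr : l + m = r + 1) (he : p + q = e) (hij : i + j < r) (ht : r + n = t + 1) (hg : e + p' = g)
    (hs : m + n = s + 1) (hf : q + p' = f) (ht' : l + s = t + 1) (hg' : p + f = g)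
    (a : obj l p) (b : obj m q) (c : obj n p') :
    comp (i + j) hij ht hg (comp i hi hr he a b) c = comp i hi ht' hg' a (comp j hj hs hf b c)
  /-- parallel associativity: for `i < j`,
  `(a ∘_i b) ∘_{j+m-1} c = (-1)^{|b||c|} (a ∘_j c) ∘_i b`, where `m` is the arity of `b` -/
  comp_par {l m n r s t : ℕ} {p q p' e f g : ℤ} (i j j' : ℕ) (hi : i < l) (hj : j < l)
    (_hij : i < j) (_hj' : j + m = j' + 1)
    (hr : l + m = r + 1) (he : p + q = e) (hjr : j' < r) (ht : r + n = t + 1) (hg : e + p' = g)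
    (hs : l + n = s + 1) (hf : p + p' = f) (his : i < s) (ht' : s + m = t + 1) (hg' : f + q = g)
    (a : obj l p) (b : obj m q) (c : obj n p') :
    comp j' hjr ht hg (comp i hi hr he a b) c
      = sgn k (q * p') • comp i his ht' hg' (comp j hj hs hf a c) b
  /-- Leibniz rule: `d (a ∘_i b) = da ∘_i b + (-1)^{|a|} a ∘_i db` -/
  d_comp {m n r : ℕ} {p q s p₁ q₁ s₁ : ℤ} (i : ℕ) (hi : i < m) (hr : m + n = r + 1)
    (hs : p + q = s) (hp : p + 1 = p₁) (hq : q + 1 = q₁) (hs₁ : s + 1 = s₁)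
    (h₁ : p₁ + q = s₁) (h₂ : p + q₁ = s₁) (a : obj m p) (b : obj n q) :
    d hs₁ (comp i hi hr hs a b)
      = comp i hi hr h₁ (d hp a) b + sgn k p • comp i hi hr h₂ a (d hq b)

namespace DGOperad

attribute [instance] DGOperad.addCommGroup DGOperad.module

variable {k : Type u} [CommRing k]

/-- Morphisms of dg operads. -/
structure Hom (A B : DGOperad k) where
  app {n : ℕ} {p : ℤ} : A.obj n p →ₗ[k] B.obj n p
  map_d {n : ℕ} {p q : ℤ} (h : p + 1 = q) (x : A.obj n p) : app (A.d h x) = B.d h (app x)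
  map_one : app A.one = B.one
  map_comp {m n r : ℕ} {p q s : ℤ} (i : ℕ) (hi : i < m) (hr : m + n = r + 1) (hs : p + q = s)
    (a : A.obj m p) (b : A.obj n q) :
    app (A.comp i hi hr hs a b) = B.comp i hi hr hs (app a) (app b)

/-- The cochain complex of `n`-ary operations. -/
noncomputable def complex (A : DGOperad k) (n : ℕ) : CochainComplex (ModuleCat.{u} k) ℤ where
  X p := ModuleCat.of k (A.obj n p)
  d p q := if h : p + 1 = q then ModuleCat.ofHom (A.d h) else 0
  shape p q h := dif_neg h
  d_comp_d' p q r h h' := by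
    have h₁ : p + 1 = q := h
    have h₂ : q + 1 = r := h'
    rw [dif_pos h₁, dif_pos h₂]
    ext x
    exact A.d_d h₁ h₂ x

/-- The cochain map induced by a morphism of dg operads on `n`-ary operations. -/
noncomputable def Hom.complexMap {A B : DGOperad k} (f : Hom A B) (n : ℕ) :
    A.complex n ⟶ B.complex n where
  f p := ModuleCat.ofHom f.app
  comm' p q h := by
    have h₁ : p + 1 = q := h
    simp only [complex, dif_pos h₁]
    ext x
    exact (f.map_d h₁ x).symm

/-- A morphism of dg operads is a quasi-isomorphism if it is one in every arity `n ≥ 0`. -/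
def Hom.IsQuasiIso {A B : DGOperad k} (f : Hom A B) : Prop :=
  ∀ n : ℕ, QuasiIso (f.complexMap n)

end DGOperad

/-! ### dg operads presented by generators and relations -/

namespace Presentation

open DGOperad

/-- Formal expressions in the operations of a dg operad and in generators `G n p` of arity `n` and
degree `p`. -/
inductive OpExpr (k : Type u) (G : ℕ → ℤ → Type) : ℕ → ℤ → Type u
  | gen {n : ℕ} {p : ℤ} (g : G n p) : OpExpr k G n p
  | zero {n : ℕ} {p : ℤ} : OpExpr k G n p
  | add {n : ℕ} {p : ℤ} (x y : OpExpr k G n p) : OpExpr k G n p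
  | smul {n : ℕ} {p : ℤ} (c : k) (x : OpExpr k G n p) : OpExpr k G n p
  | d {n : ℕ} {p q : ℤ} (h : p + 1 = q) (x : OpExpr k G n p) : OpExpr k G n q
  | one : OpExpr k G 1 0
  | comp {m n r : ℕ} {p q s : ℤ} (i : ℕ) (hi : i < m) (hr : m + n = r + 1) (hs : p + q = s)
      (a : OpExpr k G m p) (b : OpExpr k G n q) : OpExpr k G r s

/-- The sum of a list of expressions. -/
def OpExpr.sum {k : Type u} {G : ℕ → ℤ → Type} {n : ℕ} {p : ℤ} (l : List (OpExpr k G n p)) :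
    OpExpr k G n p :=
  l.foldr OpExpr.add OpExpr.zero

/-- Relations between formal expressions. -/
abbrev Relations (k : Type u) (G : ℕ → ℤ → Type) :=
  ∀ ⦃n : ℕ⦄ ⦃p : ℤ⦄, OpExpr k G n p → OpExpr k G n p → Prop

open Presentation.OpExpr in
/-- The smallest congruence on formal expressions that contains the given relations `R` and
all the axioms of a dg operad. -/
inductive Cong {k : Type u} [CommRing k] {G : ℕ → ℤ → Type} (R : Relations k G) :
    ∀ {n : ℕ} {p : ℤ}, OpExpr k G n p → OpExpr k G n p → Prop
  -- the given relations
  | of {n : ℕ} {p : ℤ} {x y : OpExpr k G n p} (h : R x y) : Cong R x y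
  -- congruence
  | refl {n : ℕ} {p : ℤ} (x : OpExpr k G n p) : Cong R x x
  | symm {n : ℕ} {p : ℤ} {x y : OpExpr k G n p} (h : Cong R x y) : Cong R y x
  | trans {n : ℕ} {p : ℤ} {x y z : OpExpr k G n p} (h : Cong R x y) (h' : Cong R y z) : Cong R x z
  | congr_add {n : ℕ} {p : ℤ} {x x' y y' : OpExpr k G n p} (h : Cong R x x') (h' : Cong R y y') :
      Cong R (add x y) (add x' y')
  | congr_smul {n : ℕ} {p : ℤ} (c : k) {x x' : OpExpr k G n p} (h : Cong R x x') :
      Cong R (smul c x) (smul c x')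
  | congr_d {n : ℕ} {p q : ℤ} (hpq : p + 1 = q) {x x' : OpExpr k G n p} (h : Cong R x x') :
      Cong R (d hpq x) (d hpq x')
  | congr_comp {m n r : ℕ} {p q s : ℤ} (i : ℕ) (hi : i < m) (hr : m + n = r + 1) (hs : p + q = s)
      {a a' : OpExpr k G m p} {b b' : OpExpr k G n q} (h : Cong R a a') (h' : Cong R b b') :
      Cong R (comp i hi hr hs a b) (comp i hi hr hs a' b')
  -- modules
  | add_comm {n : ℕ} {p : ℤ} (x y : OpExpr k G n p) : Cong R (add x y) (add y x)
  | add_assoc {n : ℕ} {p : ℤ} (x y z : OpExpr k G n p) :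
      Cong R (add (add x y) z) (add x (add y z))
  | zero_add {n : ℕ} {p : ℤ} (x : OpExpr k G n p) : Cong R (add zero x) x
  | neg_add {n : ℕ} {p : ℤ} (x : OpExpr k G n p) : Cong R (add (smul (-1) x) x) zero
  | smul_add {n : ℕ} {p : ℤ} (c : k) (x y : OpExpr k G n p) :
      Cong R (smul c (add x y)) (add (smul c x) (smul c y))
  | add_smul {n : ℕ} {p : ℤ} (c c' : k) (x : OpExpr k G n p) :
      Cong R (smul (c + c') x) (add (smul c x) (smul c' x))
  | mul_smul {n : ℕ} {p : ℤ} (c c' : k) (x : OpExpr k G n p) :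
      Cong R (smul (c * c') x) (smul c (smul c' x))
  | one_smul {n : ℕ} {p : ℤ} (x : OpExpr k G n p) : Cong R (smul 1 x) x
  -- linearity
  | d_add {n : ℕ} {p q : ℤ} (h : p + 1 = q) (x y : OpExpr k G n p) :
      Cong R (d h (add x y)) (add (d h x) (d h y))
  | d_smul {n : ℕ} {p q : ℤ} (h : p + 1 = q) (c : k) (x : OpExpr k G n p) :
      Cong R (d h (smul c x)) (smul c (d h x))
  | add_comp {m n r : ℕ} {p q s : ℤ} (i : ℕ) (hi : i < m) (hr : m + n = r + 1) (hs : p + q = s)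
      (a a' : OpExpr k G m p) (b : OpExpr k G n q) :
      Cong R (comp i hi hr hs (add a a') b) (add (comp i hi hr hs a b) (comp i hi hr hs a' b))
  | smul_comp {m n r : ℕ} {p q s : ℤ} (i : ℕ) (hi : i < m) (hr : m + n = r + 1) (hs : p + q = s)
      (c : k) (a : OpExpr k G m p) (b : OpExpr k G n q) :
      Cong R (comp i hi hr hs (smul c a) b) (smul c (comp i hi hr hs a b))
  | comp_add {m n r : ℕ} {p q s : ℤ} (i : ℕ) (hi : i < m) (hr : m + n = r + 1) (hs : p + q = s)
      (a : OpExpr k G m p) (b b' : OpExpr k G n q) :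
      Cong R (comp i hi hr hs a (add b b')) (add (comp i hi hr hs a b) (comp i hi hr hs a b'))
  | comp_smul {m n r : ℕ} {p q s : ℤ} (i : ℕ) (hi : i < m) (hr : m + n = r + 1) (hs : p + q = s)
      (c : k) (a : OpExpr k G m p) (b : OpExpr k G n q) :
      Cong R (comp i hi hr hs a (smul c b)) (smul c (comp i hi hr hs a b))
  -- the axioms of a dg operad
  | d_d {n : ℕ} {p q r : ℤ} (h : p + 1 = q) (h' : q + 1 = r) (x : OpExpr k G n p) :
      Cong R (d h' (d h x)) zero
  | one_comp {n : ℕ} {p : ℤ} (hi : 0 < 1) (hr : 1 + n = n + 1) (hs : 0 + p = p)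
      (x : OpExpr k G n p) : Cong R (comp 0 hi hr hs one x) x
  | comp_one {n : ℕ} {p : ℤ} (i : ℕ) (hi : i < n) (hr : n + 1 = n + 1) (hs : p + 0 = p)
      (x : OpExpr k G n p) : Cong R (comp i hi hr hs x one) x
  | comp_seq {l m n r s t : ℕ} {p q p' e f g : ℤ} (i j : ℕ) (hi : i < l) (hj : j < m)
      (hr : l + m = r + 1) (he : p + q = e) (hij : i + j < r) (ht : r + n = t + 1)
      (hg : e + p' = g)
      (hs : m + n = s + 1) (hf : q + p' = f) (ht' : l + s = t + 1) (hg' : p + f = g)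
      (a : OpExpr k G l p) (b : OpExpr k G m q) (c : OpExpr k G n p') :
      Cong R (comp (i + j) hij ht hg (comp i hi hr he a b) c)
        (comp i hi ht' hg' a (comp j hj hs hf b c))
  | comp_par {l m n r s t : ℕ} {p q p' e f g : ℤ} (i j j' : ℕ) (hi : i < l) (hj : j < l)
      (hij : i < j) (hj' : j + m = j' + 1)
      (hr : l + m = r + 1) (he : p + q = e) (hjr : j' < r) (ht : r + n = t + 1) (hg : e + p' = g)
      (hs : l + n = s + 1) (hf : p + p' = f) (his : i < s) (ht' : s + m = t + 1) (hg' : f + q = g)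
      (a : OpExpr k G l p) (b : OpExpr k G m q) (c : OpExpr k G n p') :
      Cong R (comp j' hjr ht hg (comp i hi hr he a b) c)
        (smul (sgn k (q * p')) (comp i his ht' hg' (comp j hj hs hf a c) b))
  | d_comp {m n r : ℕ} {p q s p₁ q₁ s₁ : ℤ} (i : ℕ) (hi : i < m) (hr : m + n = r + 1)
      (hs : p + q = s) (hp : p + 1 = p₁) (hq : q + 1 = q₁) (hs₁ : s + 1 = s₁)
      (h₁ : p₁ + q = s₁) (h₂ : p + q₁ = s₁) (a : OpExpr k G m p) (b : OpExpr k G n q) :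
      Cong R (d hs₁ (comp i hi hr hs a b))
        (add (comp i hi hr h₁ (d hp a) b) (smul (sgn k p) (comp i hi hr h₂ a (d hq b))))

section Presented

variable {k : Type u} [CommRing k] {G : ℕ → ℤ → Type} (R : Relations k G)

/-- Formal expressions up to the congruence generated by `R`. -/
def congSetoid (n : ℕ) (p : ℤ) : Setoid (OpExpr k G n p) where
  r := Cong R
  iseqv := ⟨Cong.refl, Cong.symm, Cong.trans⟩

/-- The operations of the presented dg operad. -/
def PresentedObj (n : ℕ) (p : ℤ) : Type u := Quotient (congSetoid R n p)

/-- The class of a formal expression. -/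
def PresentedObj.mk {n : ℕ} {p : ℤ} (x : OpExpr k G n p) : PresentedObj R n p :=
  Quotient.mk (congSetoid R n p) x

theorem PresentedObj.sound {n : ℕ} {p : ℤ} {x y : OpExpr k G n p} (h : Cong R x y) :
    PresentedObj.mk R x = PresentedObj.mk R y :=
  Quotient.sound (s := congSetoid R n p) h

theorem PresentedObj.ind {n : ℕ} {p : ℤ} {C : PresentedObj R n p → Prop}
    (h : ∀ x, C (PresentedObj.mk R x)) (x : PresentedObj R n p) : C x :=
  Quotient.ind (s := congSetoid R n p) h x

instance (n : ℕ) (p : ℤ) : Add (PresentedObj R n p) where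
  add := Quotient.map₂ OpExpr.add fun _ _ h _ _ h' => Cong.congr_add h h'

instance (n : ℕ) (p : ℤ) : Zero (PresentedObj R n p) where
  zero := PresentedObj.mk R OpExpr.zero

instance (n : ℕ) (p : ℤ) : Neg (PresentedObj R n p) where
  neg := Quotient.map (OpExpr.smul (-1)) fun _ _ h => Cong.congr_smul _ h

instance (n : ℕ) (p : ℤ) : AddCommGroup (PresentedObj R n p) where
  nsmul := nsmulRec
  zsmul := zsmulRec
  add_assoc := by
    refine PresentedObj.ind R fun x => PresentedObj.ind R fun y => PresentedObj.ind R fun z => ?_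
    exact PresentedObj.sound R (Cong.add_assoc x y z)
  zero_add := PresentedObj.ind R fun x => PresentedObj.sound R (Cong.zero_add x)
  add_zero := PresentedObj.ind R fun x =>
    PresentedObj.sound R ((Cong.add_comm _ _).trans (Cong.zero_add x))
  neg_add_cancel := PresentedObj.ind R fun x => PresentedObj.sound R (Cong.neg_add x)
  add_comm := by
    refine PresentedObj.ind R fun x => PresentedObj.ind R fun y => ?_
    exact PresentedObj.sound R (Cong.add_comm x y)

instance (n : ℕ) (p : ℤ) : SMul k (PresentedObj R n p) where
  smul c := Quotient.map (OpExpr.smul c) fun _ _ h => Cong.congr_smul c h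

instance (n : ℕ) (p : ℤ) : Module k (PresentedObj R n p) :=
  Module.ofMinimalAxioms
    (by
      intro c
      refine PresentedObj.ind R fun x => PresentedObj.ind R fun y => ?_
      exact PresentedObj.sound R (Cong.smul_add c x y))
    (fun c c' => PresentedObj.ind R fun x => PresentedObj.sound R (Cong.add_smul c c' x))
    (fun c c' => PresentedObj.ind R fun x => PresentedObj.sound R (Cong.mul_smul c c' x))
    (PresentedObj.ind R fun x => PresentedObj.sound R (Cong.one_smul x))

/-- The dg operad with generators `G` and relations `R`: the quotient of the free dg operad on `G`
by the dg operadic ideal generated by the relations. -/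
def presented : DGOperad k where
  obj := PresentedObj R
  d h :=
    { toFun := Quotient.map (OpExpr.d h) fun _ _ h' => Cong.congr_d h h'
      map_add' := by
        refine PresentedObj.ind R fun x => PresentedObj.ind R fun y => ?_
        exact PresentedObj.sound R (Cong.d_add h x y)
      map_smul' := fun c => PresentedObj.ind R fun x => PresentedObj.sound R (Cong.d_smul h c x) }
  one := PresentedObj.mk R OpExpr.one
  comp i hi hr hs := LinearMap.mk₂ k
    (Quotient.map₂ (OpExpr.comp i hi hr hs) fun _ _ h _ _ h' => Cong.congr_comp i hi hr hs h h')
    (by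
      refine PresentedObj.ind R fun x => PresentedObj.ind R fun y => PresentedObj.ind R fun z => ?_
      exact PresentedObj.sound R (Cong.add_comp i hi hr hs x y z))
    (by
      refine fun c => PresentedObj.ind R fun x => PresentedObj.ind R fun y => ?_
      exact PresentedObj.sound R (Cong.smul_comp i hi hr hs c x y))
    (by
      refine PresentedObj.ind R fun x => PresentedObj.ind R fun y => PresentedObj.ind R fun z => ?_
      exact PresentedObj.sound R (Cong.comp_add i hi hr hs x y z))
    (by
      refine fun c => PresentedObj.ind R fun x => PresentedObj.ind R fun y => ?_
      exact PresentedObj.sound R (Cong.comp_smul i hi hr hs c x y))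
  d_d h h' := PresentedObj.ind R fun x => PresentedObj.sound R (Cong.d_d h h' x)
  one_comp hi hr hs := PresentedObj.ind R fun x => PresentedObj.sound R (Cong.one_comp hi hr hs x)
  comp_one i hi hr hs :=
    PresentedObj.ind R fun x => PresentedObj.sound R (Cong.comp_one i hi hr hs x)
  comp_seq i j hi hj hr he hij ht hg hs hf ht' hg' := by
    refine PresentedObj.ind R fun x => PresentedObj.ind R fun y => PresentedObj.ind R fun z => ?_
    exact PresentedObj.sound R (Cong.comp_seq i j hi hj hr he hij ht hg hs hf ht' hg' x y z)
  comp_par i j j' hi hj hij hj' hr he hjr ht hg hs hf his ht' hg' := by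
    refine PresentedObj.ind R fun x => PresentedObj.ind R fun y => PresentedObj.ind R fun z => ?_
    exact PresentedObj.sound R
      (Cong.comp_par i j j' hi hj hij hj' hr he hjr ht hg hs hf his ht' hg' x y z)
  d_comp i hi hr hs hp hq hs₁ h₁ h₂ := by
    refine PresentedObj.ind R fun x => PresentedObj.ind R fun y => ?_
    exact PresentedObj.sound R (Cong.d_comp i hi hr hs hp hq hs₁ h₁ h₂ x y)

/-- Evaluation of formal expressions in a dg operad, given values of the generators. -/
def OpExpr.eval (A : DGOperad k) (φ : ∀ {n : ℕ} {p : ℤ}, G n p → A.obj n p) :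
    ∀ {n : ℕ} {p : ℤ}, OpExpr k G n p → A.obj n p
  | _, _, .gen g => φ g
  | _, _, .zero => 0
  | _, _, .add x y => OpExpr.eval A φ x + OpExpr.eval A φ y
  | _, _, .smul c x => c • OpExpr.eval A φ x
  | _, _, .d h x => A.d h (OpExpr.eval A φ x)
  | _, _, .one => A.one
  | _, _, .comp i hi hr hs a b => A.comp i hi hr hs (OpExpr.eval A φ a) (OpExpr.eval A φ b)

theorem OpExpr.eval_cong {R : Relations k G} (A : DGOperad k)
    (φ : ∀ {n : ℕ} {p : ℤ}, G n p → A.obj n p)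
    (hφ : ∀ {n : ℕ} {p : ℤ} {x y : OpExpr k G n p}, R x y → OpExpr.eval A φ x = OpExpr.eval A φ y)
    {n : ℕ} {p : ℤ} {x y : OpExpr k G n p} (h : Cong R x y) :
    OpExpr.eval A φ x = OpExpr.eval A φ y := by
  induction h with
  | of h => exact hφ h
  | refl => rfl
  | symm _ ih => exact ih.symm
  | trans _ _ ih ih' => exact ih.trans ih'
  | congr_add _ _ ih ih' => simp only [OpExpr.eval, ih, ih']
  | congr_smul c _ ih => simp only [OpExpr.eval, ih]
  | congr_d _ _ ih => simp only [OpExpr.eval, ih]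
  | congr_comp _ _ _ _ _ _ ih ih' => simp only [OpExpr.eval, ih, ih']
  | add_comm => exact _root_.add_comm _ _
  | add_assoc => exact _root_.add_assoc _ _ _
  | zero_add => exact _root_.zero_add _
  | neg_add => simp [OpExpr.eval]
  | smul_add => exact _root_.smul_add _ _ _
  | add_smul => exact _root_.add_smul _ _ _
  | mul_smul => exact SemigroupAction.mul_smul _ _ _
  | one_smul => exact _root_.one_smul _ _
  | d_add => simp [OpExpr.eval]
  | d_smul => simp [OpExpr.eval]
  | add_comp => simp [OpExpr.eval]
  | smul_comp => simp [OpExpr.eval]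
  | comp_add => simp [OpExpr.eval]
  | comp_smul => simp [OpExpr.eval]
  | d_d => exact A.d_d _ _ _
  | one_comp => exact A.one_comp _ _ _ _
  | comp_one => exact A.comp_one _ _ _ _ _
  | comp_seq => exact A.comp_seq _ _ _ _ _ _ _ _ _ _ _ _ _ _ _ _
  | comp_par _ _ _ _ _ hij hj' => exact A.comp_par _ _ _ _ _ hij hj' _ _ _ _ _ _ _ _ _ _ _ _ _
  | d_comp => exact A.d_comp _ _ _ _ _ _ _ _ _ _ _

/-- The morphism out of a presented dg operad determined by values of the generators that satisfy
the relations. -/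
def presentedLift {R : Relations k G} (A : DGOperad k)
    (φ : ∀ {n : ℕ} {p : ℤ}, G n p → A.obj n p)
    (hφ : ∀ {n : ℕ} {p : ℤ} {x y : OpExpr k G n p}, R x y → OpExpr.eval A φ x = OpExpr.eval A φ y) :
    Hom (presented R) A where
  app :=
    { toFun := Quotient.lift (OpExpr.eval A φ) fun _ _ h => OpExpr.eval_cong A φ hφ h
      map_add' := by
        refine PresentedObj.ind R fun x => PresentedObj.ind R fun y => ?_
        rfl
      map_smul' := fun c => PresentedObj.ind R fun x => rfl }
  map_d h := PresentedObj.ind R fun x => rfl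
  map_one := rfl
  map_comp i hi hr hs := by
    refine PresentedObj.ind R fun x => PresentedObj.ind R fun y => ?_
    rfl

end Presented

end Presentation

/-! ### The operad of unital associative algebras -/

/-- The one-dimensional complex `k` concentrated in degree `0`. -/
def degZero (k : Type u) [CommRing k] (p : ℤ) : Submodule k k where
  carrier := {x | p ≠ 0 → x = 0}
  add_mem' ha hb h := by rw [ha h, hb h, add_zero]
  zero_mem' _ := rfl
  smul_mem' c x hx h := by rw [hx h, smul_zero]

/-- The (non-symmetric) operad of unital associative algebras, as a dg operad with zero
differential: its arity `n` component is `k` in degree `0`, spanned by the `n`-fold product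
`(x₁, …, xₙ) ↦ x₁ ⋯ xₙ` (the unit, for `n = 0`), for every `n ≥ 0`; and composites of such products
are such products. -/
def AssocPlus (k : Type u) [CommRing k] : DGOperad k where
  obj _ p := degZero k p
  d _ := 0
  one := ⟨1, fun h => (h rfl).elim⟩
  comp {m n r p q s} i hi hr hs := LinearMap.mk₂ k
    (fun a b => ⟨a.1 * b.1, fun h => by
      by_cases hp : p = 0
      · rw [b.2 (by omega), mul_zero]
      · rw [a.2 hp, zero_mul]⟩)
    (fun a a' b => Subtype.ext (add_mul _ _ _))
    (fun c a b => Subtype.ext (mul_assoc _ _ _))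
    (fun a b b' => Subtype.ext (mul_add _ _ _))
    (fun c a b => Subtype.ext (mul_left_comm _ _ _))
  d_d _ _ _ := rfl
  one_comp _ _ _ x := Subtype.ext (one_mul _)
  comp_one _ _ _ _ x := Subtype.ext (mul_one _)
  comp_seq _ _ _ _ _ _ _ _ _ _ _ _ _ a b c := Subtype.ext (mul_assoc _ _ _)
  comp_par {l m n r s t p q p' e f g} _ _ _ _ _ _ _ _ _ _ _ _ _ _ _ _ _ a b c := by
    apply Subtype.ext
    change a.1 * b.1 * c.1 = sgn k (q * p') * (a.1 * c.1 * b.1)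
    by_cases hq : q = 0
    · subst hq
      simp [sgn]
      ring
    · rw [b.2 hq]
      ring
  d_comp _ _ _ _ _ _ _ _ _ _ _ := by
    apply Subtype.ext
    simp

/-! ### The dg operad `O'` -/

namespace OPrime

open DGOperad Presentation

/-- The generators: the product `m`, the constant `j`, and the operations `p_{n; i₁, …, i_t}`, for
`n ≥ 1` and `1 ≤ i₁ < ⋯ < i_t ≤ n`, of arity `n - t` and degree `1 - n`.  The index
`(n; i₁, …, i_t)` is encoded as the word `w` of length `n` whose letter number `i` is `true` if
`i ∈ {i₁, …, i_t}` (the formal unit `1` stands in the place `i` of `p_n`) and is `false` otherwise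
(an operadic argument stands there). -/
inductive Gen : ℕ → ℤ → Type
  | m : Gen 2 0
  | j : Gen 0 0
  | p {a : ℕ} {q : ℤ} (w : List Bool) (hw : w ≠ []) (ha : w.count false = a)
      (hq : (w.length : ℤ) + q = 1) : Gen a q

/-- Formal expressions in the generators. -/
abbrev Ex (k : Type u) := OpExpr k Gen

/-- The word of length `n - 1` obtained from `w` by multiplying its letters number `r` and `r + 1`
(numbered from `0`): `1 · 1 = 1`, whereas `1 · f`, `f · 1` and `f · f'` are operadic arguments. -/
def merge (w : List Bool) (r : ℕ) (hr : r + 1 < w.length) : List Bool :=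
  w.take r ++ (w[r] && w[r + 1]) :: w.drop (r + 2)

theorem split_eq (w : List Bool) (r : ℕ) (hr : r + 1 < w.length) :
    w = w.take r ++ w[r] :: w[r + 1] :: w.drop (r + 2) := by
  conv_lhs => rw [← List.take_append_drop r w, List.drop_eq_getElem_cons (by omega),
    List.drop_eq_getElem_cons hr]

theorem length_merge (w : List Bool) (r : ℕ) (hr : r + 1 < w.length) :
    (merge w r hr).length + 1 = w.length := by
  simp [merge]
  omega

theorem merge_ne_nil (w : List Bool) (r : ℕ) (hr : r + 1 < w.length) : merge w r hr ≠ [] := by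
  simp [merge]

theorem count_merge (w : List Bool) (r : ℕ) (hr : r + 1 < w.length)
    (h : ¬(w[r] = false ∧ w[r + 1] = false)) :
    (merge w r hr).count false = w.count false := by
  conv_rhs => rw [split_eq w r hr]
  unfold merge
  generalize w[r] = x at *
  generalize w[r + 1] = y at *
  cases x <;> cases y <;> simp_all

theorem count_merge' (w : List Bool) (r : ℕ) (hr : r + 1 < w.length)
    (h : w[r] = false ∧ w[r + 1] = false) :
    (merge w r hr).count false + 1 = w.count false := by
  conv_rhs => rw [split_eq w r hr]
  simp [merge, h.1, h.2]
  omega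

theorem slot_lt (w : List Bool) (r : ℕ) (hr : r + 1 < w.length)
    (h : w[r] = false ∧ w[r + 1] = false) :
    (w.take r).count false < (merge w r hr).count false := by
  simp [merge, h.1, h.2]

theorem count_split (w : List Bool) (l : ℕ) :
    (w.take l).count false + (w.drop l).count false = w.count false := by
  rw [← List.count_append, List.take_append_drop]

section Terms

variable (k : Type u) [CommRing k]

/-- The summand `(-1)^{ℓ-1} m ∘ (p_u, p_v)` of `d p_w`, where `w = uv` with `u` of length
`ℓ = l + 1`; here `m ∘ (x, y) = (m ∘_0 x) ∘_{arity x} y`. -/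
def splitTerm (w : List Bool) (l : ℕ) (hl : l + 1 < w.length) {a : ℕ} {q : ℤ}
    (ha : w.count false = a) (hq : (w.length : ℤ) + q = 2) : Ex k a q :=
  .smul (sgn k l)
    (.comp (r := a) (p := -l) (q := (l : ℤ) + 2 - w.length)
      ((w.take (l + 1)).count false) (m := (w.take (l + 1)).count false + 1)
      (by omega) (by have := count_split w (l + 1); omega) (by omega)
      (.comp (p := 0) (q := -l) (r := (w.take (l + 1)).count false + 1)
        0 (by omega) (by omega) (by omega)
        (.gen .m)
        (.gen (.p (w.take (l + 1)) (by rw [← List.length_pos_iff]; simp; omega) rfl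
          (by rw [List.length_take]; omega))))
      (.gen (.p (w.drop (l + 1)) (by rw [← List.length_pos_iff]; simp; omega) rfl
        (by rw [List.length_drop]; omega))))

/-- The summand of `d p_w` given by multiplying the letters of `w` number `r` and `r + 1` (numbered
from `0`), with the sign `(-1)^{r+1}`: if both are operadic arguments, it is `p_{w'} ∘_s m` where
`w'` is the merged word and `s` the number of operadic arguments to the left; and otherwise it is
`p_{w'}`, because `1` is a strict unit for the multiplication of the arguments. -/
def mergeTerm (w : List Bool) (r : ℕ) (hr : r + 1 < w.length) {a : ℕ} {q : ℤ}
    (ha : w.count false = a) (hq : (w.length : ℤ) + q = 2) : Ex k a q :=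
  .smul (sgn k (r + 1))
    (if h : w[r] = false ∧ w[r + 1] = false then
      .comp (p := q) (q := 0) ((w.take r).count false) (slot_lt w r hr h)
        (by have := count_merge' w r hr h; omega) (by omega)
        (.gen (.p (merge w r hr) (merge_ne_nil w r hr) rfl
          (by have := length_merge w r hr; omega)))
        (.gen .m)
    else
      .gen (.p (merge w r hr) (merge_ne_nil w r hr) ((count_merge w r hr h).trans ha)
        (by have := length_merge w r hr; omega)))

/-- The differential of `p_w`. -/
def dP (w : List Bool) {a : ℕ} {q : ℤ} (ha : w.count false = a) (hq : (w.length : ℤ) + q = 2) :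
    Ex k a q :=
  .add
    (OpExpr.sum (List.ofFn fun l : Fin (w.length - 1) => splitTerm k w l (by omega) ha hq))
    (OpExpr.sum (List.ofFn fun r : Fin (w.length - 1) => mergeTerm k w r (by omega) ha hq))

/-- The relations of `O'`. -/
inductive Rel : Relations k Gen
  /-- `m` is associative -/
  | assoc : Rel (n := 3) (p := 0)
      (.comp 0 (by omega) (by omega) (by omega) (.gen .m) (.gen .m))
      (.comp 1 (by omega) (by omega) (by omega) (.gen .m) (.gen .m))
  /-- `dm = 0` -/
  | d_m (h : (0 : ℤ) + 1 = 1) : Rel (.d h (.gen .m)) .zero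
  /-- `dj = 0` -/
  | d_j (h : (0 : ℤ) + 1 = 1) : Rel (.d h (.gen .j)) .zero
  /-- `p_1(1) = j` -/
  | p_unit (hw ha hq) : Rel (.gen (.p [true] hw ha hq)) (.gen .j)
  /-- `p_1(f) = f` -/
  | p_arg (hw ha hq) : Rel (.gen (.p [false] hw ha hq)) .one
  /-- `p_n(f₁, …, fₙ) = 0` for `n ≥ 2` -/
  | p_args {n : ℕ} {q : ℤ} (hn : 2 ≤ n) (hw ha hq) :
      Rel (n := n) (p := q) (.gen (.p (List.replicate n false) hw ha hq)) .zero
  /-- the components of `p` form an `A_∞` functor -/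
  | d_p {a : ℕ} {q q' : ℤ} (w : List Bool) (hw : w ≠ []) (ha : w.count false = a)
      (hq : (w.length : ℤ) + q = 1) (h : q + 1 = q') (hq' : (w.length : ℤ) + q' = 2) :
      Rel (.d h (.gen (.p w hw ha hq))) (dP k w ha hq')

end Terms

end OPrime

/-- The dg operad `O'`. -/
def OPrime (k : Type u) [CommRing k] : DGOperad k := Presentation.presented (OPrime.Rel k)

namespace OPrime

open DGOperad Presentation

variable (k : Type u) [CommRing k]

/-- The images of the generators in the operad of unital associative algebras: the product `m` goes
to the product, `j` to the unit, and `p_w` to zero if `w` has at least two letters (while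
`p_1(1) = j` goes to the unit, and `p_1(f) = f` to the identity). -/
def projGen : ∀ {n : ℕ} {p : ℤ}, Gen n p → (AssocPlus k).obj n p
  | _, _, .m => ⟨1, fun h => (h rfl).elim⟩
  | _, _, .j => ⟨1, fun h => (h rfl).elim⟩
  | _, _, .p w _ _ hq => ⟨if w.length = 1 then 1 else 0, fun h => if_neg (by omega)⟩

theorem projGen_rel {n : ℕ} {p : ℤ} {x y : Ex k n p} (h : Rel k x y) :
    OpExpr.eval (AssocPlus k) (projGen k) x = OpExpr.eval (AssocPlus k) (projGen k) y := by
  induction h with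
  | assoc => rfl
  | d_m => rfl
  | d_j => rfl
  | p_unit => rfl
  | p_arg => rfl
  | p_args hn hw ha hq =>
    apply Subtype.ext
    simp only [OpExpr.eval, projGen, List.length_replicate]
    exact if_neg (by omega)
  | @d_p a q q' w hw ha hq h hq' =>
    by_cases h0 : q' = 0
    · obtain ⟨x, y, rfl⟩ : ∃ x y, w = [x, y] := by
        rw [← List.length_eq_two]
        omega
      apply Subtype.ext
      subst h0
      cases x <;> cases y <;>
      · change (0 : k) = sgn k _ * (1 * 1 * 1) + 0 + (_ + 0)
        simp [sgn, mergeTerm, OpExpr.eval, projGen, merge, AssocPlus]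
    · apply Subtype.ext
      rw [Subtype.prop (OpExpr.eval (AssocPlus k) (projGen k) (dP k w ha hq')) h0]
      rfl

/-- The natural map of dg operads from `O'` to the operad of unital associative algebras. -/
def proj : Hom (OPrime k) (AssocPlus k) :=
  presentedLift (AssocPlus k) (projGen k) (projGen_rel k)

end OPrime

/-!
The operad `O'` is computed by means of an explicit basis, and its cohomology by a contraction that
is written down in this basis.

*The basis.* A letter is either a leaf, which stands for an operadic argument, or a bracket `[e₁ | …
| eₙ]`, which stands for `p_n(e₁, …, eₙ)`; the entries of a bracket are the formal unit `1` or words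
of letters, and a word stands for the product of its letters under `m`. By the relations, every
operation is a linear combination of nonempty words in which all the brackets contain a formal unit
as one of their entries and no entry is an empty word (`span_wordOps`): differentials of generators
are expressed through composites of generators, products can be rebracketed, `j` is the bracket
`[1]`, and `p_n(f₁, …, fₙ)` is `f₁` or zero. In order to see that these words are linearly
independent, the free module `X` on all words is made into a dg algebra. The differential of a
bracket is prescribed by the relation for `d p_n`: it is the differential `dY` of the bar
construction, followed by the map `tau` that evaluates brackets, plus the sum of the products of the
two parts into which the bracket can be cut. It squares to zero (`dX_dX`) because `tau` is a
twisting cochain (`dX_tauWord`). The generators of `O'` act on `X`, and the relations hold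
(`genEnd_rel`). The value of an operation at the leaves, `ev`, gives back the word by which the
operation is described, up to a sign; hence `ev` is injective (`ev_injective`), and `O'(n)` is
isomorphic to the subcomplex of `X` spanned by the basis words with `n` leaves.

*The contraction.* The homotopy moves the letters to the right of the first bracket into it: `v [l]
w ↦ ± v [l | w]`. The map `lowering`, which is the identity minus the commutator of the differential
and the homotopy, sends a word to a combination of words that are smaller in a well-founded order
(`lowering_mem_lowerSpan`): they contain fewer formal units, or there are fewer formal units in a
certain part of the first bracket. The only exceptions are the words `x₁ ⋯ xₙ` and `x₁ ⋯ xₙ j`,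
which are fixed, and words whose last letter is a bracket, other than `j`, that ends with a formal
unit. The latter are avoided, since a cocycle `z` is cohomologous to `z j`, by means of `p_2(z, 1)`
(`dX_coneMap`). So every cocycle is cohomologous to a combination of `x₁ ⋯ xₙ` and `x₁ ⋯ xₙ j`, and
these two are cohomologous to each other for the same reason (`mem_productsAndBoundaries`). Hence
the cohomology of `O'(n)` is spanned by the class of the `n`-fold product, which `P` maps to the
generator of `Assoc₊(n)`.
-/

namespace OPrime

section

/-! ### Signs -/

section Sign

variable (k : Type u) [CommRing k]

theorem sgn_zero : sgn k 0 = 1 := by simp [sgn]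

theorem sgn_one : sgn k 1 = -1 := by simp [sgn]

theorem sgn_add (a b : ℤ) : sgn k (a + b) = sgn k a * sgn k b := by
  simp [sgn, Int.negOnePow_add]

theorem sgn_neg (a : ℤ) : sgn k (-a) = sgn k a := by
  simp [sgn, Int.negOnePow_neg]

theorem sgn_mul_self (a : ℤ) : sgn k a * sgn k a = 1 := by
  rw [← sgn_add, sgn, Int.negOnePow_even _ ⟨a, rfl⟩]
  simp

theorem sgn_add_one (a : ℤ) : sgn k (a + 1) = -sgn k a := by
  rw [sgn_add, sgn_one, mul_neg_one]

theorem sgn_sub_one (a : ℤ) : sgn k (a - 1) = -sgn k a := by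
  rw [sub_eq_add_neg, sgn_add, sgn_neg, sgn_one, mul_neg_one]

theorem sgn_congr {a b : ℤ} (h : Even (a - b)) : sgn k a = sgn k b := by
  obtain ⟨c, hc⟩ := h
  obtain rfl : a = b + (c + c) := by omega
  rw [sgn_add, sgn_add, sgn_mul_self, mul_one]

end Sign

/-! ### Word algebras -/

/-- The free associative algebra on the alphabet `α`, with basis the words in `α`. -/
abbrev WordAlg (k : Type u) [CommRing k] (α : Type) : Type u := MonoidAlgebra k (FreeMonoid α)

section WordAlg

variable {k : Type u} [CommRing k] {α : Type}

/-- The basis element of the word algebra given by a word. -/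
noncomputable def wd (l : List α) : WordAlg k α := MonoidAlgebra.of k (FreeMonoid α)
    (FreeMonoid.ofList l)

theorem wd_nil : wd (k := k) ([] : List α) = 1 := rfl

theorem wd_append (l l' : List α) : wd (k := k) (l ++ l') = wd l * wd l' := by
  simp [wd, FreeMonoid.ofList_append]

theorem wd_cons (a : α) (l : List α) : wd (k := k) (a :: l) = wd [a] * wd l := wd_append [a] l

/-- The words form a basis of the word algebra. -/
noncomputable def wdBasis (k : Type u) [CommRing k] (α : Type) : Module.Basis (List α) k
    (WordAlg k α) :=
  (MonoidAlgebra.basis (FreeMonoid α) k).reindex FreeMonoid.toList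

theorem wdBasis_apply (l : List α) : wdBasis k α l = wd l := by
  simp [wdBasis, wd]

theorem wd_induction {C : WordAlg k α → Prop} (h : ∀ l, C (wd l))
    (hadd : ∀ x y, C x → C y → C (x + y)) (hsmul : ∀ (c : k) x, C x → C (c • x)) (x) : C x := by
  have hx : x ∈ Submodule.span k (Set.range (wdBasis k α)) := by
    rw [Module.Basis.span_eq]
    trivial
  refine Submodule.span_induction (p := fun x _ => C x) ?_ ?_ (fun x y _ _ => hadd x y)
    (fun c x _ => hsmul c x) hx
  · rintro _ ⟨l, rfl⟩
    rw [wdBasis_apply]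
    exact h l
  · simpa using hsmul 0 _ (h [])

variable {M : Type*} [AddCommGroup M] [Module k M]

/-- The linear map on the word algebra with prescribed values on words. -/
noncomputable def lin (f : List α → M) : WordAlg k α →ₗ[k] M := (wdBasis k α).constr k f

@[simp]
theorem lin_wd (f : List α → M) (l : List α) : lin f (wd (k := k) l) = f l := by
  rw [lin, ← wdBasis_apply, Module.Basis.constr_basis]

theorem lin_ext {f g : WordAlg k α →ₗ[k] M} (h : ∀ l, f (wd l) = g (wd l)) : f = g :=
  (wdBasis k α).ext fun l => by simpa [wdBasis_apply] using h l

/-- The span of the words that satisfy `P`. -/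
noncomputable def spanWd (k : Type u) [CommRing k] (P : List α → Prop) : Submodule k
    (WordAlg k α) :=
  Submodule.span k (wd '' {l | P l})

theorem wd_mem_spanWd {P : List α → Prop} {l : List α} (h : P l) : wd l ∈ spanWd k P :=
  Submodule.subset_span ⟨l, h, rfl⟩

theorem map_mem_of_mem_spanWd {P : List α → Prop} {N : Submodule k M} {f : WordAlg k α →ₗ[k] M}
    (h : ∀ l, P l → f (wd l) ∈ N) {x : WordAlg k α} (hx : x ∈ spanWd k P) : f x ∈ N := by
  have : spanWd k P ≤ N.comap f := by
    rw [spanWd, Submodule.span_le]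
    rintro _ ⟨l, hl, rfl⟩
    exact h l hl
  exact this hx

theorem map_eq_of_mem_spanWd {P : List α → Prop} {f g : WordAlg k α →ₗ[k] M}
    (h : ∀ l, P l → f (wd l) = g (wd l)) {x : WordAlg k α} (hx : x ∈ spanWd k P) : f x = g x := by
  have := map_mem_of_mem_spanWd (N := ⊥) (f := f - g) (fun l hl => by simp [h l hl]) hx
  simpa [sub_eq_zero] using this

theorem spanWd_mono {P Q : List α → Prop} (h : ∀ l, P l → Q l) : spanWd k P ≤ spanWd k Q :=
  Submodule.span_mono (Set.image_mono fun l => h l)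

/-- The sum of the degrees of the letters of a word. -/
def wdeg (deg : α → ℤ) (l : List α) : ℤ := (l.map deg).sum

@[simp] theorem wdeg_nil (deg : α → ℤ) : wdeg deg [] = 0 := rfl

@[simp] theorem wdeg_cons (deg : α → ℤ) (a : α) (l : List α) :
    wdeg deg (a :: l) = deg a + wdeg deg l := by simp [wdeg]

@[simp] theorem wdeg_append (deg : α → ℤ) (l l' : List α) :
    wdeg deg (l ++ l') = wdeg deg l + wdeg deg l' := by simp [wdeg]

/-- The parity automorphism of the word algebra of a graded alphabet. -/
noncomputable def par (deg : α → ℤ) : WordAlg k α →ₗ[k] WordAlg k α :=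
  lin fun l => sgn k (wdeg deg l) • wd l

theorem par_wd (deg : α → ℤ) (l : List α) :
    par deg (wd (k := k) l) = sgn k (wdeg deg l) • wd l := lin_wd _ _

theorem par_mul (deg : α → ℤ) (x y : WordAlg k α) : par deg (x * y) = par deg x * par deg y := by
  induction x using wd_induction with
  | h l =>
    induction y using wd_induction with
    | h l' =>
      rw [← wd_append, par_wd, par_wd, par_wd, wdeg_append, sgn_add, wd_append, smul_mul_smul_comm]
    | hadd x y hx hy => rw [mul_add, map_add, map_add, mul_add, hx, hy]
    | hsmul c x hx => rw [mul_smul_comm, map_smul, map_smul, mul_smul_comm, hx]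
  | hadd x y hx hy => rw [add_mul, map_add, map_add, add_mul, hx, hy]
  | hsmul c x hx => rw [smul_mul_assoc, map_smul, map_smul, smul_mul_assoc, hx]

theorem par_par (deg : α → ℤ) (x : WordAlg k α) : par deg (par deg x) = x := by
  induction x using wd_induction with
  | h l => rw [par_wd, map_smul, par_wd, smul_smul, sgn_mul_self, one_smul]
  | hadd x y hx hy => rw [map_add, map_add, hx, hy]
  | hsmul c x hx => rw [map_smul, map_smul, hx]

/-- The values on words of the derivation of the word algebra extending `δ`. -/
noncomputable def derWord (deg : α → ℤ) (δ : α → WordAlg k α) : List α → WordAlg k α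
  | [] => 0
  | a :: l => δ a * wd l + sgn k (deg a) • (wd [a] * derWord deg δ l)

/-- The odd derivation of the word algebra with prescribed values on the letters: it satisfies the
Leibniz rule `der_mul`, in which the sign is carried by `par`. -/
noncomputable def der (deg : α → ℤ) (δ : α → WordAlg k α) : WordAlg k α →ₗ[k] WordAlg k α :=
  lin (derWord deg δ)

theorem der_one (deg : α → ℤ) (δ : α → WordAlg k α) : der deg δ 1 = 0 := by
  rw [← wd_nil, der, lin_wd, derWord]

theorem der_letter (deg : α → ℤ) (δ : α → WordAlg k α) (a : α) : der deg δ (wd [a]) = δ a := by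
  rw [der, lin_wd, derWord, derWord, wd_nil]
  simp

theorem der_mul (deg : α → ℤ) (δ : α → WordAlg k α) (x y : WordAlg k α) :
    der deg δ (x * y) = der deg δ x * y + par deg x * der deg δ y := by
  induction x using wd_induction with
  | h l =>
    induction y using wd_induction with
    | h l' =>
      rw [← wd_append, par_wd]
      induction l with
      | nil => rw [List.nil_append, wd_nil, der_one, wdeg_nil, sgn_zero]; simp
      | cons a l ih =>
        simp only [der, lin_wd, List.cons_append, derWord] at ih ⊢
        rw [ih, wd_append, wd_cons a l, wdeg_cons, sgn_add]
        simp only [mul_add, add_mul, smul_add, smul_mul_assoc, mul_smul_comm, mul_assoc, mul_smul]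
        rw [add_assoc]
    | hadd x y hx hy =>
      rw [mul_add, map_add, map_add, hx, hy, mul_add, mul_add]
      abel
    | hsmul c x hx => rw [mul_smul_comm, map_smul, hx, map_smul]; simp
  | hadd x y hx hy =>
    rw [add_mul, map_add, map_add, hx, hy, map_add, add_mul, add_mul]
    abel
  | hsmul c x hx => rw [smul_mul_assoc, map_smul, hx, map_smul, map_smul]; simp

theorem par_der (deg : α → ℤ) (δ : α → WordAlg k α)
    (hδ : ∀ a, par deg (δ a) = -(sgn k (deg a) • δ a)) (x : WordAlg k α) :
    par deg (der deg δ x) = -der deg δ (par deg x) := by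
  induction x using wd_induction with
  | h l =>
    induction l with
    | nil => simp [der, derWord, par_wd]
    | cons a l ih =>
      rw [wd_cons, der_mul, map_add, par_mul, par_mul, par_par, ih, der_letter, hδ, par_mul,
        der_mul, par_par, par_wd deg [a], map_smul, der_letter]
      simp only [neg_mul, mul_neg, neg_add, wdeg_cons, wdeg_nil, add_zero]
  | hadd x y hx hy => rw [map_add, map_add, map_add, map_add, hx, hy, neg_add]
  | hsmul c x hx => rw [map_smul, map_smul, map_smul, map_smul, hx, smul_neg]

/-- The square of an odd derivation is a derivation, so that it vanishes on a word if it vanishes on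
the letters. The hypothesis `hδ` says that `δ` has odd degree. -/
theorem der_der (deg : α → ℤ) (δ : α → WordAlg k α)
    (hδ : ∀ a, par deg (δ a) = -(sgn k (deg a) • δ a)) (l : List α)
    (hd : ∀ a ∈ l, der deg δ (δ a) = 0) : der deg δ (der deg δ (wd l)) = 0 := by
  induction l with
  | nil => simp [wd_nil, der_one]
  | cons a l ih =>
    rw [wd_cons, der_mul, map_add, der_mul, der_mul, der_letter, par_par, hd a (by simp),
      ih fun b hb => hd b (by simp [hb]), par_wd, map_smul, der_letter, hδ]
    simp

end WordAlg

/-! ### Sums over deconcatenations -/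

section Decon

variable {α M N : Type*} [AddCommGroup M] [AddCommGroup N]

/-- The sum of `f u v` over all the ways to write a word as a concatenation `u v`. -/
def decon : (f : List α → List α → M) → List α → M
  | f, [] => f [] []
  | f, a :: l => f [] (a :: l) + decon (fun u v => f (a :: u) v) l

theorem decon_congr {f g : List α → List α → M} {l : List α}
    (h : ∀ u v, u ++ v = l → f u v = g u v) :
    decon f l = decon g l := by
  induction l generalizing f g with
  | nil => exact h _ _ rfl
  | cons a l ih =>
    simp only [decon]
    rw [h [] (a :: l) rfl, ih fun u v e => h (a :: u) v (by rw [← e]; rfl)]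

theorem decon_add (f g : List α → List α → M) (l : List α) :
    decon (fun u v => f u v + g u v) l = decon f l + decon g l := by
  induction l generalizing f g with
  | nil => rfl
  | cons a l ih => simp only [decon, ih]; abel

theorem decon_map {F : Type*} [FunLike F M N] [AddMonoidHomClass F M N] (φ : F)
    (f : List α → List α → M) (l : List α) :
    decon (fun u v => φ (f u v)) l = φ (decon f l) := by
  induction l generalizing f with
  | nil => rfl
  | cons a l ih => simp only [decon, ih, map_add]

theorem decon_smul {R : Type*} [Monoid R] [DistribMulAction R M] (c : R)
    (f : List α → List α → M) (l : List α) :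
    decon (fun u v => c • f u v) l = c • decon f l :=
  decon_map (DistribSMul.toAddMonoidHom M c) f l

theorem decon_zero (l : List α) : decon (fun _ _ => (0 : M)) l = 0 := by
  induction l with
  | nil => rfl
  | cons a l ih => simp [decon, ih]

/-- Coassociativity of deconcatenation. -/
theorem decon_assoc (f : List α → List α → List α → M) (l : List α) :
    decon (fun u v => decon (fun u₁ u₂ => f u₁ u₂ v) u) l
      = decon (fun u v => decon (fun v₁ v₂ => f u v₁ v₂) v) l := by
  induction l generalizing f with
  | nil => rfl
  | cons a l ih =>
    simp only [decon]
    rw [decon_add, ih, add_assoc]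

theorem decon_concat (f : List α → List α → M) (l : List α) (a : α) :
    decon f (l ++ [a]) = decon (fun u v => f u (v ++ [a])) l + f (l ++ [a]) [] := by
  induction l generalizing f with
  | nil => simp [decon]
  | cons b l ih => simp only [List.cons_append, decon, ih]; abel

theorem decon_eq_sum (f : List α → List α → M) (l : List α) :
    decon f l = ∑ i ∈ Finset.range (l.length + 1), f (l.take i) (l.drop i) := by
  induction l generalizing f with
  | nil => simp [decon]
  | cons a l ih =>
    rw [decon, ih, List.length_cons, Finset.sum_range_succ' _ (l.length + 1), add_comm]
    rfl

theorem decon_mem {S : Type*} [SetLike S M] [AddSubmonoidClass S M] (s : S)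
    {f : List α → List α → M} {l : List α} (h : ∀ u v, u ++ v = l → f u v ∈ s) : decon f l ∈ s := by
  induction l generalizing f with
  | nil => exact h _ _ rfl
  | cons a l ih =>
    exact add_mem (h [] (a :: l) rfl) (ih fun u v e => h (a :: u) v (by rw [← e]; rfl))

end Decon

end

section

/-! ### Words and brackets -/

/-- The letters of the normal forms of operations: a leaf stands for an operadic argument, and the
bracket `br [e₁, …, eₙ]` for `p_n(e₁, …, eₙ)`, whose entries are the formal unit (`none`) or words
(`some w`). A word stands for the product of its letters under `m`. -/
inductive Atom : Type
  | leaf : Atom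
  | br (l : List (Option (List Atom))) : Atom

/-- The entries of brackets: the formal unit, or a word. -/
abbrev Entry : Type := Option (List Atom)

section Stat

variable {M : Type*} [AddCommMonoid M] (x b o a : M)

mutual
/-- The weight of a letter in which each leaf counts for `x`, each bracket for `b`, each formal unit
for `o`, and each word in a bracket for `a`, at all levels of nesting. -/
def Atom.stat : Atom → M
  | .leaf => x
  | .br l => b + barStat l
/-- The weight of a word: the sum of the weights of its letters. -/
def wordStat : List Atom → M
  | [] => 0
  | c :: w => Atom.stat c + wordStat w
/-- The weight of the list of entries of a bracket. -/
def barStat : List Entry → M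
  | [] => 0
  | none :: l => o + barStat l
  | some w :: l => (a + wordStat w) + barStat l
end

theorem wordStat_append (w w' : List Atom) :
    wordStat x b o a (w ++ w') = wordStat x b o a w + wordStat x b o a w' := by
  induction w with
  | nil => simp [wordStat]
  | cons c w ih => simp [wordStat, ih, add_assoc]

theorem barStat_append (l l' : List Entry) :
    barStat x b o a (l ++ l') = barStat x b o a l + barStat x b o a l' := by
  induction l with
  | nil => simp [barStat]
  | cons c w ih => cases c <;> simp [barStat, ih, add_assoc]

end Stat

/-- Simultaneous induction on letters, lists of entries, and words. -/
theorem Atom.induction {P₁ : Atom → Prop} {P₂ : List Entry → Prop} {P₃ : List Atom → Prop}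
    (leaf : P₁ .leaf) (br : ∀ l, P₂ l → P₁ (.br l)) (nil₂ : P₂ [])
    (none₂ : ∀ l, P₂ l → P₂ (none :: l)) (some₂ : ∀ w l, P₃ w → P₂ l → P₂ (some w :: l))
    (nil₃ : P₃ []) (cons₃ : ∀ a w, P₁ a → P₃ w → P₃ (a :: w)) :
    (∀ a, P₁ a) ∧ (∀ l, P₂ l) ∧ ∀ w, P₃ w :=
  ⟨Atom.stat.induct P₁ P₂ P₃ leaf br nil₂ none₂ some₂ nil₃ cons₃,
    barStat.induct P₁ P₂ P₃ leaf br nil₂ none₂ some₂ nil₃ cons₃,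
    wordStat.induct P₁ P₂ P₃ leaf br nil₂ none₂ some₂ nil₃ cons₃⟩

/-- The degree of a letter: `0` for a leaf, and `1 + ∑ (|eᵢ| - 1)` for the bracket of `e₁, …, eₙ`,
where the formal unit has degree `0`. -/
abbrev Atom.deg (a : Atom) : ℤ := Atom.stat 0 1 (-1) (-1) a

/-- The degree of an entry of a bracket, in the suspension. -/
def sdeg : Entry → ℤ
  | none => -1
  | some w => wdeg Atom.deg w - 1

theorem wordStat_eq_wdeg (w : List Atom) : wordStat 0 1 (-1) (-1) w = wdeg Atom.deg w := by
  induction w with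
  | nil => rfl
  | cons a w ih => rw [wordStat, ih, wdeg_cons]

theorem barStat_eq_wdeg (l : List Entry) : barStat 0 1 (-1) (-1) l = wdeg sdeg l := by
  induction l with
  | nil => rfl
  | cons e l ih =>
    cases e with
    | none => rw [barStat, ih, wdeg_cons, sdeg]
    | some w => rw [barStat, ih, wdeg_cons, sdeg, wordStat_eq_wdeg]; ring

theorem deg_leaf : Atom.deg .leaf = 0 := rfl

theorem deg_br (l : List Entry) : Atom.deg (.br l) = wdeg sdeg l + 1 := by
  rw [Atom.deg, Atom.stat, barStat_eq_wdeg, add_comm]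

variable (k : Type u) [CommRing k]

/-- The algebra of words of letters. All brackets are allowed as letters, including those without
formal units and those with empty words, so that the formulas for the differential need no case
distinctions. -/
abbrev X : Type u := WordAlg k Atom

/-- The free module on lists of entries of brackets: the bar construction of the words with a formal
unit added. -/
abbrev Y : Type u := WordAlg k Entry

variable {k}

/-- The product of two entries of a bracket. -/
def emul : Entry → Entry → Entry
  | none, e => e
  | some w, none => some w
  | some w, some w' => some (w ++ w')

theorem emul_assoc (a b c : Entry) : emul (emul a b) c = emul a (emul b c) := by
  cases a <;> cases b <;> cases c <;> simp [emul]

theorem sdeg_emul (a b : Entry) : sdeg (emul a b) = sdeg a + sdeg b + 1 := by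
  cases a <;> cases b <;> simp [emul, sdeg]; ring

/-! ### The differential of the algebra of words -/

/-- Multiplication of the first entry of a bracket by a given entry, on basis elements. -/
noncomputable def joinWord (e : Entry) : List Entry → Y k
  | [] => 0
  | e' :: l => wd (emul e e' :: l)

/-- Multiplication of the first entry of a bracket by a given entry; it is zero on the empty list.
-/
noncomputable def join (e : Entry) : Y k →ₗ[k] Y k := lin (joinWord e)

/-- The inclusion of words as lists with one entry. -/
noncomputable def inc : X k →ₗ[k] Y k := lin fun w => wd [some w]

open Classical in
/-- The value `p_n(e₁, …, eₙ)` of a bracket, according to the relations of `O'`: a list with a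
formal unit becomes a letter, a list with a single word is evaluated to that word, and all the other
lists have the value zero. -/
noncomputable def tauWord (l : List Entry) : X k :=
  if none ∈ l then wd [.br l] else
    match l with
    | [some w] => wd w
    | _ => 0

theorem tauWord_of_mem {l : List Entry} (h : none ∈ l) : tauWord (k := k) l = wd [.br l] := if_pos h

theorem tauWord_nil : tauWord (k := k) [] = 0 := by simp [tauWord]

theorem tauWord_single (w : List Atom) : tauWord (k := k) [some w] = wd w := by simp [tauWord]

theorem tauWord_cons_cons {e e' : Entry} {l : List Entry} (h : none ∉ e :: e' :: l) :
    tauWord (k := k) (e :: e' :: l) = 0 :=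
  (if_neg h).trans (by cases e <;> rfl)

/-- The evaluation of brackets. With the sign conventions of the bar construction, it is a twisting
cochain (`dX_tau`). -/
noncomputable def tau : Y k →ₗ[k] X k := lin tauWord

/-- The part of the differential of a bracket that cuts it into two brackets. The cuts with an empty
part do not contribute, because `tauWord [] = 0`. -/
noncomputable def cut (l : List Entry) : X k :=
  decon (fun u v => sgn k (wdeg sdeg u + 1) • (tauWord u * tauWord v)) l

mutual
/-- The differential of a letter. -/
noncomputable def dAtom : Atom → X k
  | .leaf => 0
  | .br l => tau (dBar l) + cut l
/-- The differential of a word. -/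
noncomputable def dWord : List Atom → X k
  | [] => 0
  | a :: w => dAtom a * wd w + sgn k a.deg • (wd [a] * dWord w)
/-- The part of the differential of a bracket given by the differential of the bar construction: the
differentials of the entries, and the products of adjacent entries. -/
noncomputable def dBar : List Entry → Y k
  | [] => 0
  | none :: l => sgn k (-1) • (joinWord none l + wd [none] * dBar l)
  | some w :: l => inc (dWord w) * wd l
      + sgn k (wdeg Atom.deg w - 1) • (joinWord (some w) l + wd [some w] * dBar l)
end

/-- The differential of the algebra of words. -/
noncomputable def dX : X k →ₗ[k] X k := der Atom.deg dAtom

theorem dWord_eq (w : List Atom) : dWord (k := k) w = dX (wd w) := by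
  rw [dX, der, lin_wd]
  induction w with
  | nil => rfl
  | cons a w ih => rw [dWord, derWord, ih]

/-- The differential of an entry of a bracket. -/
noncomputable def dEntry : Entry → Y k
  | none => 0
  | some w => inc (dX (wd w))

/-- The differential of the bar construction. -/
noncomputable def dY : Y k →ₗ[k] Y k := lin dBar

theorem dBar_eq (l : List Entry) : dBar (k := k) l = dY (wd l) := by rw [dY, lin_wd]

theorem dY_one : dY (1 : Y k) = 0 := by rw [← wd_nil, dY, lin_wd, dBar]

theorem tau_wd (l : List Entry) : tau (wd (k := k) l) = tauWord l := lin_wd _ _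

theorem inc_wd (w : List Atom) : inc (wd (k := k) w) = wd [some w] := lin_wd _ _

theorem join_one (e : Entry) : join e (1 : Y k) = 0 := by rw [← wd_nil, join, lin_wd, joinWord]

theorem join_cons (e e' : Entry) (y : Y k) : join e (wd [e'] * y) = wd [emul e e'] * y := by
  induction y using wd_induction with
  | h l => rw [← wd_append, join, lin_wd, ← wd_append]; rfl
  | hadd x y hx hy => rw [mul_add, map_add, hx, hy, mul_add]
  | hsmul c x hx => rw [mul_smul_comm, map_smul, hx, mul_smul_comm]

theorem dY_cons (e : Entry) (y : Y k) :
    dY (wd [e] * y) = dEntry e * y + sgn k (sdeg e) • (join e y + wd [e] * dY y) := by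
  induction y using wd_induction with
  | h l =>
    rw [← wd_append, dY, lin_wd, join, lin_wd, lin_wd]
    cases e with
    | none => simp [dBar, dEntry, sdeg]
    | some w => simp only [List.cons_append, List.nil_append, dBar, dEntry, sdeg, dWord_eq]
  | hadd x y hx hy =>
    rw [mul_add, map_add, hx, hy, mul_add, map_add, map_add, mul_add]
    simp only [smul_add]
    abel
  | hsmul c x hx =>
    rw [mul_smul_comm, map_smul, hx, map_smul, map_smul, mul_smul_comm, mul_smul_comm]
    simp only [smul_add, smul_comm c]

theorem dX_mul (x y : X k) : dX (x * y) = dX x * y + par Atom.deg x * dX y := der_mul _ _ _ _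

/-! ### Parity of the differential -/

theorem par_join (e : Entry) (y : Y k) :
    par sdeg (join e y) = -(sgn k (sdeg e) • join e (par sdeg y)) := by
  induction y using wd_induction with
  | h l =>
    rw [par_wd, map_smul, join, lin_wd]
    cases l with
    | nil => simp [joinWord]
    | cons e' l =>
      rw [joinWord, par_wd, wdeg_cons, wdeg_cons, sdeg_emul, smul_smul, ← neg_smul, ← sgn_add,
        ← sgn_add_one]
      congr 2; ring
  | hadd x y hx hy => simp only [map_add, hx, hy, smul_add, neg_add]
  | hsmul c x hx => simp only [map_smul, hx, smul_neg, smul_comm c]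

theorem par_inc (x : X k) : par sdeg (inc x) = -inc (par Atom.deg x) := by
  induction x using wd_induction with
  | h l =>
    rw [par_wd, map_smul, inc_wd, par_wd, wdeg_cons, sdeg, wdeg_nil, add_zero, sgn_sub_one,
      neg_smul]
  | hadd x y hx hy => simp only [map_add, hx, hy, neg_add]
  | hsmul c x hx => simp only [map_smul, hx, smul_neg]

theorem par_tau (y : Y k) : par Atom.deg (tau y) = -tau (par sdeg y) := by
  induction y using wd_induction with
  | h l =>
    rw [par_wd, map_smul, tau_wd]
    by_cases h : none ∈ l
    · rw [tauWord_of_mem h, par_wd, wdeg_cons, wdeg_nil, deg_br, add_zero, sgn_add_one, neg_smul]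
    · rcases l with _ | ⟨_ | w, _ | ⟨e, l⟩⟩
      · simp [tauWord_nil]
      · simp at h
      · simp at h
      · rw [tauWord_single, par_wd, wdeg_cons, wdeg_nil, sdeg, add_zero, sgn_sub_one, neg_smul,
          neg_neg]
      · simp [tauWord_cons_cons h]
  | hadd x y hx hy => simp only [map_add, hx, hy, neg_add]
  | hsmul c x hx => simp only [map_smul, hx, smul_neg]

theorem par_tauWord (l : List Entry) :
    par Atom.deg (tauWord (k := k) l) = sgn k (wdeg sdeg l + 1) • tauWord l := by
  rw [← tau_wd, par_tau, par_wd, map_smul, sgn_add_one, neg_smul]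

theorem par_cut (l : List Entry) :
    par Atom.deg (cut (k := k) l) = sgn k (wdeg sdeg l) • cut l := by
  rw [cut, ← decon_map, ← decon_smul]
  refine decon_congr fun u v e => ?_
  rw [map_smul, par_mul, par_tauWord, par_tauWord, smul_mul_smul_comm, ← e, wdeg_append, smul_comm,
    smul_smul, smul_smul, ← sgn_add, ← sgn_add, ← sgn_add]
  congr 1
  exact sgn_congr k ⟨1, by ring⟩

theorem par_dAtom_dY : (∀ a, par Atom.deg (dAtom (k := k) a) = -(sgn k a.deg • dAtom a)) ∧
    (∀ l, par sdeg (dY (wd (k := k) l)) = -(sgn k (wdeg sdeg l) • dY (wd l))) ∧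
    ∀ w, par Atom.deg (dX (wd (k := k) w)) = -(sgn k (wdeg Atom.deg w) • dX (wd w)) := by
  refine Atom.induction ?_ ?_ ?_ ?_ ?_ ?_ ?_
  · simp [dAtom]
  · intro l ih
    rw [dAtom, dBar_eq, map_add, par_tau, ih, par_cut, deg_br, sgn_add_one, map_neg, map_smul]
    module
  · simp [wd_nil, dY_one]
  · intro l ih
    rw [wd_cons, dY_cons, dEntry, zero_mul, zero_add, map_smul, map_add, par_mul, ih, par_join,
      par_wd, par_wd, wdeg_cons, wdeg_cons, wdeg_nil, add_zero, sgn_add, map_smul]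
    simp only [smul_mul_assoc, mul_neg, mul_smul_comm]
    module
  · intro w l ih ih'
    rw [wd_cons, dY_cons, dEntry, map_add, map_smul, map_add, par_mul, par_mul, par_inc, ih, ih',
      par_join, par_wd, par_wd, wdeg_cons, wdeg_cons, wdeg_nil, add_zero, sgn_add, map_smul,
      map_neg, map_smul, sdeg, sgn_sub_one]
    simp only [smul_mul_assoc, mul_neg, mul_smul_comm, neg_mul]
    module
  · simp [wd_nil, dX, der_one]
  · intro a w ih ih'
    rw [← dWord_eq, dWord, dWord_eq, map_add, par_mul, ih, map_smul, par_mul, ih', par_wd, par_wd,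
      wdeg_cons, wdeg_cons, wdeg_nil, add_zero, sgn_add]
    simp only [smul_mul_assoc, mul_neg, mul_smul_comm, neg_mul]
    module

theorem par_dAtom (a : Atom) : par Atom.deg (dAtom (k := k) a) = -(sgn k a.deg • dAtom a) :=
  par_dAtom_dY.1 a

theorem par_dX (x : X k) : par Atom.deg (dX x) = -dX (par Atom.deg x) := par_der _ _ par_dAtom x

theorem par_dY (y : Y k) : par sdeg (dY y) = -dY (par sdeg y) := by
  induction y using wd_induction with
  | h l => rw [par_wd, map_smul, par_dAtom_dY.2.1]
  | hadd x y hx hy => simp only [map_add, hx, hy, neg_add]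
  | hsmul c x hx => simp only [map_smul, hx, smul_neg]

/-! ### The differential squares to zero -/

/-- Multiplication of the first entry of a bracket by an element of the algebra of words. -/
noncomputable def joinLin : X k →ₗ[k] Y k →ₗ[k] Y k := lin fun w => join (some w)

theorem joinLin_wd (w : List Atom) : joinLin (wd (k := k) w) = join (some w) := lin_wd _ _

theorem joinLin_some (x : X k) (w : List Atom) (y : Y k) :
    joinLin x (wd [some w] * y) = inc (x * wd w) * y := by
  induction x using wd_induction with
  | h l => rw [joinLin_wd, join_cons, ← wd_append, inc_wd]; rfl
  | hadd x x' hx hx' => simp only [map_add, add_mul, LinearMap.add_apply, hx, hx']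
  | hsmul c x hx => simp only [map_smul, smul_mul_assoc, LinearMap.smul_apply, hx]

theorem joinLin_one (x : X k) : joinLin x 1 = 0 := by
  induction x using wd_induction with
  | h l => rw [joinLin_wd, join_one]
  | hadd x x' hx hx' => simp only [map_add, LinearMap.add_apply, hx, hx', add_zero]
  | hsmul c x hx => simp only [map_smul, LinearMap.smul_apply, hx, smul_zero]

theorem joinLin_none (x : X k) (y : Y k) : joinLin x (wd [none] * y) = inc x * y := by
  induction x using wd_induction with
  | h l => rw [joinLin_wd, join_cons, inc_wd]; rfl
  | hadd x x' hx hx' => simp only [map_add, add_mul, LinearMap.add_apply, hx, hx']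
  | hsmul c x hx => simp only [map_smul, smul_mul_assoc, LinearMap.smul_apply, hx]

theorem join_some_inc (w : List Atom) (x : X k) (y : Y k) :
    join (some w) (inc x * y) = inc (wd w * x) * y := by
  induction x using wd_induction with
  | h l => rw [inc_wd, join_cons, ← wd_append, inc_wd]; rfl
  | hadd x x' hx hx' => simp only [map_add, add_mul, mul_add, hx, hx']
  | hsmul c x hx => simp only [map_smul, smul_mul_assoc, mul_smul_comm, hx]

theorem join_none_inc (x : X k) (y : Y k) : join none (inc x * y) = inc x * y := by
  induction x using wd_induction with
  | h l => rw [inc_wd, join_cons]; rfl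
  | hadd x x' hx hx' => simp only [map_add, add_mul, hx, hx']
  | hsmul c x hx => simp only [map_smul, smul_mul_assoc, hx]

theorem join_join (e e' : Entry) (y : Y k) : join e (join e' y) = join (emul e e') y := by
  induction y using wd_induction with
  | h l =>
    cases l with
    | nil => rw [wd_nil, join_one, join_one, map_zero]
    | cons f l => rw [wd_cons, join_cons, join_cons, join_cons, emul_assoc]
  | hadd x y hx hy => simp only [map_add, hx, hy]
  | hsmul c x hx => simp only [map_smul, hx]

theorem dY_inc (x : X k) (y : Y k) : dY (inc x * y)
    = inc (dX x) * y - (joinLin (par Atom.deg x) y + inc (par Atom.deg x) * dY y) := by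
  induction x using wd_induction with
  | h l =>
    rw [inc_wd, dY_cons, par_wd, map_smul, map_smul, LinearMap.smul_apply, joinLin_wd, inc_wd, sdeg,
      sgn_sub_one, neg_smul, smul_add, smul_mul_assoc, sub_eq_add_neg, dEntry]
  | hadd x x' hx hx' =>
    simp only [map_add, add_mul, LinearMap.add_apply, hx, hx']
    abel
  | hsmul c x hx =>
    simp only [map_smul, smul_mul_assoc, LinearMap.smul_apply, hx, smul_add, smul_sub]

/-- Multiplication of the first entry of a bracket by the differential of a given entry. -/
noncomputable def joinD : Entry → Y k →ₗ[k] Y k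
  | none => 0
  | some w => joinLin (dX (wd w))

theorem dEntry_emul (e e' : Entry) (y : Y k) : dEntry (emul e e') * y
    = joinD e (wd [e'] * y) - sgn k (sdeg e) • join e (dEntry e' * y) := by
  cases e with
  | none =>
    cases e' with
    | none => simp [emul, dEntry, joinD]
    | some w => simp [emul, dEntry, joinD, join_none_inc, sdeg, sgn_neg, sgn_one]
  | some w =>
    cases e' with
    | none => simp [emul, dEntry, joinD, joinLin_none]
    | some w' =>
      rw [emul, dEntry, joinD, dEntry, joinLin_some, join_some_inc, wd_append, dX_mul, par_wd, sdeg,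
        sgn_sub_one]
      simp [add_mul]

theorem dY_join (e : Entry) (y : Y k) :
    dY (join e y) = joinD e y - sgn k (sdeg e) • join e (dY y) := by
  induction y using wd_induction with
  | h l =>
    cases l with
    | nil =>
      rw [wd_nil, join_one, dY_one, map_zero, map_zero, smul_zero, sub_zero]
      cases e with
      | none => rfl
      | some w => rw [joinD, joinLin_one]
    | cons f l =>
      rw [wd_cons, join_cons, dY_cons, dY_cons, dEntry_emul, map_add, map_smul, map_add, join_join,
        join_cons, sdeg_emul, sgn_add_one, sgn_add]
      simp only [smul_add, smul_smul, neg_smul]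
      abel
  | hadd x y hx hy => simp only [map_add, hx, hy, smul_add]; abel
  | hsmul c x hx => simp only [map_smul, hx, smul_sub, smul_comm c]

theorem dY_dY_cons (e : Entry) (l : List Entry) (he : ∀ w, e = some w → dX (dX (wd (k := k) w)) = 0)
    (h : dY (dY (wd (k := k) l)) = 0) : dY (dY (wd (k := k) (e :: l))) = 0 := by
  rw [wd_cons, dY_cons, map_add, map_smul, map_add, dY_join, dY_cons, h]
  cases e with
  | none => simp [dEntry, joinD]
  | some w =>
    rw [dEntry, joinD, dY_inc, he w rfl, par_dX, par_wd]
    simp only [map_smul, map_neg, LinearMap.smul_apply, LinearMap.neg_apply, map_zero, zero_mul,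
      smul_mul_assoc, neg_mul, sdeg, sgn_sub_one, mul_zero, smul_add, smul_smul, mul_neg]
    module

end

section

/-! ### Cuts of brackets -/

variable {k : Type u} [CommRing k] {M : Type*} [AddCommGroup M] [Module k M]

/-- The sum of the values of a bilinear map on all the cuts of a bracket. -/
noncomputable def deconLin (F : Y k →ₗ[k] Y k →ₗ[k] M) : Y k →ₗ[k] M :=
  lin (decon fun u v => F (wd u) (wd v))

theorem deconLin_wd (F : Y k →ₗ[k] Y k →ₗ[k] M) (l : List Entry) :
    deconLin F (wd l) = decon (fun u v => F (wd u) (wd v)) l := lin_wd _ _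

theorem deconLin_cons (F : Y k →ₗ[k] Y k →ₗ[k] M) (e : Entry) (y : Y k) :
    deconLin F (wd [e] * y)
      = F 1 (wd [e] * y) + deconLin (F ∘ₗ LinearMap.mulLeft k (wd [e])) y := by
  induction y using wd_induction with
  | h l =>
    rw [← wd_cons, deconLin_wd, deconLin_wd, decon, wd_nil]
    congr 2
    funext u v
    rw [wd_cons e u]
    rfl
  | hadd x y hx hy => simp only [mul_add, map_add, hx, hy]; abel
  | hsmul c x hx => simp only [mul_smul_comm, map_smul, hx, smul_add]

theorem deconLin_add (F G : Y k →ₗ[k] Y k →ₗ[k] M) (y : Y k) :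
    deconLin (F + G) y = deconLin F y + deconLin G y := by
  have : deconLin (F + G) = deconLin F + deconLin G := lin_ext fun l => by
    rw [LinearMap.add_apply, deconLin_wd, deconLin_wd, deconLin_wd, ← decon_add]
    rfl
  rw [this, LinearMap.add_apply]

theorem deconLin_smul (c : k) (F : Y k →ₗ[k] Y k →ₗ[k] M) (y : Y k) :
    deconLin (c • F) y = c • deconLin F y := by
  have : deconLin (c • F) = c • deconLin F := lin_ext fun l => by
    rw [LinearMap.smul_apply, deconLin_wd, deconLin_wd, ← decon_smul]
    rfl
  rw [this, LinearMap.smul_apply]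

theorem deconLin_inc (F : Y k →ₗ[k] Y k →ₗ[k] M) (x : X k) (y : Y k) :
    deconLin F (inc x * y)
      = F 1 (inc x * y) + deconLin (F ∘ₗ LinearMap.mulLeft k (inc x)) y := by
  induction x using wd_induction with
  | h l => rw [inc_wd, deconLin_cons]
  | hadd x x' hx hx' =>
    have : F ∘ₗ LinearMap.mulLeft k (inc (x + x')) =
        F ∘ₗ LinearMap.mulLeft k (inc x) + F ∘ₗ LinearMap.mulLeft k (inc x') := by
      refine LinearMap.ext fun y => ?_
      simp [add_mul]
    rw [this, deconLin_add, map_add, add_mul, map_add, hx, hx', map_add]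
    abel
  | hsmul c x hx =>
    have : F ∘ₗ LinearMap.mulLeft k (inc (c • x)) = c • (F ∘ₗ LinearMap.mulLeft k (inc x)) := by
      refine LinearMap.ext fun y => ?_
      simp
    rw [this, deconLin_smul, map_smul, smul_mul_assoc, map_smul, hx, map_smul, smul_add]

theorem deconLin_dEntry (F : Y k →ₗ[k] Y k →ₗ[k] M) (e : Entry) (y : Y k) :
    deconLin F (dEntry e * y)
      = F 1 (dEntry e * y) + deconLin (F ∘ₗ LinearMap.mulLeft k (dEntry e)) y := by
  cases e with
  | some w => exact deconLin_inc F _ y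
  | none =>
    have : F ∘ₗ LinearMap.mulLeft k (0 : Y k) = (0 : k) • F := by
      refine LinearMap.ext fun y => ?_
      simp
    rw [dEntry, this, deconLin_smul]
    simp

theorem deconLin_join (F : Y k →ₗ[k] Y k →ₗ[k] M) (e : Entry) (l : List Entry) :
    deconLin F (join e (wd l))
      = F 1 (join e (wd l)) + decon (fun u v => F (join e (wd u)) (wd v)) l := by
  cases l with
  | nil => simp [wd_nil, join_one, decon]
  | cons e' l =>
    rw [wd_cons, join_cons, deconLin_cons, decon, wd_nil, join_one, map_zero, LinearMap.zero_apply,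
      zero_add, deconLin_wd]
    congr 2
    funext u v
    rw [wd_cons e' u, join_cons]
    rfl

/-- The differential of the bar construction is a coderivation of the deconcatenation. -/
theorem deconLin_dY (F : Y k →ₗ[k] Y k →ₗ[k] M) (l : List Entry) :
    deconLin F (dY (wd l)) = decon (fun u v => F (dY (wd u)) (wd v)
      + sgn k (wdeg sdeg u) • F (wd u) (dY (wd v))) l := by
  induction l generalizing F with
  | nil => simp [wd_nil, dY_one, decon]
  | cons e l ih =>
    rw [wd_cons, dY_cons, map_add, map_smul, map_add, deconLin_dEntry, deconLin_join, deconLin_cons,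
      ih, decon]
    have : ∀ u v : List Entry, F (dY (wd (e :: u))) (wd v)
        + sgn k (wdeg sdeg (e :: u)) • F (wd (e :: u)) (dY (wd v))
        = (F ∘ₗ LinearMap.mulLeft k (dEntry e)) (wd u) (wd v)
          + sgn k (sdeg e) • (F (join e (wd u)) (wd v)
            + ((F ∘ₗ LinearMap.mulLeft k (wd [e])) (dY (wd u)) (wd v)
            + sgn k (wdeg sdeg u) • (F ∘ₗ LinearMap.mulLeft k (wd [e])) (wd u) (dY (wd v)))) := by
      intro u v
      rw [wd_cons e u, dY_cons, wdeg_cons, sgn_add]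
      simp only [map_add, map_smul, LinearMap.add_apply, LinearMap.smul_apply, LinearMap.comp_apply,
        LinearMap.mulLeft_apply, smul_add, smul_smul]
      abel
    simp only [this]
    have key : ∀ (c : k) (A B C : List Entry → List Entry → M),
        decon (fun u v => A u v + c • (B u v + C u v)) l
          = decon A l + c • (decon B l + decon C l) := fun c A B C => by
      rw [decon_add, decon_smul, decon_add]
    rw [key, ← deconLin_wd, wd_nil, dY_one, wd_cons e l, dY_cons]
    simp only [map_add, map_smul, map_zero, LinearMap.zero_apply, wdeg_nil, sgn_zero, one_smul,
      smul_add]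
    abel

/-- The lists without formal units form a subcomplex, since no formal unit is ever created. -/
theorem dY_mem_of_args {l : List Entry} (h : none ∉ l) (h' : l ≠ []) :
    dY (wd l) ∈ spanWd k fun l' : List Entry => none ∉ l' ∧ l' ≠ [] := by
  induction l with
  | nil => exact absurd rfl h'
  | cons e l ih =>
    have hl : none ∉ l := fun hl => h (by simp [hl])
    rw [wd_cons, dY_cons]
    refine add_mem ?_ (Submodule.smul_mem _ _ (add_mem ?_ ?_))
    · cases e with
      | none => simp at h
      | some w =>
        rw [dEntry]
        generalize dX (wd (k := k) w) = x
        induction x using wd_induction with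
        | h v =>
          rw [inc_wd, ← wd_append]
          exact wd_mem_spanWd ⟨by simpa using hl, by simp⟩
        | hadd x y hx hy => rw [map_add, add_mul]; exact add_mem hx hy
        | hsmul c x hx => rw [map_smul, smul_mul_assoc]; exact Submodule.smul_mem _ _ hx
    · cases l with
      | nil => rw [wd_nil, join_one]; exact zero_mem _
      | cons e' l =>
        rw [wd_cons, join_cons, ← wd_append]
        refine wd_mem_spanWd ⟨?_, by simp⟩
        cases e <;> cases e' <;> simp_all [emul]
    · by_cases h0 : l = []
      · rw [h0, wd_nil, dY_one, mul_zero]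
        exact zero_mem _
      · refine map_mem_of_mem_spanWd (f := LinearMap.mulLeft k (wd [e])) (fun v hv => ?_) (ih hl h0)
        rw [LinearMap.mulLeft_apply, ← wd_append]
        refine wd_mem_spanWd ⟨?_, by simp⟩
        cases e <;> simp_all

theorem tau_inc (x : X k) : tau (inc x) = x := by
  induction x using wd_induction with
  | h l => rw [inc_wd, tau_wd, tauWord_single]
  | hadd x y hx hy => simp only [map_add, hx, hy]
  | hsmul c x hx => simp only [map_smul, hx]

/-- The defining property of a twisting cochain. If there is a formal unit in `l`, then this is the
definition of the differential of the letter; otherwise it says that the projection of the bar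
construction to the lists with one entry is a twisting cochain. -/
theorem dX_tauWord (l : List Entry) : dX (tauWord (k := k) l) = tau (dY (wd l)) + cut l := by
  by_cases h : none ∈ l
  · rw [tauWord_of_mem h, dX, der_letter, dAtom, dBar_eq]
  rcases l with _ | ⟨_ | w, l⟩
  · simp [tauWord_nil, wd_nil, dY_one, cut, decon]
  · simp at h
  rcases l with _ | ⟨_ | w', l⟩
  · rw [tauWord_single, wd_cons, dY_cons, wd_nil, join_one, dY_one, mul_one, mul_zero, dEntry,
      add_zero, smul_zero, add_zero, tau_inc]
    simp [cut, decon, tauWord_nil]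
  · simp at h
  have hl : none ∉ l := fun hl => h (by simp [hl])
  have h1 (x : X k) : tau (inc x * wd (some w' :: l)) = 0 := by
    induction x using wd_induction with
    | h v =>
      rw [inc_wd, ← wd_append, tau_wd]
      exact tauWord_cons_cons (by simpa using hl)
    | hadd x y hx hy => simp only [map_add, add_mul, hx, hy, add_zero]
    | hsmul c x hx => simp only [map_smul, smul_mul_assoc, hx, smul_zero]
  have h2 : tau (wd [some w] * dY (wd (k := k) (some w' :: l))) = 0 := by
    refine map_eq_of_mem_spanWd (f := tau ∘ₗ LinearMap.mulLeft k (wd [some w])) (g := 0)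
      (fun v hv => ?_) (dY_mem_of_args (k := k) (l := some w' :: l) (by simpa using hl) (by simp))
    rw [LinearMap.comp_apply, LinearMap.mulLeft_apply, ← wd_append, tau_wd, LinearMap.zero_apply]
    rcases v with _ | ⟨e, v⟩
    · exact absurd rfl hv.2
    · exact tauWord_cons_cons (by simpa using hv.1)
  rw [tauWord_cons_cons h, map_zero, wd_cons (some w) (some w' :: l), dY_cons, dEntry, map_add, h1,
    map_smul, map_add, h2, cut, decon, decon, tauWord_nil, tauWord_single]
  have h3 : decon (fun u v => sgn k (wdeg sdeg (some w :: some w' :: u) + 1) •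
      (tauWord (some w :: some w' :: u) * tauWord v)) l = (0 : X k) := by
    rw [← decon_zero (M := X k) l]
    refine decon_congr fun u v e => ?_
    rw [tauWord_cons_cons, zero_mul, smul_zero]
    subst e
    simp at hl ⊢
    exact hl.1
  rw [h3, wd_cons (some w'), join_cons, ← wd_append, tau_wd]
  rcases l with _ | ⟨e, l⟩
  · rw [List.append_nil, emul, tauWord_single, tauWord_single, wdeg_cons, sdeg, wdeg_nil, wd_append]
    simp only [zero_mul, smul_zero, zero_add, add_zero, sub_add_cancel, sgn_sub_one, neg_smul,
      neg_add_cancel]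
  · rw [List.singleton_append, tauWord_cons_cons (by simpa [emul] using hl), tauWord_cons_cons
      (l := l) (by simpa using hl)]
    simp

theorem dX_tau (y : Y k) : dX (tau y) = tau (dY y) + lin cut y := by
  induction y using wd_induction with
  | h l => rw [tau_wd, dX_tauWord, lin_wd]
  | hadd x y hx hy => simp only [map_add, hx, hy]; abel
  | hsmul c x hx => simp only [map_smul, hx, smul_add]

/-- The bilinear map from which `cut` is obtained by summing over deconcatenations. -/
noncomputable def cutForm : Y k →ₗ[k] Y k →ₗ[k] X k :=
  (LinearMap.mul k (X k)).compl₁₂ (-(tau ∘ₗ par sdeg)) tau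

theorem cutForm_apply (y y' : Y k) : cutForm y y' = -(tau (par sdeg y) * tau y') := by
  simp [cutForm]

theorem lin_cut (y : Y k) : lin cut y = deconLin cutForm y := by
  have : lin (cut (k := k)) = deconLin cutForm := lin_ext fun l => by
    rw [lin_wd, deconLin_wd, cut]
    refine decon_congr fun u v _ => ?_
    rw [cutForm_apply, par_wd, map_smul, tau_wd, tau_wd, sgn_add_one, neg_smul, smul_mul_assoc]
  rw [this]

/-- The coderivation property and the twisting cochain property turn the left side into a sum over
the ways to cut `l` into three parts, in which the terms cancel in pairs. -/
theorem dX_cut (l : List Entry) : dX (cut (k := k) l) + lin cut (dY (wd (k := k) l)) = 0 := by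
  rw [lin_cut, deconLin_dY, cut, ← decon_map, ← decon_add]
  have h : ∀ u v : List Entry, dX (sgn k (wdeg sdeg u + 1) • (tauWord (k := k) u * tauWord v))
      + (cutForm (dY (wd (k := k) u)) (wd v) + sgn k (wdeg sdeg u) • cutForm (wd (k := k) u)
        (dY (wd v)))
      = sgn k (wdeg sdeg u + 1) • (cut u * tauWord v) + tauWord u * cut v := by
    intro u v
    rw [map_smul, dX_mul, dX_tauWord, dX_tauWord, par_tauWord, cutForm_apply, cutForm_apply, par_dY,
      par_wd, tau_wd, map_smul, map_neg, map_smul, map_smul, tau_wd, sgn_add_one]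
    simp only [add_mul, smul_mul_assoc, neg_mul, mul_add]
    have := sgn_mul_self k (wdeg sdeg u)
    simp only [smul_add, smul_neg, smul_smul, neg_smul, neg_mul, this, one_smul]
    abel
  have hA : ∀ u v : List Entry, sgn k (wdeg sdeg u + 1) • (cut (k := k) u * tauWord v) =
      decon (fun u₁ u₂ => (sgn k (wdeg sdeg (u₁ ++ u₂) + 1) * sgn k (wdeg sdeg u₁ + 1)) •
        (tauWord u₁ * tauWord u₂ * tauWord v)) u := by
    intro u v
    rw [cut, ← LinearMap.mulRight_apply (R := k), ← decon_map, ← decon_smul]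
    refine decon_congr fun u₁ u₂ e => ?_
    rw [e, map_smul, smul_smul, LinearMap.mulRight_apply]
  have hB : ∀ u v : List Entry, tauWord (k := k) u * cut (k := k) v =
      decon (fun v₁ v₂ => sgn k (wdeg sdeg v₁ + 1) • (tauWord u * tauWord v₁ * tauWord v₂)) v := by
    intro u v
    rw [cut, ← LinearMap.mulLeft_apply (R := k), ← decon_map]
    refine decon_congr fun u₁ u₂ e => ?_
    rw [map_smul, LinearMap.mulLeft_apply, mul_assoc]
  simp only [h]
  rw [decon_add]
  simp only [hA, hB]
  rw [decon_assoc (fun u₁ u₂ v => (sgn k (wdeg sdeg (u₁ ++ u₂) + 1) * sgn k (wdeg sdeg u₁ + 1)) •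
        (tauWord u₁ * tauWord u₂ * tauWord v)), ← decon_add, ← decon_zero l]
  refine decon_congr fun u v _ => ?_
  rw [← decon_add, ← decon_zero v]
  refine decon_congr fun v₁ v₂ _ => ?_
  rw [← add_smul, wdeg_append, add_right_comm, sgn_add, mul_right_comm, sgn_mul_self, sgn_add_one,
    one_mul, add_neg_cancel, zero_smul]

theorem dX_dAtom_dY_dY : (∀ a, dX (dAtom (k := k) a) = 0) ∧ (∀ l, dY (dY (wd (k := k) l)) = 0) ∧
    ∀ w : List Atom, ∀ a ∈ w, dX (dAtom (k := k) a) = 0 := by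
  refine Atom.induction ?_ ?_ ?_ ?_ ?_ ?_ ?_
  · simp [dAtom]
  · intro l ih
    rw [dAtom, dBar_eq, map_add, dX_tau, ih, map_zero, zero_add, add_comm, dX_cut]
  · simp [wd_nil, dY_one]
  · intro l ih
    exact dY_dY_cons _ l (fun w h => by cases h) ih
  · intro w l ih ih'
    refine dY_dY_cons _ l (fun w' h => ?_) ih'
    cases h
    exact der_der _ _ par_dAtom w ih
  · simp
  · intro a w ih ih' b hb
    rcases List.mem_cons.1 hb with rfl | hb
    · exact ih
    · exact ih' b hb

theorem dX_dX (x : X k) : dX (dX x) = 0 := by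
  induction x using wd_induction with
  | h l => exact der_der _ _ par_dAtom l fun a _ => dX_dAtom_dY_dY.1 a
  | hadd x y hx hy => simp only [map_add, hx, hy, add_zero]
  | hsmul c x hx => simp only [map_smul, hx, smul_zero]

end

section

variable {k : Type u} [CommRing k]

/-! ### Powers of the parity automorphism -/

section Twist

variable {α : Type}

/-- The `q`-th power of the parity automorphism. -/
noncomputable def twist (deg : α → ℤ) (q : ℤ) : WordAlg k α →ₗ[k] WordAlg k α :=
  if Even q then LinearMap.id else par deg

theorem twist_even (deg : α → ℤ) {q : ℤ} (h : Even q) (x : WordAlg k α) : twist deg q x = x := by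
  rw [twist, if_pos h, LinearMap.id_apply]

theorem twist_odd (deg : α → ℤ) {q : ℤ} (h : ¬Even q) (x : WordAlg k α) :
    twist deg q x = par deg x := by
  rw [twist, if_neg h]

theorem sgn_even {q : ℤ} (h : Even q) : sgn k q = 1 := by
  rw [sgn, Int.negOnePow_even _ h]
  simp

theorem sgn_odd {q : ℤ} (h : ¬Even q) : sgn k q = -1 := by
  rw [sgn, Int.negOnePow_odd _ (Int.not_even_iff_odd.1 h)]
  simp

theorem twist_mul (deg : α → ℤ) (q : ℤ) (x y : WordAlg k α) :
    twist deg q (x * y) = twist deg q x * twist deg q y := by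
  by_cases h : Even q
  · simp only [twist_even deg h]
  · simp only [twist_odd deg h, par_mul]

theorem twist_twist (deg : α → ℤ) (q q' : ℤ) (x : WordAlg k α) :
    twist deg q (twist deg q' x) = twist deg (q + q') x := by
  by_cases h : Even q <;> by_cases h' : Even q'
  · rw [twist_even deg h, twist_even deg h', twist_even deg (h.add h')]
  · rw [twist_even deg h, twist_odd deg h', twist_odd deg (by simp [Int.even_add, h, h'])]
  · rw [twist_odd deg h, twist_even deg h', twist_odd deg (by simp [Int.even_add, h, h'])]
  · rw [twist_odd deg h, twist_odd deg h', par_par, twist_even deg (by simp [Int.even_add, h, h'])]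

theorem twist_one (deg : α → ℤ) (x : WordAlg k α) : twist deg 1 x = par deg x :=
  twist_odd deg (by decide) x

theorem twist_wd (deg : α → ℤ) (q : ℤ) (l : List α) :
    twist deg q (wd (k := k) l) = sgn k (q * wdeg deg l) • wd l := by
  by_cases h : Even q
  · rw [twist_even deg h, sgn_even (h.mul_right _), one_smul]
  · rw [twist_odd deg h, par_wd]
    congr 1
    refine sgn_congr k ?_
    rw [Int.even_sub, Int.even_mul]
    tauto

theorem twist_mem_length (deg : α → ℤ) (q : ℤ) {n : ℕ} {x : WordAlg k α}
    (hx : x ∈ spanWd k fun l => l.length = n) :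
    twist deg q x ∈ spanWd k fun l => l.length = n := by
  refine map_mem_of_mem_spanWd (fun l hl => ?_) hx
  rw [twist_wd]
  exact Submodule.smul_mem _ _ (wd_mem_spanWd hl)

theorem mul_mem_length {m n r : ℕ} (h : m + n = r) {x y : WordAlg k α}
    (hx : x ∈ spanWd k fun l : List α => l.length = m)
    (hy : y ∈ spanWd k fun l : List α => l.length = n) :
    x * y ∈ spanWd k fun l : List α => l.length = r := by
  refine map_mem_of_mem_spanWd (f := LinearMap.mulRight k y) (fun l hl => ?_) hx
  refine map_mem_of_mem_spanWd (f := LinearMap.mulLeft k (wd l)) (fun l' hl' => ?_) hy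
  rw [LinearMap.mulLeft_apply, ← wd_append]
  exact wd_mem_spanWd (by simp [hl, hl', h])

end Twist

/-! ### The endomorphism operad -/

/-- The tensor algebra of the algebra of words; the words in the alphabet of words are its pure
tensors. -/
abbrev T (k : Type u) [CommRing k] : Type u := WordAlg k (List Atom)

/-- The inclusion of the algebra of words into its tensor algebra. -/
noncomputable def letter : X k →ₗ[k] T k := lin fun w => wd [w]

theorem letter_wd (w : List Atom) : letter (wd (k := k) w) = wd [w] := lin_wd _ _

/-- The degree of a word. -/
abbrev tdeg : List Atom → ℤ := wdeg Atom.deg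

theorem par_letter (x : X k) : par tdeg (letter x) = letter (par Atom.deg x) := by
  induction x using wd_induction with
  | h l => rw [letter_wd, par_wd, par_wd, map_smul, letter_wd, wdeg_cons, wdeg_nil, add_zero]
  | hadd x y hx hy => simp only [map_add, hx, hy]
  | hsmul c x hx => simp only [map_smul, hx]

theorem twist_letter (q : ℤ) (x : X k) : twist tdeg q (letter x) = letter (twist Atom.deg q x) := by
  by_cases h : Even q
  · rw [twist_even _ h, twist_even _ h]
  · rw [twist_odd _ h, twist_odd _ h, par_letter]

theorem letter_mem_length (x : X k) :
    letter x ∈ spanWd k fun l : List (List Atom) => l.length = 1 := by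
  induction x using wd_induction with
  | h l => rw [letter_wd]; exact wd_mem_spanWd rfl
  | hadd x y hx hy => rw [map_add]; exact add_mem hx hy
  | hsmul c x hx => rw [map_smul]; exact Submodule.smul_mem _ _ hx

/-- The differential of the tensor algebra. -/
noncomputable def dT : T k →ₗ[k] T k := der tdeg fun w => letter (dX (wd w))

theorem dT_letter (x : X k) : dT (letter x) = letter (dX x) := by
  induction x using wd_induction with
  | h l => rw [letter_wd, dT, der_letter]
  | hadd x y hx hy => simp only [map_add, hx, hy]
  | hsmul c x hx => simp only [map_smul, hx]

theorem dT_mul (x y : T k) : dT (x * y) = dT x * y + par tdeg x * dT y := der_mul _ _ _ _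

theorem par_letter_dX (w : List Atom) : par tdeg (letter (dX (wd (k := k) w)))
    = -(sgn k (tdeg w) • letter (dX (wd w))) := by
  rw [par_letter, par_dX, par_wd, map_neg, map_smul, map_smul]

theorem par_dT (x : T k) : par tdeg (dT x) = -dT (par tdeg x) := par_der _ _ par_letter_dX x

theorem twist_dT (q : ℤ) (x : T k) : twist tdeg q (dT x) = sgn k q • dT (twist tdeg q x) := by
  by_cases h : Even q
  · rw [twist_even _ h, twist_even _ h, sgn_even h, one_smul]
  · rw [twist_odd _ h, twist_odd _ h, sgn_odd h, par_dT, neg_one_smul]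

theorem dT_dT (x : T k) : dT (dT x) = 0 := by
  induction x using wd_induction with
  | h l =>
    refine der_der _ _ par_letter_dX l fun a _ => ?_
    have := dT_letter (dX (wd (k := k) a))
    rw [dX_dX, map_zero] at this
    exact this
  | hadd x y hx hy => simp only [map_add, hx, hy, add_zero]
  | hsmul c x hx => simp only [map_smul, hx, smul_zero]

theorem dT_mem_length {n : ℕ} {x : T k} (hx : x ∈ spanWd k fun l : List (List Atom) => l.length =
    n) :
    dT x ∈ spanWd k fun l : List (List Atom) => l.length = n := by
  refine map_mem_of_mem_spanWd (fun l hl => ?_) hx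
  subst hl
  clear hx
  induction l with
  | nil => rw [wd_nil, dT, der_one]; exact zero_mem _
  | cons a l ih =>
    rw [wd_cons, dT_mul, dT, der_letter, par_wd, smul_mul_assoc]
    refine add_mem (mul_mem_length (add_comm _ _) (letter_mem_length _) (wd_mem_spanWd rfl))
      (Submodule.smul_mem _ _ (mul_mem_length (add_comm _ _) (wd_mem_spanWd rfl) ih))

/-- Application of `b`, of arity `n` and degree `q`, to the tensor factors number `i`, …, `i + n -
1`, with the Koszul sign for passing the first `i` factors; it is zero on tensors with too few
factors. -/
noncomputable def ins (i n : ℕ) (q : ℤ) (b : T k →ₗ[k] X k) : T k →ₗ[k] T k :=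
  lin fun l => if i + n ≤ l.length then
    twist tdeg q (wd (l.take i)) * letter (b (wd ((l.drop i).take n))) * wd (l.drop (i + n)) else 0

theorem ins_wd {i n : ℕ} (q : ℤ) (b : T k →ₗ[k] X k) {u v : List (List Atom)} (w : List (List Atom))
    (hu : u.length = i) (hv : v.length = n) : ins i n q b (wd (u ++ v ++ w))
      = twist tdeg q (wd u) * letter (b (wd v)) * wd w := by
  subst hu hv
  rw [ins, lin_wd, if_pos (by simp), List.append_assoc, List.take_left, List.drop_left,
    List.take_left, ← List.append_assoc, ← List.length_append, List.drop_left]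

theorem ins_mul {i n : ℕ} (q : ℤ) (b : T k →ₗ[k] X k) {x y : T k} (z : T k)
    (hx : x ∈ spanWd k fun l : List (List Atom) => l.length = i)
    (hy : y ∈ spanWd k fun l : List (List Atom) => l.length = n) :
    ins i n q b (x * y * z) = twist tdeg q x * letter (b y) * z := by
  refine map_eq_of_mem_spanWd (f := ins i n q b ∘ₗ LinearMap.mulRight k z ∘ₗ LinearMap.mulRight k y)
    (g := LinearMap.mulRight k z ∘ₗ LinearMap.mulRight k (letter (b y)) ∘ₗ twist tdeg q)
    (fun u hu => ?_) hx
  refine map_eq_of_mem_spanWd (f := ins i n q b ∘ₗ LinearMap.mulRight k z ∘ₗ LinearMap.mulLeft k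
    (wd u))
    (g := LinearMap.mulRight k z ∘ₗ LinearMap.mulLeft k (twist tdeg q (wd u)) ∘ₗ letter ∘ₗ b)
    (fun v hv => ?_) hy
  simp only [LinearMap.comp_apply, LinearMap.mulRight_apply, LinearMap.mulLeft_apply]
  induction z using wd_induction with
  | h w => rw [← wd_append, ← wd_append, ins_wd q b w hu hv]
  | hadd x y hx hy => simp only [mul_add, map_add, hx, hy]
  | hsmul c x hx => simp only [map_smul, mul_smul_comm, hx]

theorem ins_add (i n : ℕ) (q : ℤ) (b b' : T k →ₗ[k] X k) :
    ins i n q (b + b') = ins i n q b + ins i n q b' := by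
  refine lin_ext fun l => ?_
  rw [LinearMap.add_apply, ins, ins, ins, lin_wd, lin_wd, lin_wd]
  split_ifs
  · simp [mul_add, add_mul]
  · simp

theorem ins_smul (i n : ℕ) (q : ℤ) (c : k) (b : T k →ₗ[k] X k) :
    ins i n q (c • b) = c • ins i n q b := by
  refine lin_ext fun l => ?_
  rw [LinearMap.smul_apply, ins, ins, lin_wd, lin_wd]
  split_ifs
  · simp
  · simp

theorem exists_append {α : Type*} {l : List α} {i : ℕ} (h : i ≤ l.length) :
    ∃ u v, l = u ++ v ∧ u.length = i :=
  ⟨l.take i, l.drop i, (List.take_append_drop i l).symm, by simp [h]⟩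

theorem exists_append₃ {α : Type*} {l : List α} {i n : ℕ} (h : i + n ≤ l.length) :
    ∃ u v w, l = u ++ v ++ w ∧ u.length = i ∧ v.length = n := by
  obtain ⟨u', w, rfl, h'⟩ := exists_append h
  obtain ⟨u, v, rfl, h''⟩ := exists_append (l := u') (i := i) (by omega)
  exact ⟨u, v, w, rfl, h'', by simp at h'; omega⟩

theorem ins_mem_length (i n : ℕ) (q : ℤ) (b : T k →ₗ[k] X k) {r s : ℕ} (h : r + 1 = n + s) {x : T k}
    (hx : x ∈ spanWd k fun l : List (List Atom) => l.length = r) :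
    ins i n q b x ∈ spanWd k fun l : List (List Atom) => l.length = s := by
  refine map_mem_of_mem_spanWd (fun l hl => ?_) hx
  by_cases hi : i + n ≤ l.length
  · obtain ⟨u, v, w, rfl, hu, hv⟩ := exists_append₃ hi
    rw [ins_wd q b w hu hv]
    simp at hl
    exact mul_mem_length (m := i + 1) (n := w.length) (by omega)
      (mul_mem_length rfl (twist_mem_length _ _ (wd_mem_spanWd hu)) (letter_mem_length _))
      (wd_mem_spanWd rfl)
  · rw [ins, lin_wd, if_neg hi]
    exact zero_mem _

/-- The `n`-ary operations of degree `p` on the algebra of words: linear maps on its tensor algebra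
which vanish outside of the `n`-th tensor power and have the parity of `p`. The signs depend on the
parity only, so that there is no need to require the maps to be homogeneous of degree `p`. -/
noncomputable def endObj (k : Type u) [CommRing k] (n : ℕ) (p : ℤ) : Submodule k
    (T k →ₗ[k] X k) where
  carrier := {a | (∀ l, l.length ≠ n → a (wd l) = 0) ∧
    ∀ x, par Atom.deg (a x) = sgn k p • a (par tdeg x)}
  add_mem' ha hb := ⟨fun l hl => by simp [ha.1 l hl, hb.1 l hl],
    fun x => by simp [ha.2 x, hb.2 x]⟩
  zero_mem' := ⟨fun l hl => rfl, fun x => by simp⟩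
  smul_mem' c a ha := ⟨fun l hl => by simp [ha.1 l hl], fun x => by simp [ha.2 x, smul_comm c]⟩

theorem endObj_twist {n : ℕ} {p : ℤ} {a : T k →ₗ[k] X k} (ha : a ∈ endObj k n p) (q : ℤ) (x : T k) :
    twist Atom.deg q (a x) = sgn k (p * q) • a (twist tdeg q x) := by
  by_cases h : Even q
  · rw [twist_even _ h, twist_even _ h, sgn_even (h.mul_left _), one_smul]
  · rw [twist_odd _ h, twist_odd _ h, ha.2]
    congr 1
    refine sgn_congr k ?_
    rw [Int.even_sub, Int.even_mul]
    tauto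

theorem endObj_eq_zero {n m : ℕ} (hm : m ≠ n) {p : ℤ} {a : T k →ₗ[k] X k} (ha : a ∈ endObj k n p)
    {x : T k}
    (hx : x ∈ spanWd k fun l : List (List Atom) => l.length = m) : a x = 0 :=
  map_eq_of_mem_spanWd (g := 0) (fun l hl => ha.1 l (by omega)) hx

theorem endObj_ext {n : ℕ} {p : ℤ} {a b : endObj k n p}
    (h : ∀ l : List (List Atom), l.length = n → a.1 (wd l) = b.1 (wd l)) : a = b := by
  refine Subtype.ext (lin_ext fun l => ?_)
  by_cases hl : l.length = n
  · exact h l hl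
  · rw [a.2.1 l hl, b.2.1 l hl]

theorem par_ins {n : ℕ} {q : ℤ} {b : T k →ₗ[k] X k} (hb : b ∈ endObj k n q) (i : ℕ) (x : T k) :
    par tdeg (ins i n q b x) = sgn k q • ins i n q b (par tdeg x) := by
  induction x using wd_induction with
  | h l =>
    rw [par_wd, map_smul]
    by_cases hi : i + n ≤ l.length
    · obtain ⟨u, v, w, rfl, hu, hv⟩ := exists_append₃ hi
      rw [ins_wd q b w hu hv, par_mul, par_mul, par_letter, hb.2, twist_wd, par_wd, par_wd,
        map_smul, par_wd, map_smul, map_smul, map_smul]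
      simp only [smul_mul_assoc, mul_smul_comm, wdeg_append, sgn_add]
      module
    · rw [ins, lin_wd, if_neg hi, map_zero, smul_zero, smul_zero]
  | hadd x y hx hy => simp only [map_add, hx, hy, smul_add]
  | hsmul c x hx => simp only [map_smul, hx, smul_comm c]

theorem endD_mem {n : ℕ} {p q : ℤ} (h : p + 1 = q) {a : T k →ₗ[k] X k} (ha : a ∈ endObj k n p) :
    dX ∘ₗ a - sgn k p • (a ∘ₗ dT) ∈ endObj k n q := by
  subst h
  refine ⟨fun l hl => ?_, fun x => ?_⟩
  · simp [ha.1 l hl, endObj_eq_zero hl ha (dT_mem_length (wd_mem_spanWd rfl))]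
  · simp only [LinearMap.sub_apply, LinearMap.comp_apply, LinearMap.smul_apply, map_sub, map_smul,
      par_dX, ha.2, par_dT, map_neg, sgn_add_one]
    module

theorem endComp_mem {m n r : ℕ} {p q s : ℤ} (i : ℕ) (hr : m + n = r + 1) (hs : p + q = s)
    {a b : T k →ₗ[k] X k} (ha : a ∈ endObj k m p) (hb : b ∈ endObj k n q) :
    a ∘ₗ ins i n q b ∈ endObj k r s := by
  subst hs
  refine ⟨fun l hl => ?_, fun x => ?_⟩
  · by_cases hi : i + n ≤ l.length
    · exact endObj_eq_zero (m := l.length + 1 - n) (by omega) ha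
        (ins_mem_length i n q b (by omega) (wd_mem_spanWd rfl))
    · rw [LinearMap.comp_apply, ins, lin_wd, if_neg hi, map_zero]
  · rw [LinearMap.comp_apply, LinearMap.comp_apply, ha.2, par_ins hb, map_smul, smul_smul, sgn_add]

/-- The identity operation. -/
noncomputable def endOne : T k →ₗ[k] X k := lin fun l => match l with
  | [w] => wd w
  | _ => 0

theorem endOne_letter (x : X k) : endOne (letter x) = x := by
  induction x using wd_induction with
  | h l => rw [letter_wd, endOne, lin_wd]
  | hadd x y hx hy => simp only [map_add, hx, hy]
  | hsmul c x hx => simp only [map_smul, hx]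

theorem endOne_mem : endOne ∈ endObj k 1 0 := by
  refine ⟨fun l hl => ?_, fun x => ?_⟩
  · rw [endOne, lin_wd]
    rcases l with _ | ⟨w, _ | ⟨w', l⟩⟩ <;> simp at hl ⊢
  · rw [sgn_zero, one_smul]
    induction x using wd_induction with
    | h l =>
      rw [par_wd, map_smul, endOne, lin_wd]
      rcases l with _ | ⟨w, _ | ⟨w', l⟩⟩
      · simp
      · rw [par_wd, wdeg_cons, wdeg_nil, add_zero]
      · simp
    | hadd x y hx hy => simp only [map_add, hx, hy]
    | hsmul c x hx => simp only [map_smul, hx]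

end

section

open DGOperad

variable {k : Type u} [CommRing k]

/-- The endomorphism dg operad of the algebra of words. -/
noncomputable def endOperad (k : Type u) [CommRing k] : DGOperad k where
  obj n p := endObj k n p
  d {n p q} h :=
    { toFun := fun a => ⟨_, endD_mem h a.2⟩
      map_add' := fun a b => by
        refine Subtype.ext (LinearMap.ext fun x => ?_)
        simp
        abel
      map_smul' := fun c a => by
        refine Subtype.ext (LinearMap.ext fun x => ?_)
        simp [smul_sub, smul_comm c] }
  one := ⟨endOne, endOne_mem⟩
  comp {m n r p q s} i hi hr hs := LinearMap.mk₂ k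
    (fun a b => ⟨a.1 ∘ₗ ins i n q b.1, endComp_mem i hr hs a.2 b.2⟩)
    (fun a a' b => Subtype.ext (LinearMap.add_comp _ _ _))
    (fun c a b => Subtype.ext (LinearMap.smul_comp _ _ _))
    (fun a b b' => by
      refine Subtype.ext ?_
      change a.1 ∘ₗ ins i n q (b.1 + b'.1) = _
      rw [ins_add, LinearMap.comp_add]
      rfl)
    (fun c a b => by
      refine Subtype.ext ?_
      change a.1 ∘ₗ ins i n q (c • b.1) = _
      rw [ins_smul, LinearMap.comp_smul]
      rfl)
  d_d {n p q r} h h' a := by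
    refine Subtype.ext (LinearMap.ext fun x => ?_)
    subst h h'
    simp [dX_dX, dT_dT, sgn_add_one]
  one_comp {n p} hi hr hs a := by
    refine endObj_ext fun l hl => ?_
    change endOne (ins 0 n p a.1 (wd l)) = a.1 (wd l)
    have := ins_wd (k := k) (i := 0) (n := n) p a.1 (u := []) (v := l) [] rfl hl
    rw [List.nil_append, List.append_nil] at this
    rw [this, twist_wd, wdeg_nil, mul_zero, sgn_zero, one_smul, wd_nil, one_mul, mul_one,
      endOne_letter]
  comp_one {n p} i hi hr hs a := by
    refine endObj_ext fun l hl => ?_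
    change a.1 (ins i 1 0 endOne (wd l)) = a.1 (wd l)
    obtain ⟨u, v, w, rfl, hu, hv⟩ := exists_append₃ (l := l) (i := i) (n := 1) (by omega)
    rw [ins_wd 0 endOne w hu hv, twist_even _ (by simp), wd_append, wd_append]
    obtain ⟨x, rfl⟩ := List.length_eq_one_iff.1 hv
    rw [← letter_wd, endOne_letter]
  comp_seq {l m n r s t p q p' e f g} i j hi hj hr he hij ht hg hs hf ht' hg' a b c := by
    refine endObj_ext fun z hz => ?_
    change a.1 (ins i m q b.1 (ins (i + j) n p' c.1 (wd z)))
      = a.1 (ins i s f (b.1 ∘ₗ ins j n p' c.1) (wd z))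
    obtain ⟨z₁, w, z₅, rfl, h₁, hw⟩ := exists_append₃ (l := z) (i := i) (n := s) (by omega)
    obtain ⟨z₂, z₃, z₄, rfl, h₂, h₃⟩ := exists_append₃ (l := w) (i := j) (n := n) (by omega)
    simp at hw hz
    have e₁ : z₁ ++ (z₂ ++ z₃ ++ z₄) ++ z₅ = (z₁ ++ z₂) ++ z₃ ++ (z₄ ++ z₅) := by simp
    rw [ins_wd f _ z₅ h₁ (by simp; omega), LinearMap.comp_apply, ins_wd p' c.1 z₄ h₂ h₃, e₁,
      ins_wd p' c.1 (z₄ ++ z₅) (by simp; omega) h₃, wd_append, wd_append, twist_mul]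
    have e₂ : twist tdeg p' (wd z₁) * twist tdeg p' (wd z₂) * letter (c.1 (wd z₃)) * (wd z₄ * wd z₅)
      = twist tdeg p' (wd z₁) * (twist tdeg p' (wd z₂) * letter (c.1 (wd z₃)) * wd z₄) * wd z₅ := by
      simp only [mul_assoc]
    rw [e₂, ins_mul q b.1 _ (twist_mem_length _ _ (wd_mem_spanWd h₁))
      (mul_mem_length (m := j + 1) (n := z₄.length) (by omega)
        (mul_mem_length rfl (twist_mem_length _ _ (wd_mem_spanWd h₂)) (letter_mem_length _))
        (wd_mem_spanWd rfl)), twist_twist, hf]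
  comp_par {l m n r s t p q p' e f g} i j j' hi hj hij hj' hr he hjr ht hg hs hf his ht' hg'
      a b c := by
    refine endObj_ext fun z hz => ?_
    change a.1 (ins i m q b.1 (ins j' n p' c.1 (wd z)))
      = sgn k (q * p') • a.1 (ins j n p' c.1 (ins i m q b.1 (wd z)))
    obtain ⟨w, z₄, z₅, rfl, hw, h₄⟩ := exists_append₃ (l := z) (i := j') (n := n) (by omega)
    obtain ⟨z₁, z₂, z₃, rfl, h₁, h₂⟩ := exists_append₃ (l := w) (i := i) (n := m) (by omega)
    simp at hw hz
    rw [ins_wd p' c.1 z₅ (by simp; omega) h₄, wd_append, wd_append, twist_mul, twist_mul]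
    have e₁ : twist tdeg p' (wd z₁) * twist tdeg p' (wd z₂) * twist tdeg p' (wd z₃)
        * letter (c.1 (wd z₄)) * wd z₅ = twist tdeg p' (wd z₁) * twist tdeg p' (wd z₂)
        * (twist tdeg p' (wd z₃) * letter (c.1 (wd z₄)) * wd z₅) := by
      simp only [mul_assoc]
    have e₂ : z₁ ++ z₂ ++ z₃ ++ z₄ ++ z₅ = z₁ ++ z₂ ++ (z₃ ++ z₄ ++ z₅) := by simp
    rw [e₁, ins_mul q b.1 _ (twist_mem_length _ _ (wd_mem_spanWd h₁))
      (twist_mem_length _ _ (wd_mem_spanWd h₂)), e₂, ins_wd q b.1 _ h₁ h₂, wd_append, wd_append]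
    have e₃ : twist tdeg q (wd z₁) * letter (b.1 (wd z₂)) * (wd z₃ * wd z₄ * wd z₅)
        = (twist tdeg q (wd z₁) * letter (b.1 (wd z₂)) * wd z₃) * wd z₄ * wd z₅ := by
      simp only [mul_assoc]
    rw [e₃, ins_mul p' c.1 _ (mul_mem_length (m := i + 1) (n := z₃.length) (by omega)
        (mul_mem_length rfl (twist_mem_length _ _ (wd_mem_spanWd h₁)) (letter_mem_length _))
        (wd_mem_spanWd rfl)) (wd_mem_spanWd h₄), twist_mul, twist_mul, twist_twist, twist_twist,
      twist_letter, endObj_twist b.2, map_smul, add_comm p' q]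
    simp only [smul_mul_assoc, mul_smul_comm, map_smul, smul_smul, sgn_mul_self, one_smul,
      mul_assoc]
  d_comp {m n r p q s p₁ q₁ s₁} i hi hr hs hp hq hs₁ h₁ h₂ a b := by
    refine endObj_ext fun z hz => ?_
    subst hp hq hs
    change dX (a.1 (ins i n q b.1 (wd z))) - sgn k (p + q) • a.1 (ins i n q b.1 (dT (wd z)))
      = (dX (a.1 (ins i n q b.1 (wd z))) - sgn k p • a.1 (dT (ins i n q b.1 (wd z))))
        + sgn k p • a.1 (ins i n (q + 1) (dX ∘ₗ b.1 - sgn k q • (b.1 ∘ₗ dT)) (wd z))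
    have key : ins i n (q + 1) (dX ∘ₗ b.1 - sgn k q • (b.1 ∘ₗ dT)) (wd z)
        = dT (ins i n q b.1 (wd z)) - sgn k q • ins i n q b.1 (dT (wd z)) := by
      obtain ⟨u, v, w, rfl, hu, hv⟩ := exists_append₃ (l := z) (i := i) (n := n) (by omega)
      have mu : wd (k := k) u ∈ spanWd k fun l : List (List Atom) => l.length = i :=
        wd_mem_spanWd hu
      have mv : wd (k := k) v ∈ spanWd k fun l : List (List Atom) => l.length = n :=
        wd_mem_spanWd hv
      have pu : par tdeg (wd (k := k) u) ∈ spanWd k fun l : List (List Atom) => l.length = i := by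
        rw [← twist_one]; exact twist_mem_length _ _ mu
      have pv : par tdeg (wd (k := k) v) ∈ spanWd k fun l : List (List Atom) => l.length = n := by
        rw [← twist_one]; exact twist_mem_length _ _ mv
      rw [ins_wd _ _ w hu hv, ins_wd _ _ w hu hv, wd_append, wd_append, dT_mul, dT_mul, dT_mul,
        dT_mul, dT_letter, par_mul, par_mul, add_mul, add_mul (dT (wd u) * wd v), map_add, map_add,
        ins_mul q b.1 _ (dT_mem_length mu) mv, ins_mul q b.1 _ pu (dT_mem_length mv),
        ins_mul q b.1 _ pu pv, par_letter, b.2.2, twist_dT, ← twist_one tdeg,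
        ← twist_one tdeg (wd u), twist_twist, twist_twist, add_comm 1 q]
      simp only [LinearMap.sub_apply, LinearMap.comp_apply, LinearMap.smul_apply, map_sub, map_smul,
        mul_sub, sub_mul, smul_mul_assoc, mul_smul_comm, smul_add, smul_smul, sgn_mul_self,
        one_smul, mul_assoc]
      abel
    rw [key, map_sub, map_smul, sgn_add]
    module

theorem endOperad_comp {m n r : ℕ} {p q s : ℤ} (i : ℕ) (hi : i < m) (hr : m + n = r + 1)
    (hs : p + q = s)
    (a : (endOperad k).obj m p) (b : (endOperad k).obj n q) :
    ((endOperad k).comp i hi hr hs a b).1 = a.1 ∘ₗ ins i n q b.1 := rfl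

theorem endOperad_d {n : ℕ} {p q : ℤ} (h : p + 1 = q) (a : (endOperad k).obj n p) :
    ((endOperad k).d h a).1 = dX ∘ₗ a.1 - sgn k p • (a.1 ∘ₗ dT) := rfl

end

section

open DGOperad Presentation

variable {k : Type u} [CommRing k]

/-! ### The operations of `O'` on the algebra of words -/

/-- The product of the algebra of words, as a binary operation. -/
noncomputable def endMul : T k →ₗ[k] X k := lin fun l => match l with
  | [u, v] => wd (u ++ v)
  | _ => 0

theorem endMul_letter (x y : X k) : endMul (letter x * letter y) = x * y := by
  induction x using wd_induction with
  | h u =>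
    induction y using wd_induction with
    | h v => rw [letter_wd, letter_wd, ← wd_append, ← wd_append, endMul, lin_wd]; rfl
    | hadd x y hx hy => simp only [map_add, mul_add, hx, hy]
    | hsmul c x hx => simp only [map_smul, mul_smul_comm, hx]
  | hadd x y hx hy => simp only [map_add, add_mul, hx, hy]
  | hsmul c x hx => simp only [map_smul, smul_mul_assoc, hx]

theorem endMul_mem : endMul ∈ endObj k 2 0 := by
  refine ⟨fun l hl => ?_, fun x => ?_⟩
  · rw [endMul, lin_wd]
    rcases l with _ | ⟨w, _ | ⟨w', _ | ⟨w'', l⟩⟩⟩ <;> simp at hl ⊢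
  · rw [sgn_zero, one_smul]
    induction x using wd_induction with
    | h l =>
      rw [par_wd, map_smul, endMul, lin_wd]
      rcases l with _ | ⟨w, _ | ⟨w', _ | ⟨w'', l⟩⟩⟩
      · simp
      · simp
      · simp [par_wd]
      · simp
    | hadd x y hx hy => simp only [map_add, hx, hy]
    | hsmul c x hx => simp only [map_smul, hx]

/-- The letter `p_1(1)`, as an operation of arity zero: it is the value of `j`. -/
noncomputable def endUnit : T k →ₗ[k] X k := lin fun l => match l with
  | [] => wd [.br [none]]
  | _ => 0

theorem deg_unit : Atom.deg (.br [none]) = 0 := by rw [deg_br, wdeg_cons, sdeg, wdeg_nil]; rfl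

theorem endUnit_mem : endUnit ∈ endObj k 0 0 := by
  refine ⟨fun l hl => ?_, fun x => ?_⟩
  · rw [endUnit, lin_wd]
    rcases l with _ | ⟨w, l⟩ <;> simp at hl ⊢
  · rw [sgn_zero, one_smul]
    induction x using wd_induction with
    | h l =>
      rw [par_wd, map_smul, endUnit, lin_wd]
      rcases l with _ | ⟨w, l⟩
      · simp only []
        rw [par_wd, wdeg_cons, deg_unit]
        simp
      · simp
    | hadd x y hx hy => simp only [map_add, hx, hy]
    | hsmul c x hx => simp only [map_smul, hx]

/-- The bracket with the formal units at the places marked in the word `w` and with given arguments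
at the other places. -/
def fill : List Bool → List (List Atom) → List Entry
  | [], _ => []
  | true :: w, l => none :: fill w l
  | false :: w, y :: l => some y :: fill w l
  | false :: _, [] => []

theorem length_fill {w : List Bool} {l : List (List Atom)} (h : l.length = w.count false) :
    (fill w l).length = w.length := by
  induction w generalizing l with
  | nil => rfl
  | cons b w ih =>
    cases b with
    | true => simp [fill, ih (l := l) (by simpa using h)]
    | false =>
      cases l with
      | nil => simp at h
      | cons y l => simp [fill, ih (l := l) (by simpa using h)]

theorem fill_append {w w' : List Bool} {l l' : List (List Atom)} (h : l.length = w.count false) :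
    fill (w ++ w') (l ++ l') = fill w l ++ fill w' l' := by
  induction w generalizing l with
  | nil =>
    obtain rfl := List.length_eq_zero_iff.1 (h.trans (by simp))
    rfl
  | cons b w ih =>
    cases b with
    | true => simp [fill, ih (l := l) (by simpa using h)]
    | false =>
      cases l with
      | nil => simp at h
      | cons y l => simp [fill, ih (l := l) (by simpa using h)]

theorem sdeg_fill {w : List Bool} {l : List (List Atom)} (h : l.length = w.count false) :
    wdeg sdeg (fill w l) = wdeg tdeg l - w.length := by
  induction w generalizing l with
  | nil =>
    obtain rfl := List.length_eq_zero_iff.1 (h.trans (by simp))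
    rfl
  | cons b w ih =>
    cases b with
    | true =>
      simp [fill, ih (l := l) (by simpa using h), sdeg]
      ring
    | false =>
      cases l with
      | nil => simp at h
      | cons y l => simp [fill, ih (l := l) (by simpa using h), sdeg]; ring

/-- The Koszul sign that relates `p_n(e₁, …, eₙ)` to the bracket of the suspended entries: the entry
`e`, of degree `sdeg e + 1`, passes one suspension for each of the entries to its right. -/
def susp (k : Type u) [CommRing k] : List Entry → k
  | [] => 1
  | e :: l => sgn k (l.length * (sdeg e + 1)) * susp k l

theorem susp_append (l l' : List Entry) : susp k (l ++ l')
    = sgn k (l'.length * (wdeg sdeg l + l.length)) * (susp k l * susp k l') := by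
  induction l with
  | nil => simp [susp, sgn_zero]
  | cons e l ih =>
    rw [List.cons_append, susp, susp, ih, wdeg_cons, List.length_append, List.length_cons,
      ← mul_assoc, mul_assoc (sgn k _) (susp k l), ← mul_assoc (sgn k (_ * (_ + _))), ← sgn_add,
      ← sgn_add]
    congr 2
    push_cast
    ring

/-- The bracket to which `p_w` is applied, with the sign of the suspension. -/
noncomputable def barOf (w : List Bool) (l : List (List Atom)) : Y k :=
  susp k (fill w l) • wd (fill w l)

theorem barOf_true (w : List Bool) (l : List (List Atom)) :
    barOf (k := k) (true :: w) l = wd [none] * barOf w l := by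
  rw [barOf, barOf, fill, susp, sdeg, wd_cons, mul_smul_comm]
  simp [sgn_zero]

theorem barOf_false {w : List Bool} (y : List Atom) {l : List (List Atom)}
    (h : l.length = w.count false) :
    barOf (k := k) (false :: w) (y :: l)
      = sgn k (w.length * tdeg y) • (wd [some y] * barOf w l) := by
  rw [barOf, barOf, fill, susp, sdeg, wd_cons, mul_smul_comm, smul_smul, length_fill h,
    sub_add_cancel]

/-- The operation `p_w` before the evaluation of brackets. -/
noncomputable def opP (w : List Bool) : T k →ₗ[k] Y k :=
  lin fun l => if l.length = w.count false then barOf w l else 0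

theorem opP_wd {w : List Bool} {l : List (List Atom)} (h : l.length = w.count false) :
    opP w (wd (k := k) l) = barOf w l := by rw [opP, lin_wd, if_pos h]

theorem opP_true (w : List Bool) (x : T k) : opP (true :: w) x = wd [none] * opP w x := by
  induction x using wd_induction with
  | h l =>
    rw [opP, opP, lin_wd, lin_wd]
    simp only [barOf_true]
    split_ifs with h h' h'
    · rfl
    · simp at h; contradiction
    · simp at h; contradiction
    · rw [mul_zero]
  | hadd x y hx hy => simp only [map_add, mul_add, hx, hy]
  | hsmul c x hx => simp only [map_smul, mul_smul_comm, hx]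

theorem opP_false (w : List Bool) (x : X k) (t : T k) :
    opP (false :: w) (letter x * t) = inc (twist Atom.deg w.length x) * opP w t := by
  induction x using wd_induction with
  | h y =>
    induction t using wd_induction with
    | h l =>
      rw [letter_wd, ← wd_append, List.singleton_append, opP, opP, lin_wd, lin_wd]
      by_cases h : l.length = w.count false
      · rw [if_pos h, if_pos (by simpa using h), barOf_false y h, twist_wd, map_smul, inc_wd,
          smul_mul_assoc]
      · rw [if_neg h, if_neg (by simpa using h), mul_zero]
    | hadd x y hx hy => simp only [map_add, mul_add, hx, hy]
    | hsmul c x hx => simp only [map_smul, mul_smul_comm, hx]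
  | hadd x y hx hy => simp only [map_add, add_mul, hx, hy]
  | hsmul c x hx => simp only [map_smul, smul_mul_assoc, hx]

theorem opP_eq_zero {w : List Bool} {n : ℕ} (hn : n ≠ w.count false) {x : T k}
    (hx : x ∈ spanWd k fun l : List (List Atom) => l.length = n) : opP w x = 0 :=
  map_eq_of_mem_spanWd (g := 0) (fun l hl => by
    rw [opP, lin_wd, if_neg (by omega), LinearMap.zero_apply]) hx

theorem endP_mem {a : ℕ} {q : ℤ} {w : List Bool} (ha : w.count false = a)
    (hq : (w.length : ℤ) + q = 1) : tau ∘ₗ opP w ∈ endObj k a q := by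
  subst ha
  refine ⟨fun l hl => ?_, fun x => ?_⟩
  · rw [LinearMap.comp_apply, opP_eq_zero hl (wd_mem_spanWd rfl), map_zero]
  · induction x using wd_induction with
    | h l =>
      rw [LinearMap.comp_apply, LinearMap.comp_apply, par_tau, par_wd, map_smul, map_smul]
      by_cases h : l.length = w.count false
      · rw [opP_wd h, barOf, map_smul, par_wd, sdeg_fill h, map_smul, map_smul, map_smul]
        obtain rfl : q = 1 - w.length := by omega
        rw [sub_eq_add_neg, sub_eq_add_neg, sgn_add, sgn_neg, sgn_add, sgn_neg, sgn_one]
        module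
      · rw [opP_eq_zero h (wd_mem_spanWd rfl)]
        simp
    | hadd x y hx hy => simp only [map_add, smul_add, hx, hy]
    | hsmul c x hx => simp only [map_smul, smul_comm c, hx]

/-- The operations on the algebra of words given by the generators. -/
noncomputable def genEnd (k : Type u) [CommRing k] : ∀ {n : ℕ} {p : ℤ}, Gen n p →
    (endOperad k).obj n p
  | _, _, .m => ⟨endMul, endMul_mem⟩
  | _, _, .j => ⟨endUnit, endUnit_mem⟩
  | _, _, .p w _ ha hq => ⟨tau ∘ₗ opP w, endP_mem ha hq⟩

/-! ### The two parts of the differential of the bar construction -/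

/-- The part of the differential of the bar construction that differentiates the entries. -/
noncomputable def dInt : Y k →ₗ[k] Y k := der sdeg dEntry

theorem dInt_mul (x y : Y k) : dInt (x * y) = dInt x * y + par sdeg x * dInt y := der_mul _ _ _ _

theorem dInt_inc (x : X k) : dInt (inc x) = inc (dX x) := by
  induction x using wd_induction with
  | h l => rw [inc_wd, dInt, der_letter, dEntry]
  | hadd x y hx hy => simp only [map_add, hx, hy]
  | hsmul c x hx => simp only [map_smul, hx]

/-- The part of the differential of the bar construction that multiplies adjacent entries. -/
noncomputable def dJoin : Y k →ₗ[k] Y k := dY - dInt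

theorem dJoin_one : dJoin (1 : Y k) = 0 := by
  rw [dJoin, LinearMap.sub_apply, dY_one, dInt, der_one, sub_zero]

theorem dJoin_cons (e : Entry) (y : Y k) :
    dJoin (wd [e] * y) = sgn k (sdeg e) • (join e y + wd [e] * dJoin y) := by
  rw [dJoin, LinearMap.sub_apply, LinearMap.sub_apply, dY_cons, dInt_mul, dInt, der_letter, par_wd,
    wdeg_cons, wdeg_nil, add_zero, smul_mul_assoc, mul_sub]
  module

theorem twist_dX (q : ℤ) (x : X k) :
    twist Atom.deg q (dX x) = sgn k q • dX (twist Atom.deg q x) := by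
  by_cases h : Even q
  · rw [twist_even _ h, twist_even _ h, sgn_even h, one_smul]
  · rw [twist_odd _ h, twist_odd _ h, sgn_odd h, par_dX, neg_one_smul]

theorem dInt_opP (w : List Bool) (l : List (List Atom)) :
    dInt (opP w (wd (k := k) l)) = sgn k (w.length + 1) • opP w (dT (wd l)) := by
  induction w generalizing l with
  | nil =>
    by_cases h : l = []
    · subst h
      rw [opP_wd (by simp), barOf, fill, wd_nil, map_smul, wd_nil, dInt, der_one, dT, der_one]
      simp
    · have h' : l.length ≠ List.count false [] := by simpa using h
      rw [opP_eq_zero h' (wd_mem_spanWd rfl), opP_eq_zero h' (dT_mem_length (wd_mem_spanWd rfl))]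
      simp
  | cons b w ih =>
    cases b with
    | true =>
      rw [opP_true, dInt_mul, dInt, der_letter, dEntry, zero_mul, zero_add, ← dInt, ih, opP_true,
        par_wd, wdeg_cons, wdeg_nil, sdeg, List.length_cons, smul_mul_assoc, mul_smul_comm,
        smul_smul, ← sgn_add]
      congr 1
      exact sgn_congr k ⟨-1, by push_cast; ring⟩
    | false =>
      cases l with
      | nil =>
        rw [opP_eq_zero (n := 0) (by simp) (wd_mem_spanWd rfl), wd_nil, dT, der_one]
        simp
      | cons y l =>
        rw [wd_cons, ← letter_wd, opP_false, dInt_mul, dInt_inc, ih, dT_mul, dT_letter, map_add,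
          opP_false, par_letter, opP_false, par_inc, twist_dX, ← twist_one, ← twist_one,
          twist_twist, twist_twist, add_comm (w.length : ℤ) 1, List.length_cons, map_smul]
        simp only [smul_mul_assoc, mul_smul_comm, neg_mul]
        push_cast
        have := sgn_mul_self k w.length
        simp only [add_comm (1 : ℤ), sgn_add_one, smul_add, smul_smul, neg_neg, this]
        module

end

section

open DGOperad Presentation

variable {k : Type u} [CommRing k]

/-! ### The structure equation of the operations `p_w` -/

/-- The operation on words given by the summand of the differential of `p_w` that multiplies the
letters number `r` and `r + 1` of `w`, before the evaluation of brackets. -/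
noncomputable def mergeOp (w : List Bool) (r : ℕ) : T k →ₗ[k] Y k :=
  if hr : r + 1 < w.length then
    if w[r] = false ∧ w[r + 1] = false then
      opP (merge w r hr) ∘ₗ ins ((w.take r).count false) 2 0 endMul
    else opP (merge w r hr)
  else 0

theorem merge_cons_succ (b : Bool) (w : List Bool) (r : ℕ) (hr : r + 1 + 1 < (b :: w).length) :
    merge (b :: w) (r + 1) hr = b :: merge w r (by simpa using hr) := rfl

theorem ins_succ (i n : ℕ) (b : T k →ₗ[k] X k) (y : List Atom) (l : List (List Atom)) :
    ins (i + 1) n 0 b (wd (y :: l)) = letter (wd y) * ins i n 0 b (wd l) := by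
  by_cases h : i + n ≤ l.length
  · obtain ⟨u, v, w, rfl, hu, hv⟩ := exists_append₃ h
    rw [← List.cons_append, ← List.cons_append, ins_wd 0 b w (by simp [hu]) hv, ins_wd 0 b w hu hv,
      twist_even _ (by simp), twist_even _ (by simp), wd_cons, letter_wd]
    simp only [mul_assoc]
  · rw [ins, lin_wd, if_neg (by simp; omega), ins, lin_wd, if_neg h, mul_zero]

theorem mergeOp_true (w : List Bool) (r : ℕ) (x : T k) :
    mergeOp (true :: w) (r + 1) x = wd [none] * mergeOp w r x := by
  rw [mergeOp, mergeOp]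
  by_cases h : r + 1 < w.length
  · rw [dif_pos h, dif_pos (by simpa using h)]
    simp only [List.getElem_cons_succ, merge_cons_succ]
    split_ifs
    · simp only [LinearMap.comp_apply, opP_true]
      simp
    · rw [opP_true]
  · rw [dif_neg h, dif_neg (by simpa using h)]
    simp

theorem mergeOp_false (w : List Bool) (r : ℕ) (y : List Atom) (l : List (List Atom)) :
    mergeOp (k := k) (false :: w) (r + 1) (wd (y :: l))
      = sgn k ((w.length - 1) * tdeg y) • (wd [some y] * mergeOp w r (wd l)) := by
  rw [mergeOp, mergeOp]
  by_cases h : r + 1 < w.length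
  · rw [dif_pos h, dif_pos (by simpa using h)]
    simp only [List.getElem_cons_succ, merge_cons_succ]
    have e : ((merge w r h).length : ℤ) = w.length - 1 := by
      have := length_merge w r h
      omega
    split_ifs
    · simp only [LinearMap.comp_apply]
      rw [List.take_succ_cons, List.count_cons_self, ins_succ, opP_false, twist_wd, map_smul,
        inc_wd, smul_mul_assoc, e]
    · rw [wd_cons, ← letter_wd, opP_false, twist_wd, map_smul, inc_wd, smul_mul_assoc, e]
  · rw [dif_neg h, dif_neg (by simpa using h)]
    simp

theorem mergeOp_true_zero {c : Bool} {w : List Bool} {l : List (List Atom)}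
    (h : l.length = (true :: c :: w).count false) :
    mergeOp (true :: c :: w) 0 (wd (k := k) l) = join none (opP (c :: w) (wd l)) := by
  rw [mergeOp, dif_pos (by simp), if_neg (by simp)]
  cases c with
  | true => simp [merge, opP_true, join_cons, emul]
  | false =>
    obtain ⟨y, l, rfl⟩ := List.exists_cons_of_length_pos (l := l) (by rw [h]; simp)
    simp only [wd_cons y l, ← letter_wd, opP_false, join_none_inc]
    simp [merge, opP_false]

theorem mergeOp_false_zero {c : Bool} {w : List Bool} (y : List Atom) {l : List (List Atom)}
    (hl : l.length = (c :: w).count false) :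
    mergeOp (false :: c :: w) 0 (wd (k := k) (y :: l))
      = sgn k (w.length * tdeg y) • join (some y) (opP (c :: w) (wd l)) := by
  rw [mergeOp, dif_pos (by simp)]
  cases c with
  | true =>
    rw [if_neg (by simp), opP_true, join_cons, emul, wd_cons, ← letter_wd]
    simp only [merge, List.take_zero, List.getElem_cons_zero, List.getElem_cons_succ,
      List.nil_append, Bool.false_and, List.drop_succ_cons, List.drop_zero]
    rw [opP_false, twist_wd, map_smul, inc_wd, smul_mul_assoc]
  | false =>
    obtain ⟨y', l, rfl⟩ := List.exists_cons_of_length_pos (l := l) (by rw [hl]; simp)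
    rw [if_pos (by simp), LinearMap.comp_apply]
    simp only [merge, List.take_zero, List.getElem_cons_zero, List.getElem_cons_succ,
      List.nil_append, Bool.false_and, List.drop_succ_cons, List.drop_zero, List.count_nil]
    have := ins_wd (k := k) (i := 0) (n := 2) 0 endMul (u := []) (v := [y, y']) l rfl rfl
    rw [show y :: y' :: l = [] ++ [y, y'] ++ l from rfl, this, twist_even _ (by simp), wd_nil,
      one_mul, wd_cons y [y'], ← letter_wd, ← letter_wd, endMul_letter, opP_false, ← wd_append,
      twist_wd, map_smul, inc_wd, wd_cons y' l, ← letter_wd, opP_false, twist_wd, map_smul, inc_wd,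
      smul_mul_assoc, smul_mul_assoc, map_smul, join_cons, emul, smul_smul, ← sgn_add, wdeg_append,
      mul_add]

/-- The products of adjacent entries give the second sum in the differential of `p_w`. -/
theorem dJoin_opP {w : List Bool} {l : List (List Atom)} (h : l.length = w.count false) :
    dJoin (opP w (wd (k := k) l))
      = ∑ r ∈ Finset.range (w.length - 1), sgn k ((r : ℤ) + 1) • mergeOp w r (wd l) := by
  induction w generalizing l with
  | nil =>
    obtain rfl := List.length_eq_zero_iff.1 (h.trans (by simp))
    rw [opP_wd h, barOf, fill, wd_nil, map_smul, dJoin_one]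
    simp
  | cons b w ih =>
    cases w with
    | nil =>
      simp only [List.length_cons, List.length_nil, zero_add, Nat.sub_self, Finset.range_zero,
        Finset.sum_empty]
      cases b with
      | true =>
        obtain rfl := List.length_eq_zero_iff.1 (h.trans (by simp))
        rw [opP_true, opP_wd (by simp), dJoin_cons, barOf, fill, susp, one_smul, wd_nil, join_one,
          dJoin_one]
        simp
      | false =>
        obtain ⟨y, rfl⟩ := List.length_eq_one_iff.1 (h.trans (by simp))
        rw [opP_wd (by simp), barOf_false y (by simp), map_smul, dJoin_cons, barOf, fill, susp,
          one_smul, wd_nil, join_one, dJoin_one]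
        simp
    | cons c w =>
      rw [List.length_cons, Nat.add_sub_cancel, List.length_cons, Finset.sum_range_succ']
      cases b with
      | true =>
        rw [opP_true, dJoin_cons, ih (by simpa using h)]
        simp only [mergeOp_true, List.length_cons, Nat.add_sub_cancel, sdeg]
        rw [mergeOp_true_zero h, smul_add, Finset.mul_sum, Finset.smul_sum, add_comm]
        refine congrArg₂ (· + ·) (Finset.sum_congr rfl fun r _ => ?_) ?_
        · push_cast
          rw [mul_smul_comm, smul_smul, ← sgn_add]
          congr 1
          exact sgn_congr k ⟨-1, by ring⟩
        · rw [sgn_neg, Nat.cast_zero, zero_add]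
      | false =>
        obtain ⟨y, l, rfl⟩ := List.exists_cons_of_length_pos (l := l) (by rw [h]; simp)
        have hl : l.length = (c :: w).count false := by simpa using h
        rw [wd_cons, ← letter_wd, opP_false, twist_wd, map_smul, inc_wd, smul_mul_assoc, map_smul,
          dJoin_cons, ih hl, letter_wd, ← wd_cons]
        simp only [mergeOp_false, List.length_cons, Nat.add_sub_cancel, sdeg]
        rw [mergeOp_false_zero y hl, smul_add, smul_add, Finset.mul_sum, Finset.smul_sum,
          Finset.smul_sum, add_comm]
        refine congrArg₂ (· + ·) (Finset.sum_congr rfl fun r _ => ?_) ?_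
        · push_cast
          rw [mul_smul_comm, smul_smul, smul_smul, smul_smul, ← sgn_add, ← sgn_add, ← sgn_add]
          congr 1
          exact sgn_congr k ⟨tdeg y - 1, by ring⟩
        · push_cast
          rw [smul_smul, smul_smul, ← sgn_add, ← sgn_add]
          congr 1
          exact sgn_congr k ⟨tdeg y - 1, by ring⟩

/-- The cuts of a bracket give the first sum in the differential of `p_w`. -/
theorem susp_smul_cut {w : List Bool} (hw : w ≠ []) {l : List (List Atom)}
    (h : l.length = w.count false) :
    susp k (fill w l) • cut (k := k) (fill w l) = ∑ i ∈ Finset.range (w.length - 1),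
      (sgn k i * sgn k (((i : ℤ) + 2 - w.length) * wdeg tdeg
      (l.take ((w.take (i + 1)).count false)))) •
        (tau (barOf (w.take (i + 1)) (l.take ((w.take (i + 1)).count false)))
          * tau (barOf (w.drop (i + 1)) (l.drop ((w.take (i + 1)).count false)))) := by
  obtain ⟨n, hn⟩ : ∃ n, w.length = n + 1 := Nat.exists_eq_succ_of_ne_zero (by simpa using hw)
  have hf := length_fill h
  have h₀ : (fill w l).drop (n + 1) = [] := List.drop_of_length_le (by omega)
  rw [cut, decon_eq_sum, hf, hn, Finset.sum_range_succ, Finset.sum_range_succ', Nat.add_sub_cancel,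
    List.take_zero, h₀, tauWord_nil, mul_zero, zero_mul, smul_zero, smul_zero, add_zero, add_zero,
    Finset.smul_sum]
  refine Finset.sum_congr rfl fun i hi => ?_
  have hi' := Finset.mem_range.1 hi
  have hc := count_split w (i + 1)
  set w₁ := w.take (i + 1) with hw₁
  set w₂ := w.drop (i + 1) with hw₂
  have h₁ : (l.take (w₁.count false)).length = w₁.count false := by simp; omega
  have h₂ : (l.drop (w₁.count false)).length = w₂.count false := by simp; omega
  have e : fill w l = fill w₁ (l.take (w₁.count false)) ++ fill w₂ (l.drop (w₁.count false)) := by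
    rw [← fill_append h₁, List.take_append_drop, List.take_append_drop]
  have hl₁ : w₁.length = i + 1 := by simp [hw₁]; omega
  have hl₂ : (w₂.length : ℤ) = n - i := by simp [hw₂]; omega
  rw [e, List.take_left' (by rw [length_fill h₁, hl₁]), List.drop_left'
    (by rw [length_fill h₁, hl₁]),
    susp_append, length_fill h₁, length_fill h₂, barOf, barOf, map_smul, map_smul, tau_wd, tau_wd,
    sdeg_fill h₁, sub_add_cancel, hl₂, hl₁, smul_mul_smul_comm, smul_smul, smul_smul, ← sgn_add,
    mul_right_comm, ← sgn_add]
  congr 2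
  refine sgn_congr k ?_
  push_cast
  generalize wdeg tdeg _ = z
  exact ⟨(n - i) * z - i, by ring⟩

end

section

open DGOperad Presentation

variable {k : Type u} [CommRing k]

/-! ### The action of `O'` on the algebra of words -/

/-- The value of an operation at a tuple of words. -/
noncomputable def valueAt {n : ℕ} {p : ℤ} (l : List (List Atom)) :
    (endOperad k).obj n p →ₗ[k] X k :=
  LinearMap.applyₗ (wd l) ∘ₗ (endObj k n p).subtype

theorem eval_sum {G : ℕ → ℤ → Type} (A : DGOperad k) (φ : ∀ {n : ℕ} {p : ℤ}, G n p → A.obj n p)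
    {n : ℕ} {p : ℤ} (l : List (OpExpr k G n p)) :
    OpExpr.eval A φ (OpExpr.sum l) = (l.map (OpExpr.eval A φ)).sum := by
  induction l with
  | nil => rfl
  | cons x l ih =>
    rw [List.map_cons, List.sum_cons, ← ih]
    rfl

theorem eval_splitTerm (w : List Bool) (i : ℕ) (hi : i + 1 < w.length) {a : ℕ} {q : ℤ}
    (ha : w.count false = a) (hq : (w.length : ℤ) + q = 2) {l : List (List Atom)}
      (h : l.length = a) :
    valueAt l (OpExpr.eval (endOperad k) (genEnd k) (splitTerm k w i hi ha hq))
      = (sgn k i * sgn k (((i : ℤ) + 2 - w.length) *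
          wdeg tdeg (l.take ((w.take (i + 1)).count false)))) •
        (tau (barOf (w.take (i + 1)) (l.take ((w.take (i + 1)).count false)))
          * tau (barOf (w.drop (i + 1)) (l.drop ((w.take (i + 1)).count false)))) := by
  subst ha
  have hc := count_split w (i + 1)
  have h₁ : (l.take ((w.take (i + 1)).count false)).length = (w.take (i + 1)).count false := by
    simp; omega
  have h₂ : (l.drop ((w.take (i + 1)).count false)).length = (w.drop (i + 1)).count false := by
    simp; omega
  change sgn k i • endMul (ins 0 _ _ (tau ∘ₗ opP (w.take (i + 1)))
    (ins _ _ _ (tau ∘ₗ opP (w.drop (i + 1))) (wd l))) = _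
  generalize hl₁ : l.take ((w.take (i + 1)).count false) = l₁ at *
  generalize hl₂ : l.drop ((w.take (i + 1)).count false) = l₂ at *
  obtain rfl : l = l₁ ++ l₂ ++ [] := by
    rw [List.append_nil, ← hl₁, ← hl₂, List.take_append_drop]
  rw [ins_wd _ _ _ h₁ h₂, wd_nil, mul_one, ← one_mul (twist _ _ _),
    ins_mul _ _ _ (by rw [← wd_nil]; exact wd_mem_spanWd rfl) (twist_mem_length _ _ (wd_mem_spanWd h₁)),
    ← wd_nil, twist_wd, wdeg_nil, mul_zero, sgn_zero, one_smul, wd_nil, one_mul, endMul_letter,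
    twist_wd, map_smul, LinearMap.comp_apply, LinearMap.comp_apply, opP_wd h₁, opP_wd h₂,
    smul_mul_assoc, smul_smul]

theorem eval_mergeTerm (w : List Bool) (r : ℕ) (hr : r + 1 < w.length) {a : ℕ} {q : ℤ}
    (ha : w.count false = a) (hq : (w.length : ℤ) + q = 2) (l : List (List Atom)) :
    valueAt l (OpExpr.eval (endOperad k) (genEnd k) (mergeTerm k w r hr ha hq))
      = sgn k ((r : ℤ) + 1) • tau (mergeOp w r (wd l)) := by
  rw [mergeTerm, mergeOp, dif_pos hr]
  split_ifs
  · rfl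
  · rfl

theorem fin_sum_eq (n : ℕ) {M : Type*} [AddCommMonoid M] (f : ℕ → M) (g : Fin n → M)
    (h : ∀ i, g i = f i) :
    ∑ i, g i = ∑ i ∈ Finset.range n, f i := by
  rw [← Fin.sum_univ_eq_sum_range]
  exact Finset.sum_congr rfl fun i _ => h i

theorem valueAt_dP {w : List Bool} (hw : w ≠ []) {a : ℕ} {q : ℤ}
    (ha : w.count false = a) (hq : (w.length : ℤ) + q = 2) {l : List (List Atom)}
      (h : l.length = a) :
    valueAt l (OpExpr.eval (endOperad k) (genEnd k) (dP k w ha hq))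
      = susp k (fill w l) • cut (fill w l) + tau (dJoin (opP w (wd l))) := by
  rw [susp_smul_cut hw (h.trans ha.symm), dJoin_opP (h.trans ha.symm), map_sum]
  have e : OpExpr.eval (endOperad k) (genEnd k) (dP k w ha hq)
    = OpExpr.eval (endOperad k) (genEnd k) (OpExpr.sum (List.ofFn fun l : Fin (w.length - 1) =>
        splitTerm k w l (by omega) ha hq))
    + OpExpr.eval (endOperad k) (genEnd k) (OpExpr.sum (List.ofFn fun r : Fin (w.length - 1) =>
        mergeTerm k w r (by omega) ha hq)) := rfl
  rw [e, map_add, eval_sum, eval_sum, List.map_ofFn, List.map_ofFn, List.sum_ofFn, List.sum_ofFn,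
    map_sum, map_sum]
  refine congrArg₂ (· + ·) (fin_sum_eq _ _ _ fun i => ?_) (fin_sum_eq _ _ _ fun i => ?_)
  · exact eval_splitTerm w i (by omega) ha hq h
  · rw [map_smul]
    exact eval_mergeTerm w i (by omega) ha hq l

theorem none_mem_fill {n : ℕ} {l : List (List Atom)} : none ∉ fill (List.replicate n false) l := by
  induction n generalizing l with
  | zero => simp [fill]
  | succ n ih =>
    cases l with
    | nil => simp [List.replicate_succ, fill]
    | cons y l => simp [List.replicate_succ, fill, ih]

theorem dX_unit : dX (wd (k := k) [.br [none]]) = 0 := by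
  rw [← tauWord_of_mem (l := [none]) (by simp), dX_tauWord, wd_cons, dY_cons, wd_nil, join_one,
    dY_one, dEntry, cut, decon, decon, tauWord_nil]
  simp

theorem valueAt_d_gen {n : ℕ} {p q : ℤ} (h : p + 1 = q) (l : List (List Atom)) (g : Gen n p) :
    valueAt l (OpExpr.eval (endOperad k) (genEnd k) (.d h (.gen g)))
      = dX ((genEnd k g).1 (wd l)) - sgn k p • (genEnd k g).1 (dT (wd l)) := rfl

theorem valueAt_p {a : ℕ} {q : ℤ} (w : List Bool) (hw ha hq) (l : List (List Atom)) :
    valueAt l (OpExpr.eval (endOperad k) (genEnd k) (n := a) (p := q) (.gen (.p w hw ha hq)))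
      = tau (opP w (wd l)) := rfl

theorem endOperad_ext {n : ℕ} {p : ℤ} {a b : (endOperad k).obj n p}
    (h : ∀ l : List (List Atom), l.length = n → valueAt l a = valueAt l b) : a = b :=
  endObj_ext h

theorem genEnd_rel {n : ℕ} {p : ℤ} {x y : Ex k n p} (h : Rel k x y) :
    OpExpr.eval (endOperad k) (genEnd k) x = OpExpr.eval (endOperad k) (genEnd k) y := by
  induction h with
  | assoc =>
    refine endObj_ext fun l hl => ?_
    change endMul (ins 0 2 0 endMul (wd l)) = endMul (ins 1 2 0 endMul (wd l))
    obtain ⟨u, v, w, rfl⟩ := List.length_eq_three.1 hl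
    have h₁ := ins_wd (k := k) (i := 0) (n := 2) 0 endMul (u := []) (v := [u, v]) [w] rfl rfl
    have h₂ := ins_wd (k := k) (i := 1) (n := 2) 0 endMul (u := [u]) (v := [v, w]) [] rfl rfl
    simp only [List.cons_append, List.nil_append, List.append_nil] at h₁ h₂
    rw [h₁, h₂, twist_even _ (by simp), twist_even _ (by simp), wd_nil, one_mul, mul_one,
      wd_cons u [v], wd_cons v [w], ← letter_wd, ← letter_wd, ← letter_wd, endMul_letter,
      endMul_letter, endMul_letter, endMul_letter, mul_assoc]
  | d_m h =>
    refine endOperad_ext fun l hl => ?_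
    rw [valueAt_d_gen, OpExpr.eval, map_zero, genEnd]
    obtain ⟨u, v, rfl⟩ := List.length_eq_two.1 hl
    rw [wd_cons, ← letter_wd, ← letter_wd, endMul_letter, dT_mul, map_add, dT_letter, par_letter,
      dT_letter, endMul_letter, endMul_letter, dX_mul, sgn_zero, one_smul, sub_self]
  | d_j h =>
    refine endOperad_ext fun l hl => ?_
    rw [valueAt_d_gen, OpExpr.eval, map_zero, genEnd]
    obtain rfl := List.length_eq_zero_iff.1 hl
    have h' : endUnit (wd (k := k) []) = wd [.br [none]] := lin_wd _ _
    rw [h', dX_unit, wd_nil, dT, der_one]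
    simp
  | p_unit hw ha hq =>
    refine endOperad_ext fun l hl => ?_
    rw [valueAt_p]
    change _ = endUnit (wd l)
    obtain rfl := List.length_eq_zero_iff.1 hl
    rw [opP_wd (by simp), barOf, fill, fill, map_smul, tau_wd, tauWord_of_mem (by simp), endUnit,
      lin_wd, susp, susp]
    simp [sgn_zero]
  | p_arg hw ha hq =>
    refine endOperad_ext fun l hl => ?_
    rw [valueAt_p]
    change _ = endOne (wd l)
    obtain ⟨u, rfl⟩ := List.length_eq_one_iff.1 hl
    rw [opP_wd (by simp), barOf, fill, fill, map_smul, tau_wd, tauWord_single, endOne, lin_wd, susp,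
      susp]
    simp [sgn_zero]
  | @p_args n q hn hw ha hq =>
    refine endOperad_ext fun l hl => ?_
    rw [valueAt_p, OpExpr.eval, map_zero]
    rw [opP_wd (by simp [hl]), barOf, map_smul, tau_wd]
    have h₁ := none_mem_fill (n := n) (l := l)
    have h₂ := length_fill (w := List.replicate n false) (l := l) (by simp [hl])
    rw [List.length_replicate] at h₂
    generalize fill (List.replicate n false) l = z at *
    match z, h₂, h₁ with
    | [], h₂, _ => simp at h₂; omega
    | [_], h₂, _ => simp at h₂; omega
    | e :: e' :: z, _, h₁ => rw [tauWord_cons_cons h₁, smul_zero]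
  | @d_p a q q' w hw ha hq h hq' =>
    refine endOperad_ext fun l hl => ?_
    rw [valueAt_dP hw ha hq' hl, valueAt_d_gen, genEnd, LinearMap.comp_apply, LinearMap.comp_apply]
    have hl' : l.length = w.count false := hl.trans ha.symm
    have h₁ := dInt_opP (k := k) w l
    have h₂ : lin (cut (k := k)) (opP w (wd (k := k) l)) = susp k (fill w l) • cut (fill w l) := by
      rw [opP_wd hl', barOf, map_smul, lin_wd]
    obtain rfl : q = 1 - w.length := by omega
    have h₃ : sgn k (1 - w.length) = sgn k (w.length + 1) := sgn_congr k ⟨-w.length, by ring⟩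
    rw [dX_tau, h₂, h₃, ← map_smul, ← h₁, dJoin, LinearMap.sub_apply, map_sub]
    abel

/-- The action of `O'` on the algebra of words. -/
noncomputable def action (k : Type u) [CommRing k] : Hom (OPrime k) (endOperad k) :=
  presentedLift (endOperad k) (genEnd k) fun h => genEnd_rel h

/-- The value of an operation when all of its arguments are leaves. -/
noncomputable def ev {n : ℕ} {p : ℤ} : (OPrime k).obj n p →ₗ[k] X k :=
  valueAt (k := k) (List.replicate n [.leaf]) ∘ₗ (action k).app

theorem ev_apply {n : ℕ} {p : ℤ} (c : (OPrime k).obj n p) :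
    ev c = ((action k).app c).1 (wd (List.replicate n [.leaf])) := rfl

theorem dX_leaf : dX (wd (k := k) [.leaf]) = 0 := by rw [dX, der_letter, dAtom]

theorem dT_leaf (n : ℕ) : dT (wd (k := k) (List.replicate n [.leaf])) = 0 := by
  induction n with
  | zero => rw [List.replicate_zero, wd_nil, dT, der_one]
  | succ n ih =>
    rw [List.replicate_succ, wd_cons, dT_mul, ih, ← letter_wd, dT_letter, dX_leaf]
    simp

theorem ev_d {n : ℕ} {p q : ℤ} (h : p + 1 = q) (c : (OPrime k).obj n p) :
    ev ((OPrime k).d h c) = dX (ev c) := by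
  rw [ev_apply, (action k).map_d, endOperad_d, LinearMap.sub_apply, LinearMap.smul_apply,
    LinearMap.comp_apply, LinearMap.comp_apply, dT_leaf, map_zero, smul_zero, sub_zero, ev_apply]

end

section

open DGOperad Presentation

variable {k : Type u} [CommRing k]

/-! ### Composites of generators -/

/-- A generator, as an operation of `O'`. -/
def genOp (k : Type u) [CommRing k] {n : ℕ} {p : ℤ} (g : Gen n p) : (OPrime k).obj n p :=
  PresentedObj.mk (Rel k) (.gen g)

/-- The linear combinations of operations obtained by composing generators.  The operations with
`Built none` are linear combinations of iterated composites `g(s₁, …, sₙ)`, and the operations with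
`Built (some i)` are linear combinations of generators in which such composites have been plugged
into all the inputs except for the first `i` ones. -/
inductive Built (k : Type u) [CommRing k] : Option ℕ → ∀ {n : ℕ} {p : ℤ}, (OPrime k).obj n p → Prop
  | zero {s : Option ℕ} {n : ℕ} {p : ℤ} : Built k s (0 : (OPrime k).obj n p)
  | add {s : Option ℕ} {n : ℕ} {p : ℤ} {x y : (OPrime k).obj n p} (hx : Built k s x)
      (hy : Built k s y) :
      Built k s (x + y)
  | smul {s : Option ℕ} {n : ℕ} {p : ℤ} (c : k) {x : (OPrime k).obj n p} (hx : Built k s x) :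
      Built k s (c • x)
  | one : Built k none (OPrime k).one
  | gen {n : ℕ} {p : ℤ} (g : Gen n p) : Built k (some n) (genOp k g)
  | plug {m n r : ℕ} {p q s : ℤ} (i : ℕ) (hi : i < m) (hr : m + n = r + 1) (hs : p + q = s)
      {x : (OPrime k).obj m p} {b : (OPrime k).obj n q} (hx : Built k (some (i + 1)) x)
      (hb : Built k none b) : Built k (some i) ((OPrime k).comp i hi hr hs x b)
  | close {n : ℕ} {p : ℤ} {x : (OPrime k).obj n p} (hx : Built k (some 0) x) : Built k none x

/-- By the two associativity laws, composing with `b` plugs `b` into one of the operations which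
were plugged in earlier. -/
theorem Built.comp {o : Option ℕ} {m n r : ℕ} {p q s : ℤ} {i : ℕ} (hi : i < m) (hr : m + n = r + 1)
    (hs : p + q = s) {x : (OPrime k).obj m p} {b : (OPrime k).obj n q} (hx : Built k o x)
    (ho : ∀ j, o = some j → j ≤ i) (hb : Built k none b) :
    Built k o ((OPrime k).comp i hi hr hs x b) := by
  induction hx generalizing i n r q s b with
  | zero => rw [map_zero, LinearMap.zero_apply]; exact .zero
  | add _ _ hx hy => rw [map_add, LinearMap.add_apply]; exact .add (hx _ _ _ ho hb) (hy _ _ _ ho hb)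
  | smul c _ hx => rw [map_smul, LinearMap.smul_apply]; exact .smul c (hx _ _ _ ho hb)
  | one =>
    obtain rfl : i = 0 := by omega
    obtain rfl : n = r := by omega
    obtain rfl : q = s := by omega
    rw [(OPrime k).one_comp]
    exact hb
  | @gen n p g =>
    have := ho _ rfl
    omega
  | @plug m' n' r' p' q' s' i' hi' hr' hs' x b' hx hb' ihx ihb' =>
    have hii := ho i' rfl
    by_cases h : i < i' + n'
    · obtain ⟨j, rfl⟩ := Nat.exists_eq_add_of_le hii
      rw [(OPrime k).comp_seq i' j hi' (by omega) hr' hs' hi hr hs (s := n' + n - 1) (by omega) rfl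
        (by omega) (by omega)]
      exact .plug _ _ _ _ hx (ihb' _ _ _ (fun j h => by cases h) hb)
    · rw [(OPrime k).comp_par i' (i + 1 - n') i (by omega) (by omega) (by omega)
        (by omega) hr' hs' hi hr hs
        (s := m' + n - 1) (by omega) rfl (by omega) (by omega) (by omega)]
      exact .smul _ (.plug _ _ _ _ (ihx _ _ _ (fun j h => by cases h; omega) hb) hb')
  | close hx ih => exact .close (ih _ _ _ (fun j h => by cases h; omega) hb)

theorem Built.gen_of_le {n : ℕ} {p : ℤ} (g : Gen n p) {i j : ℕ} (h : i + j = n) :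
    Built k (some i) (genOp k g) := by
  induction j generalizing i with
  | zero =>
    obtain rfl : i = n := by omega
    exact .gen g
  | succ j ih =>
    rw [← (OPrime k).comp_one i (by omega) rfl (by omega) (genOp k g)]
    exact .plug _ _ _ _ (ih (i := i + 1) (by omega)) .one

theorem Built.genOp {n : ℕ} {p : ℤ} (g : Gen n p) : Built k none (genOp k g) :=
  .close (.gen_of_le g (zero_add n))

theorem Built.none {o : Option ℕ} {n : ℕ} {p : ℤ} {x : (OPrime k).obj n p} (hx : Built k o x) :
    Built k none x := by
  induction hx with
  | zero => exact .zero
  | add _ _ hx hy => exact .add hx hy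
  | smul c _ hx => exact .smul c hx
  | one => exact .one
  | gen g => exact .genOp g
  | plug i hi hr hs _ _ ihx ihb => exact .comp hi hr hs ihx (fun j h => by cases h) ihb
  | close _ ih => exact ih

theorem mk_eq_of_rel {n : ℕ} {p : ℤ} {x y : Ex k n p} (h : Rel k x y) :
    PresentedObj.mk (Rel k) x = PresentedObj.mk (Rel k) y := PresentedObj.sound _ (.of h)

theorem Built.mk_sum {n : ℕ} {p : ℤ} {l : List (Ex k n p)}
    (h : ∀ x ∈ l, Built k .none (PresentedObj.mk (Rel k) x : (OPrime k).obj n p)) :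
    Built k .none (PresentedObj.mk (Rel k) (OpExpr.sum l) : (OPrime k).obj n p) := by
  induction l with
  | nil => exact .zero
  | cons x l ih => exact .add (h x (by simp)) (ih fun y hy => h y (by simp [hy]))

theorem Built.mk_smul {n : ℕ} {p : ℤ} (c : k) {x : Ex k n p}
    (h : Built k .none (PresentedObj.mk (Rel k) x : (OPrime k).obj n p)) :
    Built k .none (PresentedObj.mk (Rel k) (.smul c x) : (OPrime k).obj n p) := .smul c h

theorem Built.d_gen {n : ℕ} {p q : ℤ} (h : p + 1 = q) (g : Gen n p) :
    Built k .none ((OPrime k).d h (OPrime.genOp k g)) := by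
  cases g with
  | m =>
    obtain rfl : q = 1 := by omega
    rw [show (OPrime k).d h (OPrime.genOp k .m) = 0 from mk_eq_of_rel (.d_m h)]
    exact .zero
  | j =>
    obtain rfl : q = 1 := by omega
    rw [show (OPrime k).d h (OPrime.genOp k .j) = 0 from mk_eq_of_rel (.d_j h)]
    exact .zero
  | p w hw ha hq =>
    rw [show (OPrime k).d h (OPrime.genOp k (.p w hw ha hq)) = PresentedObj.mk (Rel k)
      (dP k w ha (by omega)) from
      mk_eq_of_rel (.d_p w hw ha hq h (by omega))]
    refine .add (.mk_sum fun x hx => ?_) (.mk_sum fun x hx => ?_)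
    · obtain ⟨i, rfl⟩ := (List.mem_ofFn' _ _).1 hx
      refine .smul _ (.comp _ _ _ (.comp _ _ _ (.genOp .m) (fun j h => by cases h) (.genOp _))
        (fun j h => by cases h) (.genOp _))
    · obtain ⟨i, rfl⟩ := (List.mem_ofFn' _ _).1 hx
      dsimp only [mergeTerm]
      refine .mk_smul _ ?_
      split_ifs
      · exact .comp _ _ _ (.genOp _) (fun j h => by cases h) (.genOp .m)
      · exact .genOp _

/-- The Leibniz rule and the relations express the differential of a composite of generators through
such composites. -/
theorem Built.d {o : Option ℕ} {n : ℕ} {p q : ℤ} (h : p + 1 = q) {x : (OPrime k).obj n p}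
    (hx : Built k o x) : Built k .none ((OPrime k).d h x) := by
  induction hx generalizing q with
  | zero => rw [map_zero]; exact .zero
  | add _ _ hx hy => rw [map_add]; exact .add (hx h) (hy h)
  | smul c _ hx => rw [map_smul]; exact .smul c (hx h)
  | one =>
    obtain rfl : q = 1 := by omega
    have : PresentedObj.mk (Rel k) (.gen (.p [false] (by simp) rfl rfl)) = (OPrime k).one :=
      mk_eq_of_rel (.p_arg _ _ _)
    rw [← this]
    exact .d_gen h _
  | gen g => exact .d_gen h g
  | plug i hi hr hs hx hb ihx ihb =>
    rw [(OPrime k).d_comp i hi hr hs rfl rfl h (by omega) (by omega)]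
    exact .add (.comp _ _ _ (ihx rfl) (fun j h => by cases h) hb)
      (.smul _ (.comp _ _ _ hx.none (fun j h => by cases h) (ihb rfl)))
  | close _ ih => exact ih h

/-- Every operation of `O'` is a linear combination of composites of generators: by the relations,
no differentials are needed. -/
theorem built {n : ℕ} {p : ℤ} (x : (OPrime k).obj n p) : Built k none x := by
  induction x using PresentedObj.ind with
  | h x =>
    induction x with
    | gen g => exact .genOp g
    | zero => exact .zero
    | add x y hx hy => exact .add hx hy
    | smul c x hx => exact .smul c hx
    | d h x hx => exact .d h hx
    | one => exact .one
    | comp i hi hr hs a b ha hb => exact .comp hi hr hs ha (fun j h => by cases h) hb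

end

section

open DGOperad Presentation

variable {k : Type u} [CommRing k]

/-! ### Operations described by words -/

/-- Operations of arbitrary arity and degree. -/
abbrev Op (k : Type u) [CommRing k] : Type u := Σ (n : ℕ) (p : ℤ), (OPrime k).obj n p

/-- An operation, together with its arity and its degree. -/
abbrev op {n : ℕ} {p : ℤ} (a : (OPrime k).obj n p) : Op k := ⟨n, p, a⟩

/-- Partial composition of operations of arbitrary arities and degrees; it is set to be the first
operation if the input does not exist. -/
noncomputable def opComp (i : ℕ) (a b : Op k) : Op k :=
  if h : i < a.1 then
    ⟨a.1 + b.1 - 1, a.2.1 + b.2.1, (OPrime k).comp i h (by omega) rfl a.2.2 b.2.2⟩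
  else a

theorem opComp_op {m n r : ℕ} {p q s : ℤ} (i : ℕ) (hi : i < m) (hr : m + n = r + 1) (hs : p + q = s)
    (a : (OPrime k).obj m p) (b : (OPrime k).obj n q) :
    opComp i (op a) (op b) = op ((OPrime k).comp i hi hr hs a b) := by
  obtain rfl : r = m + n - 1 := by omega
  subst hs
  exact dif_pos hi

theorem opComp_seq (i j : ℕ) {a b : Op k} (c : Op k) (hi : i < a.1) (hj : j < b.1) :
    opComp (i + j) (opComp i a b) c = opComp i a (opComp j b c) := by
  obtain ⟨l, p, a⟩ := a
  obtain ⟨m, q, b⟩ := b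
  obtain ⟨n, p', c⟩ := c
  simp only at hi hj
  rw [opComp_op i hi (r := l + m - 1) (by omega) rfl, opComp_op (i + j) (by omega)
    (r := l + m - 1 + n - 1) (by omega) rfl,
    opComp_op j hj (r := m + n - 1) (by omega) rfl, opComp_op i hi (r := l + m - 1 + n - 1)
    (by omega) (s := p + q + p') (by omega)]
  congr 1
  exact (OPrime k).comp_seq ..

theorem opComp_par (i j j' : ℕ) {a b : Op k} (c : Op k) (hij : i < j) (hj : j < a.1)
    (hj' : j + b.1 = j' + 1) (hb : b.2.1 = 0) :
    opComp j' (opComp i a b) c = opComp i (opComp j a c) b := by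
  obtain ⟨l, p, a⟩ := a
  obtain ⟨m, q, b⟩ := b
  obtain ⟨n, p', c⟩ := c
  simp only at hj hj' hb
  subst hb
  rw [opComp_op i (by omega) (r := l + m - 1) (by omega) rfl,
    opComp_op j' (by omega) (r := l + m - 1 + n - 1) (by omega) rfl,
    opComp_op j hj (r := l + n - 1) (by omega) rfl,
    opComp_op i (by omega) (r := l + m - 1 + n - 1) (by omega) (s := p + 0 + p') (by omega),
    (OPrime k).comp_par i j j' (by omega) hj hij hj' (by omega) rfl (by omega) (by omega) rfl
      (s := l + n - 1) (by omega) rfl (by omega) (by omega) (by omega),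
    zero_mul, sgn_zero, one_smul]

/-- The product of two operations. -/
noncomputable def opMul (a b : Op k) : Op k := opComp 0 (opComp 1 (op (genOp k .m)) b) a

theorem opMul_assoc (a b c : Op k) : opMul (opMul a b) c = opMul a (opMul b c) := by
  have hm : opComp 0 (op (genOp k .m)) (op (genOp k .m)) = opComp 1 (op (genOp k .m))
      (op (genOp k .m)) := by
    rw [opComp_op 0 (by omega) (r := 3) (by omega) (s := 0) (by omega),
      opComp_op 1 (by omega) (r := 3) (by omega) (s := 0) (by omega)]
    exact congrArg op (mk_eq_of_rel .assoc)
  have h1 (x : Op k) : (opComp 1 (op (genOp k .m)) x).1 = x.1 + 1 := by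
    obtain ⟨n, p, x⟩ := x
    rw [opComp_op 1 (by omega) (r := n + 1) (by omega) rfl]
  have h2 (x : Op k) : opComp 0 (opComp 1 (op (genOp k .m)) x) (op (genOp k .m))
      = opComp 2 (opComp 0 (op (genOp k .m)) (op (genOp k .m))) x :=
    (opComp_par 0 1 2 x (by omega) (by simp) rfl rfl).symm
  rw [opMul, opMul, opMul, opMul, ← opComp_seq 0 0 a (by rw [h1]; omega) (by rw [h1]; omega),
    ← opComp_seq 0 1 b (by rw [h1]; omega) (by simp), h2, hm, opComp_seq 1 1 c (by simp) (by simp),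
    ← opComp_seq 1 0 b (by simp) (by rw [h1]; omega)]

/-- The pattern of formal units of a bracket. -/
def shape (l : List Entry) : List Bool := l.map Option.isNone

/-- The words in a bracket. -/
def args (l : List Entry) : List (List Atom) := l.filterMap id

theorem fill_shape_args (l : List Entry) : fill (shape l) (args l) = l := by
  induction l with
  | nil => rfl
  | cons e l ih => cases e <;> simp_all [shape, args, fill]

theorem shape_fill {w : List Bool} {l : List (List Atom)} (h : l.length = w.count false) :
    shape (fill w l) = w := by
  induction w generalizing l with
  | nil => rfl
  | cons b w ih =>
    cases b with
    | true => simpa [fill, shape] using ih (l := l) (by simpa using h)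
    | false =>
      cases l with
      | nil => simp at h
      | cons y l => simpa [fill, shape] using ih (l := l) (by simpa using h)

theorem length_args (l : List Entry) : (args l).length = (shape l).count false := by
  induction l with
  | nil => rfl
  | cons e l ih => cases e <;> simp_all [shape, args]

/-- The operation `p_w`; for the empty word, the identity is taken as a default value. -/
noncomputable def opGen (k : Type u) [CommRing k] (w : List Bool) : Op k :=
  if hw : w = [] then op (OPrime k).one else
    op (genOp k (.p w hw rfl (q := 1 - w.length) (by omega)))

mutual
/-- The operation described by a letter. -/
noncomputable def opAtom (k : Type u) [CommRing k] : Atom → Op k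
  | .leaf => op (OPrime k).one
  | .br l => opBar k 0 (opGen k (l.map Option.isNone)) l
/-- The operation described by a word: the product of its letters. The identity is the default value
at the empty word. -/
noncomputable def opWord (k : Type u) [CommRing k] : List Atom → Op k
  | [] => op (OPrime k).one
  | a :: w => if w.isEmpty then opAtom k a else opMul (opAtom k a) (opWord k w)
/-- The operation obtained from `c` by plugging the words in a bracket into its inputs, starting
from the input number `i`. -/
noncomputable def opBar (k : Type u) [CommRing k] (i : ℕ) (c : Op k) : List Entry → Op k
  | [] => c
  | none :: l => opBar k i c l
  | some w :: l => opComp i (opBar k (i + 1) c l) (opWord k w)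
end

theorem opWord_single (a : Atom) : opWord k [a] = opAtom k a := by rw [opWord]; rfl

theorem opWord_cons (a : Atom) {w : List Atom} (h : w ≠ []) :
    opWord k (a :: w) = opMul (opAtom k a) (opWord k w) := by
  rw [opWord, if_neg (by simpa using h)]

theorem opWord_append {w w' : List Atom} (h : w ≠ []) (h' : w' ≠ []) :
    opWord k (w ++ w') = opMul (opWord k w) (opWord k w') := by
  induction w with
  | nil => exact absurd rfl h
  | cons a w ih =>
    by_cases hw : w = []
    · subst hw
      rw [List.singleton_append, opWord_cons a h', opWord_single]
    · rw [List.cons_append, opWord_cons a (by simp [h']), ih hw, opWord_cons a hw, opMul_assoc]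

mutual
/-- The letters which describe basis elements of `O'`: each bracket in them contains a formal unit,
and all the words in brackets are nonempty. -/
def Atom.Good : Atom → Prop
  | .leaf => True
  | .br l => none ∈ l ∧ GoodBar l
/-- The words all of whose letters describe basis elements. -/
def GoodWord : List Atom → Prop
  | [] => True
  | a :: w => a.Good ∧ GoodWord w
/-- The brackets all of whose words are nonempty and consist of good letters. -/
def GoodBar : List Entry → Prop
  | [] => True
  | none :: l => GoodBar l
  | some w :: l => (w ≠ [] ∧ GoodWord w) ∧ GoodBar l
end

theorem goodWord_iff {w : List Atom} : GoodWord w ↔ ∀ a ∈ w, a.Good := by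
  induction w with
  | nil => simp [GoodWord]
  | cons a w ih => simp [GoodWord, ih]

theorem goodBar_iff {l : List Entry} : GoodBar l ↔ ∀ w, some w ∈ l → w ≠ [] ∧ GoodWord w := by
  induction l with
  | nil => simp [GoodBar]
  | cons e l ih => cases e <;> simp [GoodBar, ih]

/-- The number of leaves of a word. -/
abbrev leaves : List Atom → ℕ := wordStat 1 0 0 0

/-- The number of leaves of a bracket. -/
abbrev barLeaves : List Entry → ℕ := barStat 1 0 0 0

/-- The operation `a` has the arity and the degree of the word `w`, and its value at the generating
words is `w` up to a sign. -/
def Represents (a : Op k) (w : List Atom) : Prop :=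
  a.1 = leaves w ∧ a.2.1 = tdeg w ∧ ∃ s : ℤ, ev a.2.2 = sgn k s • wd w

/-- The value of a composite when the arguments of the inner operation are leaves. -/
theorem ev_comp {m n r : ℕ} {p q s : ℤ} (i : ℕ) (hi : i < m) (hr : m + n = r + 1) (hs : p + q = s)
    (a : (OPrime k).obj m p) (b : (OPrime k).obj n q) (u v : List (List Atom)) (hu : u.length = i) :
    ((action k).app ((OPrime k).comp i hi hr hs a b)).1 (wd (u ++ List.replicate n [.leaf] ++ v))
      = ((action k).app a).1 (twist tdeg q (wd u) * letter (ev b) * wd v) := by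
  rw [(action k).map_comp, endOperad_comp, LinearMap.comp_apply, ins_wd _ _ _ hu (by simp),
    ev_apply]

theorem Represents.mul {a b : Op k} {w w' : List Atom} (ha : Represents a w)
    (hb : Represents b w') :
    Represents (opMul a b) (w ++ w') := by
  obtain ⟨n, p, a⟩ := a
  obtain ⟨n', p', b⟩ := b
  obtain ⟨rfl, rfl, s, ha⟩ := ha
  obtain ⟨rfl, rfl, s', hb⟩ := hb
  rw [opMul, opComp_op 1 (by omega) (r := leaves w' + 1) (by omega) (zero_add _),
    opComp_op 0 (by omega) (r := leaves w + leaves w') (by omega) (s := tdeg w + tdeg w') (by omega)]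
  refine ⟨(wordStat_append _ _ _ _ w w').symm, (wdeg_append _ _ _).symm, s + s' + tdeg w' * tdeg w,
    ?_⟩
  have h := ev_comp (k := k) 0 (Nat.succ_pos _) (r := leaves w + leaves w')
    (by omega) (s := tdeg w + tdeg w') (by omega)
    ((OPrime k).comp 1 (by omega) (r := leaves w' + 1) (by omega) (zero_add _) (genOp k .m) b) a []
    (List.replicate (leaves w') [.leaf]) rfl
  rw [List.nil_append, ← List.replicate_add] at h
  rw [ev_apply, h, ha, map_smul, wd_nil, letter_wd]
  have h' := ev_comp (k := k) 1 (by omega) (r := leaves w' + 1) (by omega) (zero_add _)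
    (genOp k .m) b [w] [] rfl
  rw [List.append_nil, wd_append, hb, twist_wd, wd_nil, mul_one] at h'
  have h0 : twist tdeg (tdeg w) (1 : T k) = 1 := by rw [← wd_nil, twist_wd]; simp [sgn_zero]
  rw [h0, one_mul, smul_mul_assoc, map_smul, h', map_smul, letter_wd, smul_mul_assoc, mul_smul_comm,
    map_smul, map_smul, wdeg_cons, wdeg_nil, add_zero]
  have h'' : ((action k).app (genOp k .m)).1 (wd [w] * wd [w']) = wd (w ++ w') := by
    rw [← letter_wd, ← letter_wd, wd_append]
    exact endMul_letter _ _
  rw [h'', smul_smul, smul_smul, ← sgn_add, ← sgn_add]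
  congr 2
  ring

theorem susp_eq_sgn (l : List Entry) : ∃ s : ℤ, susp k l = sgn k s := by
  induction l with
  | nil => exact ⟨0, (sgn_zero k).symm⟩
  | cons e l ih =>
    obtain ⟨s, hs⟩ := ih
    exact ⟨_ + s, by rw [susp, hs, ← sgn_add]⟩

/-- The operation described by a good word takes the value of this word, up to a sign, when all of
its arguments are leaves. The middle statement is the inductive step for brackets, in which the
inputs are filled from the right. -/
theorem represents_opWord : (∀ a : Atom, a.Good → Represents (opAtom k a) [a]) ∧
    (∀ l : List Entry, GoodBar l → ∀ (i : ℕ) (c : Op k), c.1 = i + (args l).length →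
      (opBar k i c l).1 = i + barLeaves l ∧ (opBar k i c l).2.1 = c.2.1 + wdeg tdeg (args l) ∧
      ∀ u : List (List Atom), u.length = i → ∃ s : ℤ,
        ((action k).app (opBar k i c l).2.2).1 (wd (u ++ List.replicate (barLeaves l) [.leaf]))
          = sgn k s • ((action k).app c.2.2).1 (wd (u ++ args l))) ∧
    ∀ w : List Atom, GoodWord w → w ≠ [] → Represents (opWord k w) w := by
  refine Atom.induction ?_ ?_ ?_ ?_ ?_ ?_ ?_
  · intro _
    refine ⟨rfl, rfl, 0, ?_⟩
    rw [sgn_zero, one_smul, ev_apply]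
    change endOne (wd [[.leaf]]) = _
    rw [← letter_wd, endOne_letter]
  · intro l ih hl
    have hs : shape l ≠ [] := by
      intro h
      have := hl.1
      rw [List.map_eq_nil_iff.1 h] at this
      simp at this
    have hc : opGen k (shape l) = op (genOp k
        (.p (shape l) hs rfl (q := 1 - (shape l).length) (by omega))) :=
      dif_neg hs
    obtain ⟨h₁, h₂, h₃⟩ := ih hl.2 0 (opGen k (shape l)) (by rw [hc, length_args, zero_add])
    obtain ⟨s, h₃⟩ := h₃ [] rfl
    obtain ⟨s', hs'⟩ := susp_eq_sgn (k := k) l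
    have hd := sdeg_fill (length_args l)
    rw [fill_shape_args] at hd
    rw [opAtom]
    change Represents (opBar k 0 (opGen k (shape l)) l) _
    refine ⟨by rw [h₁]; simp [wordStat, Atom.stat], ?_, s + s', ?_⟩
    · rw [h₂, hc]
      change 1 - ((shape l).length : ℤ) + wdeg tdeg (args l) = wdeg Atom.deg [.br l]
      rw [wdeg_cons, wdeg_nil, deg_br, hd]
      ring
    · have h₄ : ((action k).app (opGen k (shape l)).2.2).1 (wd ([] ++ args l)) =
        sgn k s' • wd [.br l] := by
        rw [hc, List.nil_append]
        change tau (opP (shape l) (wd (args l))) = _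
        rw [opP_wd (length_args l), barOf, fill_shape_args, map_smul, tau_wd, tauWord_of_mem hl.1,
          hs']
      rw [h₄, List.nil_append] at h₃
      have e : List.replicate (opBar k 0 (opGen k (shape l)) l).1 [Atom.leaf]
          = List.replicate (barLeaves l) [.leaf] := by rw [h₁, zero_add]
      rw [ev_apply, e, h₃, smul_smul, sgn_add]
  · intro _ i c hc
    exact ⟨by rw [opBar, hc]; rfl, by rw [opBar]; simp [args], fun u hu => ⟨0, by
      rw [opBar, sgn_zero, one_smul]; rfl⟩⟩
  · intro l ih hl i c hc
    rw [opBar, barLeaves, barStat, zero_add]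
    exact ih hl i c hc
  · intro w l ihw ihl hl i c hc
    rw [opBar, barLeaves, barStat, zero_add]
    have ha : args (some w :: l) = w :: args l := rfl
    rw [ha] at hc ⊢
    rw [List.length_cons] at hc
    obtain ⟨h₁, h₂, h₃⟩ := ihl hl.2 (i + 1) c (by omega)
    obtain ⟨h₄, h₅, s, h₆⟩ := ihw hl.1.2 hl.1.1
    generalize opBar k (i + 1) c l = x at *
    generalize opWord k w = y at *
    obtain ⟨n, p, x⟩ := x
    obtain ⟨n', p', y⟩ := y
    simp only at h₁ h₂ h₃ h₄ h₅ h₆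
    subst h₄ h₅
    rw [opComp_op i (by omega) (r := i + (leaves w + barLeaves l)) (by omega) rfl]
    refine ⟨rfl, ?_, fun u hu => ?_⟩
    · change p + tdeg w = _
      rw [wdeg_cons]
      omega
    obtain ⟨s', h₃⟩ := h₃ (u ++ [w]) (by simp [hu])
    refine ⟨s + tdeg w * wdeg tdeg u + s', ?_⟩
    rw [List.replicate_add, ← List.append_assoc, ev_comp i _ _ _ _ _ _ _ hu, h₆, map_smul,
      letter_wd, twist_wd, mul_smul_comm, smul_mul_assoc, smul_mul_assoc, smul_mul_assoc,
      ← wd_append, ← wd_append, map_smul, map_smul, h₃, List.append_assoc, List.singleton_append,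
      smul_smul, smul_smul, ← sgn_add, ← sgn_add]
  · intro _ h
    exact absurd rfl h
  · intro a w iha ihw hw _
    by_cases h : w = []
    · subst h
      rw [opWord_single]
      exact iha hw.1
    · rw [opWord_cons a h]
      exact (iha hw.1).mul (ihw hw.2 h)

end

section

open DGOperad Presentation

variable {k : Type u} [CommRing k]

/-! ### A basis of `O'` -/

theorem opBar_map_args (i : ℕ) (c : Op k) (l : List Entry) :
    opBar k i c ((args l).map some) = opBar k i c l := by
  induction l generalizing i with
  | nil => rfl
  | cons e l ih =>
    cases e with
    | none => rw [opBar, ← ih]; rfl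
    | some w => rw [opBar, ← ih, ← opBar]; rfl

theorem opComp_zero (i : ℕ) {c : Op k} (hc : c.2.2 = 0) (b : Op k) : (opComp i c b).2.2 = 0 := by
  by_cases h : i < c.1
  · rw [opComp, dif_pos h]
    change (OPrime k).comp i h _ _ c.2.2 b.2.2 = 0
    rw [hc, map_zero, LinearMap.zero_apply]
  · rw [opComp, dif_neg h, hc]

theorem opBar_zero (i : ℕ) {c : Op k} (hc : c.2.2 = 0) (l : List Entry) :
    (opBar k i c l).2.2 = 0 := by
  induction l generalizing i with
  | nil => rwa [opBar]
  | cons e l ih =>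
    cases e with
    | none => rw [opBar]; exact ih i
    | some w => rw [opBar]; exact opComp_zero i (ih (i + 1)) _

theorem args_fill {w : List Bool} {l : List (List Atom)} (h : l.length = w.count false) :
    args (fill w l) = l := by
  induction w generalizing l with
  | nil => exact (List.length_eq_zero_iff.1 (h.trans (by simp))).symm
  | cons b w ih =>
    cases b with
    | true => simpa [fill, args] using ih (l := l) (by simpa using h)
    | false =>
      cases l with
      | nil => simp at h
      | cons y l => simpa [fill, args] using ih (l := l) (by simpa using h)

theorem mem_fill {w : List Bool} {l : List (List Atom)} (h : l.length = w.count false)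
    {y : List Atom} :
    some y ∈ fill w l ↔ y ∈ l := by
  conv_rhs => rw [← args_fill h, args, List.mem_filterMap]
  simp

theorem none_mem_fill_of_mem {w : List Bool} {l : List (List Atom)} (h : l.length = w.count false)
    (hw : true ∈ w) : none ∈ fill w l := by
  rw [← shape_fill h, shape, List.mem_map] at hw
  obtain ⟨e, he, h'⟩ := hw
  rwa [Option.isNone_iff_eq_none.1 h'] at he

/-- The operations described by good words. -/
def wordOps (k : Type u) [CommRing k] (n : ℕ) (p : ℤ) : Set ((OPrime k).obj n p) :=
  {c | ∃ w, GoodWord w ∧ w ≠ [] ∧ opWord k w = op c}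

/-- The operations obtained by plugging operations described by good words into all but the first
`i` inputs of a generator. -/
def partialOps (k : Type u) [CommRing k] (i n : ℕ) (p : ℤ) : Set ((OPrime k).obj n p) :=
  {c | ∃ (n' : ℕ) (p' : ℤ) (g : Gen n' p') (l : List (List Atom)), (∀ w ∈ l, w ≠ [] ∧ GoodWord w) ∧
    i + l.length = n' ∧ opBar k i (op (genOp k g)) (l.map some) = op c}

theorem op_inj {n : ℕ} {p : ℤ} {a b : (OPrime k).obj n p} (h : op a = op b) : a = b := by
  simpa using h

theorem op_genOp_arg {a : ℕ} {q : ℤ} (hw : [false] ≠ []) (ha : [false].count false = a) (hq) :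
    op (genOp k (.p (q := q) [false] hw ha hq)) = op (OPrime k).one := by
  obtain rfl : a = 1 := ha.symm.trans (by simp)
  obtain rfl : q = 0 := by simpa using hq
  exact congrArg op (mk_eq_of_rel (.p_arg _ _ _))

theorem genOp_args {n a : ℕ} {q : ℤ} (hn : 2 ≤ n) (hw : List.replicate n false ≠ [])
    (ha : (List.replicate n false).count false = a) (hq) :
    genOp k (.p (q := q) (List.replicate n false) hw ha hq) = 0 := by
  obtain rfl : n = a := (by simp : n = _).trans ha
  exact mk_eq_of_rel (.p_args hn _ _ _)

/-- A generator with good words in all of its inputs is described by a good word: `m` concatenates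
words, `j` is the bracket of the formal unit, and `p_w` gives a bracket, unless there are no formal
units in `w`, in which case it is the identity or zero. -/
theorem mem_span_wordOps_of_partialOps {n : ℕ} {p : ℤ} {c : (OPrime k).obj n p}
    (hc : c ∈ partialOps k 0 n p) :
    c ∈ Submodule.span k (wordOps k n p) := by
  obtain ⟨n', p', g, l, hl, hn, hc⟩ := hc
  rw [zero_add] at hn
  cases g with
  | m =>
    obtain ⟨w, w', rfl⟩ := List.length_eq_two.1 hn
    refine Submodule.subset_span ⟨w ++ w', ?_, ?_, ?_⟩
    · simp only [List.mem_cons, List.not_mem_nil, or_false, forall_eq_or_imp, forall_eq] at hl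
      rw [goodWord_iff] at hl ⊢
      rw [goodWord_iff] at hl
      intro a ha
      rcases List.mem_append.1 ha with ha | ha
      · exact hl.1.2 a ha
      · exact hl.2.2 a ha
    · simp [(hl w (by simp)).1]
    · rw [opWord_append (hl w (by simp)).1 (hl w' (by simp)).1, ← hc]
      simp only [List.map_cons, List.map_nil, opBar]
      rfl
  | j =>
    obtain rfl := List.length_eq_zero_iff.1 hn
    refine Submodule.subset_span ⟨[.br [none]], by simp [GoodWord, Atom.Good, GoodBar], by simp, ?_⟩
    rw [← hc, opWord_single, opAtom, opBar, opBar, List.map_nil, opBar]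
    exact congrArg op (mk_eq_of_rel (.p_unit (by simp) rfl rfl))
  | p v hv ha hq =>
    obtain rfl : p' = 1 - v.length := by omega
    subst ha
    have hg : opGen k v = op (genOp k (.p v hv rfl hq)) := dif_neg hv
    by_cases h : true ∈ v
    · refine Submodule.subset_span ⟨[.br (fill v l)], ?_, by simp, ?_⟩
      · refine ⟨⟨none_mem_fill_of_mem hn h, ?_⟩, trivial⟩
        rw [goodBar_iff]
        exact fun w hw => hl w ((mem_fill hn).1 hw)
      · rw [opWord_single, opAtom, ← hc, ← hg, ← opBar_map_args, args_fill hn]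
        change opBar k 0 (opGen k (shape (fill v l))) _ = _
        rw [shape_fill hn]
    · obtain ⟨n', rfl⟩ : ∃ n', v = List.replicate n' false := ⟨v.length, List.eq_replicate_iff.2
        ⟨rfl, fun b hb => by cases b <;> simp_all⟩⟩
      match n' with
      | 0 => exact absurd rfl hv
      | 1 =>
        obtain ⟨w, rfl⟩ := List.length_eq_one_iff.1 hn
        refine Submodule.subset_span ⟨w, (hl w (by simp)).2, (hl w (by simp)).1, ?_⟩
        rw [← hc]
        change _ = opBar k 0 (op (genOp k (.p [false] hv rfl hq))) [some w]
        rw [opBar, opBar, op_genOp_arg]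
        obtain ⟨n, p, x⟩ := opWord k w
        rw [opComp_op 0 (by omega) (add_comm _ _) (zero_add _), (OPrime k).one_comp]
      | n' + 2 =>
        have h0 : (op (genOp k (.p (List.replicate (n' + 2) false) hv rfl hq))).2.2 = 0 :=
          genOp_args (by omega) _ _ _
        have := opBar_zero 0 h0 (l.map some)
        rw [hc] at this
        change c = 0 at this
        rw [this]
        exact zero_mem _

theorem mem_span_of_built {o : Option ℕ} {n : ℕ} {p : ℤ} {x : (OPrime k).obj n p}
    (hx : Built k o x) :
    match o with
    | none => x ∈ Submodule.span k (wordOps k n p)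
    | some i => x ∈ Submodule.span k (partialOps k i n p) := by
  induction hx with
  | zero => split <;> exact zero_mem _
  | add _ _ hx hy => split at hx <;> exact add_mem hx hy
  | smul c _ hx => split at hx <;> exact Submodule.smul_mem _ c hx
  | one =>
    refine Submodule.subset_span ⟨[.leaf], by simp [GoodWord, Atom.Good], by simp, ?_⟩
    rw [opWord_single, opAtom]
  | gen g => exact Submodule.subset_span ⟨_, _, g, [], by simp, by simp,
      by rw [List.map_nil, opBar]⟩
  | @plug m n r p q s i hi hr hs x b hx hb ihx ihb =>
    simp only at ihx ihb ⊢
    have h₁ : ∀ x ∈ partialOps k (i + 1) m p,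
        (OPrime k).comp i hi hr hs x b ∈ Submodule.span k (partialOps k i r s) := by
      intro x hx'
      have h₂ : Submodule.span k (wordOps k n q)
          ≤ (Submodule.span k (partialOps k i r s)).comap ((OPrime k).comp i hi hr hs x) := by
        refine Submodule.span_le.2 fun b hb' => ?_
        obtain ⟨n', p', g, l, hl, hn, hx'⟩ := hx'
        obtain ⟨w, hw, hw', hb'⟩ := hb'
        refine Submodule.subset_span ⟨n', p', g, w :: l, ?_, ?_, ?_⟩
        · simpa using ⟨⟨hw', hw⟩, hl⟩
        · simp
          omega
        · rw [List.map_cons, opBar, hx', hb', opComp_op i hi hr hs]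
      exact h₂ ihb
    have h₃ : Submodule.span k (partialOps k (i + 1) m p)
        ≤ (Submodule.span k (partialOps k i r s)).comap (((OPrime k).comp i hi hr hs).flip b) :=
      Submodule.span_le.2 h₁
    exact h₃ ihx
  | close hx ih =>
    simp only at ih ⊢
    exact Submodule.span_le.2 (fun c hc => mem_span_wordOps_of_partialOps hc) ih

/-- The words with `n` leaves and degree `p` that describe basis elements of `O'(n)^p`. -/
def IsBasisWord (n : ℕ) (p : ℤ) (w : List Atom) : Prop :=
  GoodWord w ∧ w ≠ [] ∧ leaves w = n ∧ tdeg w = p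

theorem span_wordOps (n : ℕ) (p : ℤ) : Submodule.span k (wordOps k n p) = ⊤ :=
  eq_top_iff.2 fun x _ => mem_span_of_built (built x)

theorem isBasisWord_of_opWord {n : ℕ} {p : ℤ} {w : List Atom} (hw : GoodWord w) (hw' : w ≠ [])
    {c : (OPrime k).obj n p} (hc : opWord k w = op c) :
    IsBasisWord n p w ∧ ∃ s : ℤ, ev c = sgn k s • wd w := by
  have h := (represents_opWord (k := k)).2.2 w hw hw'
  rw [hc] at h
  exact ⟨⟨hw, hw', h.1.symm, h.2.1.symm⟩, h.2.2⟩

theorem ev_mem {n : ℕ} {p : ℤ} (c : (OPrime k).obj n p) : ev c ∈ spanWd k (IsBasisWord n p) := by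
  have hc : c ∈ Submodule.span k (wordOps k n p) := by rw [span_wordOps]; trivial
  have : Submodule.span k (wordOps k n p) ≤ (spanWd k (IsBasisWord n p)).comap ev := by
    rw [Submodule.span_le]
    rintro c ⟨w, hw, hw', hc⟩
    obtain ⟨h, s, hs⟩ := isBasisWord_of_opWord hw hw' hc
    change ev c ∈ spanWd k (IsBasisWord n p)
    rw [hs]
    exact Submodule.smul_mem _ _ (wd_mem_spanWd h)
  exact this hc

theorem exists_ev_eq {n : ℕ} {p : ℤ} {x : X k} (hx : x ∈ spanWd k (IsBasisWord n p)) :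
    ∃ c : (OPrime k).obj n p, ev c = x := by
  have : spanWd k (IsBasisWord n p) ≤ LinearMap.range (ev (k := k) (n := n) (p := p)) := by
    rw [spanWd, Submodule.span_le]
    rintro _ ⟨w, ⟨hw, hw', rfl, rfl⟩, rfl⟩
    have h := (represents_opWord (k := k)).2.2 w hw hw'
    generalize opWord k w = c at h
    obtain ⟨n, p, c⟩ := c
    obtain ⟨rfl, rfl, s, hs⟩ := h
    refine ⟨sgn k s • c, ?_⟩
    rw [map_smul, hs, smul_smul, sgn_mul_self, one_smul]
  exact this hx

/-- The map that sends each basis word to the operation it describes, with the appropriate sign, is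
a left inverse. -/
theorem ev_injective (n : ℕ) (p : ℤ) : Function.Injective (ev (k := k) (n := n) (p := p)) := by
  classical
  let f : X k →ₗ[k] (OPrime k).obj n p := lin fun w =>
    if h : ∃ cs : (OPrime k).obj n p × ℤ, opWord k w = op cs.1 ∧ ev cs.1 = sgn k cs.2 • wd w then
      sgn k h.choose.2 • h.choose.1 else 0
  have hf (c : (OPrime k).obj n p) : f (ev c) = c := by
    have hc : c ∈ Submodule.span k (wordOps k n p) := by rw [span_wordOps]; trivial
    induction hc using Submodule.span_induction with
    | mem c hc =>
      obtain ⟨w, hw, hw', hc⟩ := hc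
      obtain ⟨_, s, hs⟩ := isBasisWord_of_opWord hw hw' hc
      have h : ∃ cs : (OPrime k).obj n p × ℤ, opWord k w = op cs.1 ∧ ev cs.1 = sgn k cs.2 • wd w :=
        ⟨(c, s), hc, hs⟩
      rw [hs, map_smul, lin_wd, dif_pos h]
      have h₁ := h.choose_spec.1
      have h₂ := h.choose_spec.2
      generalize h.choose = cs at h₁ h₂
      obtain ⟨c', s'⟩ := cs
      obtain rfl : c = c' := op_inj (hc.symm.trans h₁)
      have h₃ := congrArg (lin fun v => if v = w then (1 : k) else 0) (hs.symm.trans h₂)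
      rw [map_smul, map_smul, lin_wd, if_pos rfl, smul_eq_mul, smul_eq_mul, mul_one, mul_one] at h₃
      rw [h₃, smul_smul, sgn_mul_self, one_smul]
    | zero => simp
    | add x y _ _ hx hy => rw [map_add, map_add, hx, hy]
    | smul c x _ hx => rw [map_smul, map_smul, hx]
  exact Function.LeftInverse.injective hf

end

section

open DGOperad Presentation

variable {k : Type u} [CommRing k]

/-! ### Spans of words -/

theorem mem_spanWd_and {α : Type} {P Q : List α → Prop} {x : WordAlg k α} (hP : x ∈ spanWd k P)
    (hQ : x ∈ spanWd k Q) : x ∈ spanWd k fun l => P l ∧ Q l := by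
  classical
  let f : WordAlg k α →ₗ[k] WordAlg k α := lin fun l => if Q l then wd l else 0
  have h₁ : f x = x :=
    map_eq_of_mem_spanWd (g := LinearMap.id)
    (fun l hl => by rw [lin_wd, if_pos hl, LinearMap.id_apply]) hQ
  rw [← h₁]
  refine map_mem_of_mem_spanWd (fun l hl => ?_) hP
  rw [lin_wd]
  split_ifs with h
  · exact wd_mem_spanWd ⟨hl, h⟩
  · exact zero_mem _

theorem mul_mem_spanWd {α : Type} {P Q R : List α → Prop} (h : ∀ u v, P u → Q v → R (u ++ v))
    {x y : WordAlg k α} (hx : x ∈ spanWd k P) (hy : y ∈ spanWd k Q) : x * y ∈ spanWd k R := by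
  refine map_mem_of_mem_spanWd (f := LinearMap.mulRight k y) (fun u hu => ?_) hx
  refine map_mem_of_mem_spanWd (f := LinearMap.mulLeft k (wd u)) (fun v hv => ?_) hy
  rw [LinearMap.mulLeft_apply, ← wd_append]
  exact wd_mem_spanWd (h u v hu hv)

/-! ### The homotopy -/

/-- The values of the homotopy on words. -/
noncomputable def homotopyWord : List Atom → X k
  | [] => 0
  | .leaf :: w => wd [.leaf] * homotopyWord w
  | .br l :: w => if w.isEmpty then 0 else sgn k (Atom.deg (.br l)) • wd [.br (l ++ [some w])]

/-- The homotopy: it moves the letters to the right of the first bracket of a word into that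
bracket, where they form a new last entry. It vanishes if there are no such letters. -/
noncomputable def homotopy : X k →ₗ[k] X k := lin homotopyWord

theorem homotopy_one : homotopy (1 : X k) = 0 := lin_wd _ _

theorem homotopy_leaf (x : X k) : homotopy (wd [.leaf] * x) = wd [.leaf] * homotopy x := by
  induction x using wd_induction with
  | h l => rw [← wd_append, homotopy, lin_wd, lin_wd]; rfl
  | hadd x y hx hy => simp only [mul_add, map_add, hx, hy]
  | hsmul c x hx => simp only [mul_smul_comm, map_smul, hx]

theorem homotopy_br (l : List Entry) : homotopy (wd (k := k) [.br l]) = 0 := lin_wd _ _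

theorem homotopy_br_cons (l : List Entry) {w : List Atom} (hw : w ≠ []) :
    homotopy (wd (k := k) (.br l :: w)) = sgn k (wdeg sdeg l + 1) • wd [.br (l ++ [some w])] := by
  rw [homotopy, lin_wd, homotopyWord, if_neg (by simpa using hw), deg_br]

theorem homotopy_br_mul {l : List Entry} (hl : none ∈ l) {x : X k}
    (hx : x ∈ spanWd k fun w => w ≠ []) :
    homotopy (wd [.br l] * x) = sgn k (wdeg sdeg l + 1) • tau (wd l * inc x) := by
  refine map_eq_of_mem_spanWd (f := homotopy ∘ₗ LinearMap.mulLeft k (wd [.br l]))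
    (g := sgn k (wdeg sdeg l + 1) • (tau ∘ₗ LinearMap.mulLeft k (wd l) ∘ₗ inc)) (fun w hw => ?_) hx
  simp only [LinearMap.comp_apply, LinearMap.mulLeft_apply, LinearMap.smul_apply]
  rw [← wd_cons, homotopy_br_cons l hw, inc_wd, ← wd_append, tau_wd, tauWord_of_mem (by simp [hl])]

theorem barDeg_append_some (l : List Entry) (w : List Atom) :
    Atom.deg (.br (l ++ [some w])) = Atom.deg (.br l) + tdeg w - 1 := by
  rw [deg_br, deg_br, wdeg_append, wdeg_cons, wdeg_nil, sdeg]
  ring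

theorem goodWord_append {w w' : List Atom} : GoodWord (w ++ w') ↔ GoodWord w ∧ GoodWord w' := by
  simp only [goodWord_iff, List.mem_append, or_imp, forall_and]

theorem goodBar_append {l l' : List Entry} : GoodBar (l ++ l') ↔ GoodBar l ∧ GoodBar l' := by
  simp only [goodBar_iff, List.mem_append, or_imp, forall_and]
  tauto

theorem tdeg_cons (a : Atom) (w : List Atom) : tdeg (a :: w) = a.deg + tdeg w := wdeg_cons _ _ _

theorem leaves_leaf_cons (w : List Atom) : leaves (.leaf :: w) = leaves w + 1 := add_comm _ _

theorem homotopy_mem {n : ℕ} {p : ℤ} {x : X k} (hx : x ∈ spanWd k (IsBasisWord n p)) :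
    homotopy x ∈ spanWd k (IsBasisWord n (p - 1)) := by
  refine map_mem_of_mem_spanWd (fun w hw => ?_) hx
  clear hx
  induction w generalizing n p with
  | nil => exact absurd rfl hw.2.1
  | cons a w ih =>
    obtain ⟨h₁, -, rfl, rfl⟩ := hw
    by_cases hw : w = []
    · subst hw
      cases a with
      | leaf =>
        rw [wd_cons, homotopy_leaf, wd_nil, homotopy_one, mul_zero]
        exact zero_mem _
      | br l => rw [homotopy_br]; exact zero_mem _
    cases a with
    | leaf =>
      rw [wd_cons, homotopy_leaf]
      refine map_mem_of_mem_spanWd (f := LinearMap.mulLeft k (wd [.leaf])) (fun v hv => ?_)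
        (ih ⟨h₁.2, hw, rfl, rfl⟩)
      rw [LinearMap.mulLeft_apply, ← wd_append]
      obtain ⟨h₃, h₄, h₅, h₆⟩ := hv
      refine wd_mem_spanWd ⟨⟨trivial, h₃⟩, by simp, ?_, ?_⟩
      · rw [List.singleton_append, leaves_leaf_cons, leaves_leaf_cons, h₅]
      · rw [List.singleton_append, tdeg_cons, tdeg_cons, h₆]
        ring
    | br l =>
      rw [homotopy_br_cons l hw]
      refine Submodule.smul_mem _ _ (wd_mem_spanWd ⟨⟨⟨?_, ?_⟩, trivial⟩, by simp, ?_, ?_⟩)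
      · exact List.mem_append_left _ h₁.1.1
      · exact goodBar_append.2 ⟨h₁.1.2, ⟨hw, h₁.2⟩, trivial⟩
      · simp [wordStat, Atom.stat, barStat_append, barStat]
      · rw [tdeg_cons, tdeg_cons, barDeg_append_some]
        change _ + 0 = _
        ring

theorem dX_mem {n : ℕ} {p : ℤ} {x : X k} (hx : x ∈ spanWd k (IsBasisWord n p)) :
    dX x ∈ spanWd k (IsBasisWord n (p + 1)) := by
  obtain ⟨c, rfl⟩ := exists_ev_eq hx
  rw [← ev_d rfl]
  exact ev_mem _

/-! ### A well-founded order on words -/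

/-- The number of formal units in a word, at all levels of nesting. -/
abbrev units : List Atom → ℕ := wordStat 0 0 1 0

/-- The number of formal units in a bracket, including those of the brackets inside of it. -/
abbrev barUnits : List Entry → ℕ := barStat 0 0 1 0

theorem barUnits_append (l l' : List Entry) : barUnits (l ++ l') = barUnits l + barUnits l' :=
  barStat_append _ _ _ _ l l'

theorem barUnits_cons (e : Entry) (l : List Entry) :
    barUnits (e :: l) = barUnits [e] + barUnits l :=
  barUnits_append [e] l

theorem units_append (l l' : List Atom) : units (l ++ l') = units l + units l' :=
  wordStat_append _ _ _ _ l l'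

theorem units_br (l : List Entry) : units [.br l] = barUnits l := by simp [wordStat, Atom.stat]

theorem units_br_cons (l : List Entry) (w : List Atom) :
    units (.br l :: w) = barUnits l + units w := by
  simp [wordStat, Atom.stat]

theorem units_leaf_cons (w : List Atom) : units (.leaf :: w) = units w := by
  simp [wordStat, Atom.stat]

theorem barUnits_none (l : List Entry) : barUnits (none :: l) = 1 + barUnits l := rfl

theorem barUnits_some (w : List Atom) (l : List Entry) :
    barUnits (some w :: l) = units w + barUnits l := by
  rw [barUnits, barStat, zero_add]

open Classical in
/-- The number of formal units in a bracket, at all levels of nesting, up to its last formal unit on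
the top level. It does not count the words at the end of the bracket, which are those that the
homotopy adds. -/
noncomputable def barRank : List Entry → ℕ
  | [] => 0
  | e :: l => if none ∈ l then barUnits [e] + barRank l else if e = none then 1 else 0

theorem barRank_append_some (l : List Entry) (w : List Atom) :
    barRank (l ++ [some w]) = barRank l := by
  induction l with
  | nil => simp [barRank]
  | cons e l ih =>
    rw [List.cons_append, barRank, barRank, ih]
    by_cases h : none ∈ l
    · rw [if_pos (by simp [h]), if_pos h]
    · rw [if_neg (by simp [h]), if_neg h]

theorem barRank_append (l : List Entry) {l' : List Entry} (h : none ∈ l') :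
    barRank (l ++ l') = barUnits l + barRank l' := by
  induction l with
  | nil => simp [barStat]
  | cons e l ih =>
    rw [List.cons_append, barRank, if_pos (by simp [h]), ih, barUnits_cons e l, add_assoc]

theorem barRank_pos {l : List Entry} (h : none ∈ l) : 0 < barRank l := by
  induction l with
  | nil => simp at h
  | cons e l ih =>
    rw [barRank]
    split_ifs with h₁ h₂
    · have := ih h₁
      omega
    · omega
    · rcases List.mem_cons.1 h with h | h
      · exact absurd h.symm h₂
      · exact absurd h h₁

theorem barRank_le (l : List Entry) : barRank l ≤ barUnits l := by
  induction l with
  | nil => simp [barRank]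
  | cons e l ih =>
    rw [barRank, barUnits_cons e l]
    split_ifs with h₁ h₂
    · omega
    · subst h₂
      rw [barUnits_none]
      omega
    · omega

/-- The rank of the first bracket of a word, or zero if there is none. -/
noncomputable def wordRank : List Atom → ℕ
  | [] => 0
  | .leaf :: w => wordRank w
  | .br l :: _ => barRank l

theorem wordRank_le (w : List Atom) : wordRank w ≤ units w := by
  induction w with
  | nil => simp [wordRank]
  | cons a w ih =>
    cases a with
    | leaf => rw [wordRank, units_leaf_cons]; exact ih
    | br l =>
      rw [wordRank, units_br_cons]
      have := barRank_le l
      omega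

theorem wordRank_append {w : List Atom} (h : ∃ a ∈ w, a ≠ .leaf) (w' : List Atom) :
    wordRank (w ++ w') = wordRank w := by
  induction w with
  | nil => simp at h
  | cons a w ih =>
    cases a with
    | leaf => exact ih (by simpa using h)
    | br l => rfl

/-- The words whose last letter is a leaf, or the operation `j`, or a bracket that ends with a word.
A bracket with at least two entries which ends with a formal unit is excluded: for instance, the
homotopy vanishes on `[x | 1]` and on its differential. -/
def Tame (w : List Atom) : Prop :=
  ∃ v a, w = v ++ [a] ∧ (a = .leaf ∨ a = .br [none] ∨ ∃ l z, a = .br (l ++ [some z]))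

/-- A word has lower rank than another one if it has fewer formal units, or if it has as many of
them but a first bracket of smaller rank. -/
def Lower (v w : List Atom) : Prop :=
  units v < units w ∨ units v = units w ∧ wordRank v < wordRank w

theorem lower_wellFounded : WellFounded Lower := by
  refine Subrelation.wf (r := InvImage (Prod.Lex (· < ·) (· < ·)) fun w : List Atom =>
    (units w, wordRank w))
    (fun {v w} h => ?_) (InvImage.wf _ (WellFounded.prod_lex wellFounded_lt wellFounded_lt))
  rw [InvImage, Prod.lex_def]
  exact h

theorem Tame.append (w : List Atom) {v : List Atom} (h : Tame v) : Tame (w ++ v) := by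
  obtain ⟨v, a, rfl, h⟩ := h
  exact ⟨w ++ v, a, by simp, h⟩

theorem tame_br (l : List Entry) (z : List Atom) : Tame [.br (l ++ [some z])] :=
  ⟨[], _, rfl, .inr (.inr ⟨l, z, rfl⟩)⟩

theorem Tame.of_append {w v : List Atom} (h : Tame (w ++ v)) (hv : v ≠ []) : Tame v := by
  obtain ⟨v', a, h, ha⟩ := h
  rw [← List.dropLast_append_getLast hv, ← List.append_assoc] at h
  have := List.append_inj_right' h rfl
  exact ⟨v.dropLast, a, by rw [← this, List.dropLast_append_getLast hv], ha⟩

/-- The homotopy produces tame words and preserves both of the numbers by which words are compared.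
-/
theorem homotopy_wd_mem (w : List Atom) :
    homotopy (wd (k := k) w) ∈ spanWd k fun v => Tame v ∧ units v = units w ∧ wordRank v =
    wordRank w := by
  induction w with
  | nil => rw [wd_nil, homotopy_one]; exact zero_mem _
  | cons a w ih =>
    cases a with
    | leaf =>
      rw [wd_cons, homotopy_leaf]
      refine map_mem_of_mem_spanWd (f := LinearMap.mulLeft k (wd [.leaf])) (fun v hv => ?_) ih
      rw [LinearMap.mulLeft_apply, ← wd_append]
      exact wd_mem_spanWd ⟨hv.1.append _, by simp only [List.singleton_append, units_leaf_cons,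
        hv.2.1],
        hv.2.2⟩
    | br l =>
      by_cases hw : w = []
      · subst hw
        rw [homotopy_br]
        exact zero_mem _
      · rw [homotopy_br_cons l hw]
        refine Submodule.smul_mem _ _ (wd_mem_spanWd ⟨tame_br l w, ?_, ?_⟩)
        · rw [units_br, barUnits_append, barUnits_some, units_br_cons]
          rfl
        · exact barRank_append_some l w

end

section

open DGOperad Presentation

variable {k : Type u} [CommRing k]

/-! ### Formal units in differentials -/

theorem tauWord_units (l : List Entry) :
    tauWord (k := k) l ∈ spanWd k fun v => units v = barUnits l := by
  by_cases h : none ∈ l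
  · rw [tauWord_of_mem h]
    exact wd_mem_spanWd (units_br l)
  · rcases l with _ | ⟨_ | w, _ | ⟨e, l⟩⟩
    · rw [tauWord_nil]; exact zero_mem _
    · simp at h
    · simp at h
    · rw [tauWord_single, barUnits_some]; exact wd_mem_spanWd rfl
    · rw [tauWord_cons_cons h]; exact zero_mem _

theorem cut_units (l : List Entry) : cut (k := k) l ∈ spanWd k fun v => units v = barUnits l := by
  refine decon_mem _ fun u v h => Submodule.smul_mem _ _ ?_
  refine mul_mem_spanWd (fun a b ha hb => ?_) (tauWord_units u) (tauWord_units v)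
  rw [units_append, ha, hb, ← h, barUnits_append]

theorem inc_mul_mem {P : List Atom → Prop} {Q R : List Entry → Prop}
    (h : ∀ w l, P w → Q l → R (some w :: l))
    {x : X k} {y : Y k} (hx : x ∈ spanWd k P) (hy : y ∈ spanWd k Q) : inc x * y ∈ spanWd k R := by
  refine mul_mem_spanWd (P := fun u => ∃ w, u = [some w] ∧ P w) (Q := Q) ?_
    (map_mem_of_mem_spanWd (fun w hw => ?_) hx) hy
  · rintro _ v ⟨w, rfl, hw⟩ hv
    exact h w v hw hv
  · rw [inc_wd]
    exact wd_mem_spanWd ⟨w, rfl, hw⟩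

/-- The brackets which may appear in the internal differential of a bracket: there are no more
formal units in them, and strictly fewer ones if all the top-level formal units disappear. -/
def BarLE (l l' : List Entry) : Prop :=
  l ≠ [] ∧ barUnits l ≤ barUnits l' ∧ (none ∈ l' → none ∉ l → barUnits l < barUnits l')

theorem barUnits_emul (e e' : Entry) (l : List Entry) :
    barUnits (emul e e' :: l) ≤ barUnits (e :: e' :: l) ∧
    (e = none ∨ e' = none → barUnits (emul e e' :: l) < barUnits (e :: e' :: l)) := by
  cases e <;> cases e' <;> simp only [emul, barUnits_none, barUnits_some, units_append] <;>
    simp <;> omega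

/-- The differential does not increase the number of formal units. A formal unit on the top level of
a bracket can only disappear by being multiplied with an adjacent entry, and then the number
decreases. -/
theorem differential_units : (∀ a, dAtom (k := k) a ∈ spanWd k fun v => units v ≤ units [a]) ∧
    (∀ l, dY (wd (k := k) l) ∈ spanWd k fun l' => BarLE l' l) ∧
    ∀ w, dX (wd (k := k) w) ∈ spanWd k fun v => units v ≤ units w := by
  refine Atom.induction ?_ ?_ ?_ ?_ ?_ ?_ ?_
  · rw [dAtom]
    exact zero_mem _
  · intro l ih
    rw [dAtom, dBar_eq, units_br]
    refine add_mem (map_mem_of_mem_spanWd (fun v hv => ?_) ih)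
      (spanWd_mono (fun v hv => hv.le) (cut_units l))
    rw [tau_wd]
    exact spanWd_mono (fun v' hv' => hv'.trans_le hv.2.1) (tauWord_units v)
  · rw [wd_nil, dY_one]
    exact zero_mem _
  · intro l ih
    rw [wd_cons, dY_cons, dEntry, zero_mul, zero_add]
    refine Submodule.smul_mem _ _ (add_mem ?_ ?_)
    · cases l with
      | nil => rw [wd_nil, join_one]; exact zero_mem _
      | cons e l =>
        rw [wd_cons, join_cons, ← wd_append]
        have h := barUnits_emul none e l
        exact wd_mem_spanWd ⟨by simp, h.1, fun _ _ => h.2 (.inl rfl)⟩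
    · refine mul_mem_spanWd (P := fun u => u = [none]) (fun u v hu hv => ?_) (wd_mem_spanWd rfl) ih
      subst hu
      refine ⟨by simp, ?_, fun _ h => absurd (by simp) h⟩
      rw [List.singleton_append, barUnits_none, barUnits_none]
      have := hv.2.1
      omega
  · intro w l ihw ihl
    rw [wd_cons, dY_cons, dEntry]
    refine add_mem ?_ (Submodule.smul_mem _ _ (add_mem ?_ ?_))
    · refine inc_mul_mem (Q := fun l' => l' = l) (fun v l' hv hl' => ?_) ihw (wd_mem_spanWd rfl)
      subst hl'
      refine ⟨by simp, ?_, fun h h' => ?_⟩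
      · rw [barUnits_some, barUnits_some]
        omega
      · simp at h h'
        exact absurd h h'
    · cases l with
      | nil => rw [wd_nil, join_one]; exact zero_mem _
      | cons e l =>
        rw [wd_cons, join_cons, ← wd_append]
        have h := barUnits_emul (some w) e l
        refine wd_mem_spanWd ⟨by simp, h.1, fun h₁ h₂ => h.2 ?_⟩
        cases e with
        | none => exact .inr rfl
        | some w' =>
          simp [emul] at h₁ h₂
          exact absurd h₁ h₂
    · refine mul_mem_spanWd (P := fun u => u = [some w]) (fun u v hu hv => ?_)
        (wd_mem_spanWd rfl) ihl
      subst hu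
      obtain ⟨h₁, h₂, h₃⟩ := hv
      refine ⟨by simp, ?_, fun h h' => ?_⟩
      · rw [List.singleton_append, barUnits_some, barUnits_some]
        omega
      · rw [List.singleton_append, barUnits_some, barUnits_some]
        have := h₃ (by simpa using h) (by simpa using h')
        omega
  · rw [wd_nil, dX, der_one]
    exact zero_mem _
  · intro a w iha ihw
    rw [wd_cons, dX_mul, dX, der_letter, ← dX, par_wd, smul_mul_assoc]
    have e : units (a :: w) = units [a] + units w := units_append [a] w
    refine add_mem (mul_mem_spanWd (fun u v hu hv => ?_) iha
      (wd_mem_spanWd (P := fun v => v = w) rfl))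
      (Submodule.smul_mem _ _ (mul_mem_spanWd (fun u v hu hv => ?_)
        (wd_mem_spanWd (P := fun v => v = [a]) rfl) ihw))
    · subst hv
      rw [units_append, e]
      omega
    · subst hu
      rw [units_append, e]
      omega

theorem join_mul (e : Entry) {l : List Entry} (hl : l ≠ []) (y : Y k) :
    join e (wd l * y) = join e (wd l) * y := by
  cases l with
  | nil => exact absurd rfl hl
  | cons f l => rw [wd_cons, mul_assoc, join_cons, join_cons, mul_assoc]

/-- The internal differential of a bracket with one more entry at the end. -/
theorem dY_concat (l : List Entry) (f e : Entry) : dY (wd (k := k) (l ++ [f]) * wd [e])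
    = dY (wd (l ++ [f])) * wd [e]
      + sgn k (wdeg sdeg (l ++ [f])) • (wd (l ++ [f]) * dEntry e + wd l * wd [emul f e]) := by
  have h1 (e : Entry) : dY (wd (k := k) [e]) = dEntry e := by
    rw [← mul_one (wd [e]), dY_cons, join_one, dY_one]
    simp
  induction l with
  | nil =>
    rw [List.nil_append, dY_cons, h1, h1, ← mul_one (wd [e]), join_cons, wdeg_cons, wdeg_nil,
      wd_nil]
    simp only [mul_one, one_mul, add_zero]
    rw [add_comm (wd [f] * _)]
  | cons a l ih =>
    rw [List.cons_append, wd_cons a, mul_assoc, dY_cons, ih, dY_cons, join_mul _ (by simp),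
      wdeg_cons, sgn_add, wd_cons a l]
    simp only [mul_add, add_mul, smul_add, smul_smul, mul_smul_comm, smul_mul_assoc, mul_assoc]
    abel

/-- A version of `decon_mem` for the sum without the cut whose right part is empty. -/
theorem decon_sub_mem {α M S : Type*} [AddCommGroup M] [SetLike S M] [AddSubmonoidClass S M] (s : S)
    {f : List α → List α → M} {l : List α} (h : ∀ u v, u ++ v = l → v ≠ [] → f u v ∈ s) :
    decon f l - f l [] ∈ s := by
  induction l generalizing f with
  | nil => simp [decon]
  | cons a l ih =>
    rw [decon, add_sub_assoc]
    exact add_mem (h [] _ rfl (by simp)) (ih fun u v e hv => h (a :: u) v (by rw [← e]; rfl) hv)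

/-! ### Lower words in the homotopy formula -/

/-- The span of the tame words that are lower than a given word. -/
noncomputable def lowerSpan (k : Type u) [CommRing k] (w : List Atom) : Submodule k (X k) :=
  spanWd k fun v => Tame v ∧ Lower v w

theorem homotopy_mem_lowerSpan {v w : List Atom} (h : Lower v w) :
    homotopy (wd v) ∈ lowerSpan k w := by
  refine spanWd_mono (fun x hx => ⟨hx.1, ?_⟩) (homotopy_wd_mem v)
  rwa [Lower, hx.2.1, hx.2.2]

theorem homotopy_leaves {z : List Atom} (hz : ∀ a ∈ z, a = .leaf) (x : X k) :
    homotopy (wd z * x) = wd z * homotopy x := by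
  induction z with
  | nil => rw [wd_nil, one_mul, one_mul]
  | cons a z ih =>
    obtain rfl := hz a (by simp)
    rw [wd_cons, mul_assoc, homotopy_leaf, ih fun b hb => hz b (by simp [hb]), mul_assoc]

theorem tdeg_leaves {z : List Atom} (hz : ∀ a ∈ z, a = .leaf) : tdeg z = 0 := by
  induction z with
  | nil => rfl
  | cons a z ih =>
    obtain rfl := hz a (by simp)
    rw [tdeg_cons, deg_leaf, ih fun b hb => hz b (by simp [hb]), add_zero]

theorem lower_append {u v w : List Atom} {l : List Entry} (hu : wordRank (u ++ v) < barRank l)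
    (h : units u + units v = barUnits l + units w) : Lower (u ++ v) (.br l :: w) := by
  refine .inr ⟨?_, hu⟩
  rw [units_append, units_br_cons, h]

/-- The terms of the homotopy formula that come from a cut whose right part contains a formal unit:
up to lower words they cancel. -/
theorem cut_mem_lowerSpan (u : List Entry) {v : List Entry} (hv : none ∈ v) (w : List Atom) :
    sgn k (wdeg sdeg (u ++ v) + 1) • (tauWord u * if w = [] then 0 else wd [.br (v ++ [some w])])
      + homotopy (tauWord u * tauWord v * wd w) ∈ lowerSpan k (.br (u ++ v) :: w) := by
  have hr := barRank_append u hv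
  have hp := barRank_pos hv
  have key (z : List Atom) (h : ∀ v', wordRank (z ++ .br v :: v') < barRank (u ++ v))
      (h' : units z = barUnits u)
      (h'' : wordRank (z ++ [.br (v ++ [some w])]) < barRank (u ++ v)) :
      sgn k (wdeg sdeg (u ++ v) + 1) • (wd z * if w = [] then 0 else wd [.br (v ++ [some w])])
      + homotopy (wd z * wd [.br v] * wd w) ∈ lowerSpan k (.br (u ++ v) :: w) := by
    refine add_mem (Submodule.smul_mem _ _ ?_) ?_
    · split_ifs
      · rw [mul_zero]; exact zero_mem _
      · rw [← wd_append]
        refine wd_mem_spanWd ⟨(tame_br _ _).append _, lower_append h'' ?_⟩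
        rw [h', units_br, barUnits_append, barUnits_append, barUnits_some]
        change _ + (_ + (_ + 0)) = _
        omega
    · rw [mul_assoc, ← wd_append, ← wd_append]
      refine homotopy_mem_lowerSpan (lower_append (h _) ?_)
      rw [h', List.singleton_append, units_br_cons, barUnits_append]
      omega
  by_cases hu : none ∈ u
  · rw [tauWord_of_mem hu, tauWord_of_mem hv]
    have := barRank_le u
    exact key [.br u] (fun v' => by rw [hr]; change barRank u < _; omega) (units_br u)
      (by rw [hr]; change barRank u < _; omega)
  · rcases u with _ | ⟨_ | z, _ | ⟨e, u⟩⟩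
    · simp [tauWord_nil]
    · simp at hu
    · simp at hu
    · rw [tauWord_single, tauWord_of_mem hv]
      rw [barUnits_some] at hr
      by_cases hz : ∃ a ∈ z, a ≠ .leaf
      · have := wordRank_le z
        exact key z (fun v' => by rw [wordRank_append hz, hr]; omega) (by rw [barUnits_some]; rfl)
          (by rw [wordRank_append hz, hr]; omega)
      · push Not at hz
        rw [mul_assoc, homotopy_leaves hz]
        by_cases hw : w = []
        · subst hw
          rw [if_pos rfl, wd_nil, mul_one, homotopy_br]
          simp
        · rw [if_neg hw, ← wd_cons, homotopy_br_cons v hw, mul_smul_comm, ← add_smul,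
            List.singleton_append, wdeg_cons, sdeg]
          have : wdeg Atom.deg z = 0 := tdeg_leaves hz
          rw [this, sgn_add_one _ (wdeg sdeg v), show 0 - 1 + wdeg sdeg v + 1 =
            wdeg sdeg v by ring, add_neg_cancel,
            zero_smul]
          exact zero_mem _
    · simp [tauWord_cons_cons hu]

end

section

open DGOperad Presentation

variable {k : Type u} [CommRing k]

/-! ### The homotopy lowers words -/

/-- The difference of the identity and of the commutator of the differential and the homotopy. -/
noncomputable def lowering : X k →ₗ[k] X k := LinearMap.id - dX ∘ₗ homotopy - homotopy ∘ₗ dX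

theorem lowering_apply (x : X k) : lowering x = x - dX (homotopy x) - homotopy (dX x) := rfl

theorem lowering_leaf (x : X k) : lowering (wd [.leaf] * x) = wd [.leaf] * lowering x := by
  have h (x : X k) : dX (wd [.leaf] * x) = wd [.leaf] * dX x := by
    rw [dX_mul, dX_leaf, zero_mul, zero_add, par_wd, wdeg_cons, wdeg_nil, deg_leaf, add_zero,
      sgn_zero, one_smul]
  rw [lowering_apply, lowering_apply, homotopy_leaf, h, h, homotopy_leaf, mul_sub, mul_sub]

theorem lowering_one : lowering (1 : X k) = 1 := by
  rw [lowering_apply, homotopy_one, map_zero, dX, der_one, map_zero]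
  simp

theorem dX_br (l : List Entry) (h : none ∈ l) :
    dX (wd (k := k) [.br l]) = tau (dY (wd l)) + cut l := by
  rw [← dX_tauWord, tauWord_of_mem h]

/-- The differential of a nonempty good word contains no empty word. -/
theorem dX_mem_ne_nil {w : List Atom} (hw : GoodWord w) (hw' : w ≠ []) :
    dX (wd (k := k) w) ∈ spanWd k fun v => v ≠ [] :=
  spanWd_mono (fun _ h => h.2.1)
    (dX_mem (wd_mem_spanWd (⟨hw, hw', rfl, rfl⟩ : IsBasisWord (leaves w) (tdeg w) w)))

/-- The terms of the homotopy formula that come from the internal differential of a bracket: they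
cancel, except for the brackets that lose all of their top-level formal units. -/
theorem internal_mem_lowerSpan {l : List Entry} (hl : none ∈ l) {w : List Atom} (hw : w ≠ []) :
    sgn k (wdeg sdeg l + 1) • tau (dY (wd l) * wd [some w]) + homotopy (tau (dY (wd l)) * wd w)
      ∈ lowerSpan k (.br l :: w) := by
  have h₁ : sgn k (wdeg sdeg l + 1) • tau (dY (wd (k := k) l) * wd [some w])
      = tau (par sdeg (dY (wd l)) * wd [some w]) := by
    rw [par_dY, par_wd, map_smul, sgn_add_one, neg_smul, neg_mul, map_neg, smul_mul_assoc, map_smul]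
  rw [h₁]
  refine map_mem_of_mem_spanWd (f := tau ∘ₗ LinearMap.mulRight k (wd [some w]) ∘ₗ par sdeg
    + homotopy ∘ₗ LinearMap.mulRight k (wd w) ∘ₗ tau) (fun v hv => ?_) (differential_units.2.1 l)
  simp only [LinearMap.add_apply, LinearMap.comp_apply, LinearMap.mulRight_apply]
  rw [par_wd, smul_mul_assoc, map_smul, ← wd_append, tau_wd, tau_wd]
  by_cases h : none ∈ v
  · rw [tauWord_of_mem h, tauWord_of_mem (by simp [h]), ← wd_append, List.singleton_append,
      homotopy_br_cons v hw, sgn_add_one]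
    simp
  · obtain ⟨h₂, h₃, h₄⟩ := hv
    rcases v with _ | ⟨_ | z, _ | ⟨e, v⟩⟩
    · exact absurd rfl h₂
    · simp at h
    · simp at h
    · rw [tauWord_single, List.singleton_append, tauWord_cons_cons (by simp), smul_zero, zero_add,
        ← wd_append]
      refine homotopy_mem_lowerSpan (.inl ?_)
      have := h₄ hl h
      rw [barUnits_some] at this
      change units z + 0 < _ at this
      rw [units_append, units_br_cons]
      omega
    · rw [List.cons_append, List.cons_append, tauWord_cons_cons h,
        tauWord_cons_cons (by simpa using h)]
      simp

/-- The words that start with a bracket and have further letters. The cut of `l ++ [some w]` just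
before its last entry gives back the word itself, and the other terms are lower, or they cancel. -/
theorem lowering_br_cons {l : List Entry} {w : List Atom} (hw : w ≠ []) (hg : GoodWord (.br l :: w))
    (ht : Tame w) : lowering (wd (k := k) (.br l :: w)) ∈ lowerSpan k (.br l :: w) := by
  have hl : none ∈ l := hg.1.1
  obtain ⟨β, f, rfl⟩ : ∃ β f, l = β ++ [f] :=
    ⟨l.dropLast, l.getLast (List.ne_nil_of_mem hl), (List.dropLast_append_getLast _).symm⟩
  -- The last entry `f` of `l` is singled out because the differential of `l ++ [some w]` multiplies
  -- it by `w`.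
  set l := β ++ [f] with hlβ
  set ε := sgn k (wdeg sdeg l + 1) with hε
  have hεε : ε * ε = 1 := sgn_mul_self k _
  have hε' : sgn k (wdeg sdeg l) = -ε := by rw [hε, sgn_add_one, neg_neg]
  let F : List Entry → List Entry → X k := fun u v => sgn k (wdeg sdeg u + 1) •
    (ε • (tauWord u * tauWord (v ++ [some w])) + homotopy (tauWord u * tauWord v * wd w))
  have e₁ : dX (homotopy (wd (k := k) (.br l :: w))) = ε • tau (dY (wd l) * wd [some w])
      - tau (wd l * inc (dX (wd w))) - tau (wd β * wd [emul f (some w)])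
      + decon (fun u v => sgn k (wdeg sdeg u + 1) • ε • (tauWord u * tauWord (v ++ [some w])))
        l := by
    have e₀ : decon (fun u v => sgn k (wdeg sdeg u + 1) • ε •
        (tauWord (k := k) u * tauWord (v ++ [some w]))) l
        = ε • decon (fun u v => sgn k (wdeg sdeg u + 1) •
          (tauWord u * tauWord (v ++ [some w]))) l := by
      rw [← decon_smul]
      exact decon_congr fun u v _ => smul_comm _ _ _
    rw [e₀, homotopy_br_cons l hw, ← hε, map_smul, dX_br _ (by simp [hl]), wd_append, hlβ,
      dY_concat, ← hlβ, hε', cut, decon_concat, tauWord_nil, mul_zero, smul_zero, add_zero, dEntry,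
      map_add, map_smul, map_add, smul_add, smul_add, smul_smul, mul_neg, hεε, neg_smul, one_smul]
    abel
  have e₂ : homotopy (dX (wd (k := k) (.br l :: w))) = homotopy (tau (dY (wd l)) * wd w)
      + decon (fun u v => sgn k (wdeg sdeg u + 1) • homotopy (tauWord u * tauWord v * wd w)) l
      + tau (wd l * inc (dX (wd w))) := by
    rw [wd_cons, dX_mul, dX_br l hl, add_mul, par_wd, wdeg_cons, wdeg_nil, add_zero, deg_br, ← hε,
      smul_mul_assoc, map_add, map_add, map_smul, homotopy_br_mul hl (dX_mem_ne_nil hg.2 hw), ← hε,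
      smul_smul, hεε, one_smul]
    congr 2
    change (homotopy ∘ₗ LinearMap.mulRight k (wd w)) (cut l) = _
    rw [cut, ← decon_map]
    refine decon_congr fun u v _ => ?_
    rw [map_smul]
    rfl
  have e₃ : dX (homotopy (wd (k := k) (.br l :: w))) + homotopy (dX (wd (.br l :: w)))
      = (ε • tau (dY (wd l) * wd [some w]) + homotopy (tau (dY (wd l)) * wd w))
        - tau (wd β * wd [emul f (some w)]) + decon F l := by
    have : decon F l = decon (fun u v => sgn k (wdeg sdeg u + 1) • ε •
        (tauWord u * tauWord (v ++ [some w]))) l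
        + decon (fun u v => sgn k (wdeg sdeg u + 1) • homotopy (tauWord u * tauWord v * wd w))
          l := by
      rw [← decon_add]
      refine decon_congr fun u v _ => ?_
      rw [← smul_add]
    rw [e₁, e₂, this]
    abel
  -- the cut of `l ++ [some w]` between `l` and `w` is the original word
  have e₄ : F l [] = wd (.br l :: w) := by
    simp only [F]
    rw [tauWord_of_mem hl, List.nil_append, tauWord_single, tauWord_nil, mul_zero, zero_mul,
      map_zero, add_zero, ← hε, smul_smul, hεε, one_smul, ← wd_cons]
  have e₅ : lowering (wd (k := k) (.br l :: w))
      = -(ε • tau (dY (wd l) * wd [some w]) + homotopy (tau (dY (wd l)) * wd w))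
        + (tau (wd β * wd [emul f (some w)]) - F β [f])
        - (decon (fun u v => F u (v ++ [f])) β - F β ([] ++ [f])) := by
    rw [lowering_apply, sub_sub, e₃, hlβ, decon_concat, ← hlβ, e₄, List.nil_append]
    abel
  have hF (u v : List Entry) (h : u ++ v = l) (hv : none ∈ v) :
      F u v ∈ lowerSpan k (.br l :: w) := by
    have := cut_mem_lowerSpan (k := k) u hv w
    rw [if_neg hw, h, ← hε, ← tauWord_of_mem (l := v ++ [some w]) (by simp [hv])] at this
    exact Submodule.smul_mem _ _ this
  -- The cut of `l` just before `f` is kept together with the product of `f` and `w`: the two terms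
  -- cancel if `f` is a
  -- word, and both of them are lower if `f` is the formal unit.
  rw [e₅]
  refine sub_mem (add_mem (neg_mem (internal_mem_lowerSpan hl hw)) ?_) ?_
  · cases f with
    | none =>
      refine sub_mem ?_ (hF β [none] rfl (by simp))
      rw [emul, ← wd_append, tau_wd]
      have hu : units (.br l :: w) = barUnits β + 1 + units w := by
        rw [units_br_cons, barUnits_append]
        rfl
      by_cases h : none ∈ β
      · rw [tauWord_of_mem (by simp [h])]
        refine wd_mem_spanWd ⟨tame_br _ _, .inl ?_⟩
        rw [hu, units_br, barUnits_append, barUnits_some]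
        change _ + (_ + 0) < _
        omega
      · rcases β with _ | ⟨e, β⟩
        · rw [List.nil_append, tauWord_single]
          refine wd_mem_spanWd ⟨ht, .inl ?_⟩
          rw [hu]
          omega
        · cases β with
          | nil => rw [List.singleton_append, tauWord_cons_cons
              (by simpa using h)]; exact zero_mem _
          | cons e' β => rw [List.cons_append, List.cons_append, tauWord_cons_cons
              (by simpa using h)]; exact zero_mem _
    | some z =>
      have hβ : none ∈ β := by simpa [hlβ] using hl
      have hz : z ++ w ≠ [] := by simp [hw]
      simp only [F]
      rw [emul, List.singleton_append, tauWord_cons_cons (by simp), mul_zero, smul_zero, zero_add,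
        tauWord_single, tauWord_of_mem hβ, mul_assoc, ← wd_append z w, ← wd_cons,
        homotopy_br_cons β hz, ← wd_append, tau_wd, tauWord_of_mem (by simp [hβ]), smul_smul,
        sgn_mul_self, one_smul, sub_self]
      exact zero_mem _
  · refine decon_sub_mem _ fun u v h hv => ?_
    by_cases hn : none ∈ v ++ [f]
    · exact hF u (v ++ [f]) (by rw [← List.append_assoc, h]) hn
    · obtain ⟨e, v, rfl⟩ := List.exists_cons_of_ne_nil hv
      simp only [F]
      have h₁ : tauWord (k := k) (e :: v ++ [f]) = 0 := by
        cases v with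
        | nil => exact tauWord_cons_cons hn
        | cons e' v => exact tauWord_cons_cons hn
      have h₂ : tauWord (k := k) (e :: v ++ [f] ++ [some w]) = 0 := by
        cases v with
        | nil => exact tauWord_cons_cons (by simpa using hn)
        | cons e' v => exact tauWord_cons_cons (by simpa using hn)
      rw [h₁, h₂]
      simp

/-- The words that consist of a bracket ending with a word `z`. The cut just before `z` gives `l`
times `z`, from which the homotopy recovers the bracket; all the other terms are lower. -/
theorem lowering_br {l : List Entry} {z : List Atom} (hg : GoodWord [.br (l ++ [some z])]) :
    lowering (wd (k := k) [.br (l ++ [some z])]) ∈ lowerSpan k [.br (l ++ [some z])] := by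
  have hl : none ∈ l := by simpa using hg.1.1
  have hl' : none ∈ l ++ [some z] := by simp [hl]
  have hz : z ≠ [] := (goodBar_iff.1 hg.1.2 z (by simp)).1
  have e : homotopy (dX (wd (k := k) [.br (l ++ [some z])])) = homotopy
    (tau (dY (wd (l ++ [some z]))))
      + decon (fun u v => sgn k (wdeg sdeg u + 1) • homotopy
        (tauWord u * tauWord (v ++ [some z]))) l := by
    rw [dX_br _ hl', map_add, cut, decon_concat, tauWord_nil, mul_zero, smul_zero, add_zero,
      ← decon_map]
    congr 1
    refine decon_congr fun u v _ => ?_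
    rw [map_smul]
  have e' : sgn k (wdeg sdeg l + 1) • homotopy (tauWord (k := k) l * tauWord ([] ++ [some z]))
      = wd [.br (l ++ [some z])] := by
    rw [List.nil_append, tauWord_single, tauWord_of_mem hl, ← wd_cons, homotopy_br_cons l hz,
      smul_smul, sgn_mul_self, one_smul]
  have e'' : lowering (wd (k := k) [.br (l ++ [some z])]) = -homotopy
    (tau (dY (wd (l ++ [some z]))))
      - (decon (fun u v => sgn k (wdeg sdeg u + 1) • homotopy
        (tauWord u * tauWord (v ++ [some z]))) l
        - sgn k (wdeg sdeg l + 1) • homotopy (tauWord (k := k) l * tauWord ([] ++ [some z]))) := by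
    rw [lowering_apply, homotopy_br, map_zero, e, e']
    abel
  rw [e'']
  refine sub_mem (neg_mem ?_) (decon_sub_mem _ fun u v h hv => Submodule.smul_mem _ _ ?_)
  · refine map_mem_of_mem_spanWd (f := homotopy ∘ₗ tau) (fun v hv => ?_)
      (differential_units.2.1 (l ++ [some z]))
    rw [LinearMap.comp_apply, tau_wd]
    obtain ⟨h₂, h₃, h₄⟩ := hv
    by_cases h : none ∈ v
    · rw [tauWord_of_mem h, homotopy_br]
      exact zero_mem _
    · rcases v with _ | ⟨_ | y, _ | ⟨e, v⟩⟩
      · exact absurd rfl h₂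
      · simp at h
      · simp at h
      · rw [tauWord_single]
        refine homotopy_mem_lowerSpan (.inl ?_)
        have := h₄ hl' h
        rw [barUnits_some] at this
        rw [units_br]
        exact this
      · rw [tauWord_cons_cons h, map_zero]
        exact zero_mem _
  · by_cases hn : none ∈ v ++ [some z]
    · have := cut_mem_lowerSpan (k := k) u hn []
      rw [if_pos rfl, mul_zero, smul_zero, zero_add, wd_nil, mul_one, ← List.append_assoc,
        h] at this
      exact this
    · obtain ⟨e, v, rfl⟩ := List.exists_cons_of_ne_nil hv
      have h₁ : tauWord (k := k) (e :: v ++ [some z]) = 0 := by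
        cases v with
        | nil => exact tauWord_cons_cons hn
        | cons e' v => exact tauWord_cons_cons hn
      rw [h₁, mul_zero, map_zero]
      exact zero_mem _

/-- The words which are not reduced further by the homotopy: the product of the arguments, possibly
multiplied by `j` on the right. -/
def Terminal (w : List Atom) : Prop :=
  ∃ n, w = List.replicate n .leaf ∨ w = List.replicate n .leaf ++ [.br [none]]

theorem lowering_terminal {w : List Atom} (hw : Terminal w) : lowering (wd (k := k) w) = wd w := by
  obtain ⟨n, hw⟩ := hw
  induction n generalizing w with
  | zero =>
    rcases hw with rfl | rfl
    · rw [List.replicate_zero, wd_nil, lowering_one]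
    · rw [List.replicate_zero, List.nil_append, lowering_apply, homotopy_br, dX_unit]
      simp
  | succ n ih =>
    rcases hw with rfl | rfl
    · rw [List.replicate_succ, wd_cons, lowering_leaf, ih (.inl rfl)]
    · rw [List.replicate_succ, List.cons_append, wd_cons, lowering_leaf, ih (.inr rfl)]

/-- The lowering of a tame good word that is not terminal is a combination of lower tame words. -/
theorem lowering_mem_lowerSpan {w : List Atom} (hg : GoodWord w) (ht : Tame w) :
    Terminal w ∨ lowering (wd (k := k) w) ∈ lowerSpan k w := by
  induction w with
  | nil => exact .inl ⟨0, .inl rfl⟩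
  | cons a w ih =>
    by_cases hw : w = []
    · subst hw
      obtain ⟨v, a', h, ha⟩ := ht
      obtain ⟨rfl, rfl⟩ : v = [] ∧ a = a' := by
        cases v <;> simp_all
      rcases ha with rfl | rfl | ⟨l, z, rfl⟩
      · exact .inl ⟨1, .inl rfl⟩
      · exact .inl ⟨0, .inr rfl⟩
      · exact .inr (lowering_br hg)
    have ht' : Tame w := Tame.of_append (w := [a]) ht hw
    cases a with
    | br l => exact .inr (lowering_br_cons hw hg ht')
    | leaf =>
      rcases ih hg.2 ht' with ⟨n, h | h⟩ | h
      · exact .inl ⟨n + 1, .inl (by rw [h, List.replicate_succ])⟩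
      · exact .inl ⟨n + 1, .inr (by rw [h, List.replicate_succ, List.cons_append])⟩
      · right
        rw [wd_cons, lowering_leaf]
        refine map_mem_of_mem_spanWd (f := LinearMap.mulLeft k (wd [.leaf])) (fun v hv => ?_) h
        rw [LinearMap.mulLeft_apply, ← wd_append]
        refine wd_mem_spanWd ⟨hv.1.append _, ?_⟩
        rw [List.singleton_append, Lower, units_leaf_cons, units_leaf_cons]
        exact hv.2

end

section

open DGOperad Presentation

variable {k : Type u} [CommRing k]

/-! ### Cocycles -/

/-- The homotopy between the identity and the right multiplication by `j`; it sends `z` to `p_2(z,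
1)` up to a sign. -/
noncomputable def coneMap : X k →ₗ[k] X k := tau ∘ₗ LinearMap.mulRight k
    (wd [none]) ∘ₗ inc ∘ₗ par Atom.deg

theorem coneMap_apply (x : X k) : coneMap x = tau (inc (par Atom.deg x) * wd [none]) := rfl

theorem cut_inc (x : X k) : lin cut (inc x * wd [none]) = par Atom.deg x * wd [.br [none]] := by
  induction x using wd_induction with
  | h w =>
    rw [inc_wd, ← wd_append, lin_wd, par_wd, cut, List.singleton_append, decon, decon, decon,
      tauWord_nil, tauWord_single, tauWord_of_mem (l := [none]) (by simp), tauWord_of_mem (by simp),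
      wdeg_cons, sdeg, wdeg_nil, smul_mul_assoc]
    simp
  | hadd x y hx hy => simp only [map_add, add_mul, hx, hy]
  | hsmul c x hx => simp only [map_smul, smul_mul_assoc, hx]

theorem dX_coneMap {x : X k} (hx : dX x = 0) : dX (coneMap x) = x * wd [.br [none]] - x := by
  have h₀ : dY (wd (k := k) [none]) = 0 := by
    rw [← mul_one (wd [none]), dY_cons, join_one, dY_one, dEntry]
    simp
  have h₁ : joinLin x (wd [none]) = inc x := by
    rw [← mul_one (wd [none]), joinLin_none, mul_one]
  have h₂ : dX (par Atom.deg x) = 0 := by rw [← neg_eq_iff_eq_neg.2 (par_dX x), hx, map_zero,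
    neg_zero]
  rw [coneMap_apply, dX_tau, cut_inc, par_par, dY_inc, h₂, par_par, h₁, h₀, mul_zero, add_zero,
    map_zero, zero_mul, zero_sub, map_neg, tau_inc]
  abel

theorem coneMap_mem {n : ℕ} {p : ℤ} {x : X k} (hx : x ∈ spanWd k (IsBasisWord n p)) :
    coneMap x ∈ spanWd k (IsBasisWord n (p - 1)) := by
  refine map_mem_of_mem_spanWd (fun w hw => ?_) hx
  obtain ⟨h₁, h₂, rfl, rfl⟩ := hw
  rw [coneMap_apply, par_wd, map_smul, inc_wd, smul_mul_assoc, map_smul, ← wd_append, tau_wd,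
    tauWord_of_mem (by simp)]
  refine Submodule.smul_mem _ _ (wd_mem_spanWd ⟨?_, by simp, ?_, ?_⟩)
  · exact ⟨⟨by simp, ⟨h₂, h₁⟩, trivial⟩, trivial⟩
  · simp [wordStat, Atom.stat, barStat]
  · rw [tdeg_cons, deg_br, List.singleton_append, wdeg_cons, wdeg_cons, wdeg_nil, sdeg, sdeg]
    change _ + 0 = _
    ring

theorem tdeg_append (u v : List Atom) : tdeg (u ++ v) = tdeg u + tdeg v := wdeg_append _ _ _

theorem leaves_append (u v : List Atom) : leaves (u ++ v) = leaves u + leaves v :=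
    wordStat_append _ _ _ _ u v

theorem IsBasisWord.append_unit {n : ℕ} {p : ℤ} {w : List Atom} (hw : IsBasisWord n p w) :
    IsBasisWord n p (w ++ [.br [none]]) := by
  obtain ⟨h₁, h₂, rfl, rfl⟩ := hw
  refine ⟨goodWord_append.2 ⟨h₁, ⟨by simp, trivial⟩, trivial⟩, by simp, ?_, ?_⟩
  · simp [wordStat_append, wordStat, Atom.stat, barStat]
  · rw [tdeg_append, tdeg_cons, deg_unit]
    simp

/-- The lowering preserves the span of basis words, since it is the identity up to terms that do. -/
theorem lowering_mem {n : ℕ} {p : ℤ} {x : X k} (hx : x ∈ spanWd k (IsBasisWord n p)) :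
    lowering x ∈ spanWd k (IsBasisWord n p) := by
  have h₁ := dX_mem (homotopy_mem hx)
  have h₂ := homotopy_mem (dX_mem hx)
  rw [sub_add_cancel] at h₁
  rw [add_sub_cancel_right] at h₂
  exact sub_mem (sub_mem hx h₁) h₂

/-- The elements which become linear combinations of terminal words when they are lowered often
enough. -/
noncomputable def eventuallyTerminal (k : Type u) [CommRing k] (n : ℕ) (p : ℤ) : Submodule k
    (X k) where
  carrier := {x | ∃ m₀ : ℕ, ∀ m ≥ m₀,
    (lowering ^ m : Module.End k (X k)) x ∈ spanWd k fun w => IsBasisWord n p w ∧ Terminal w}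
  zero_mem' := ⟨0, fun m _ => by rw [map_zero]; exact zero_mem _⟩
  add_mem' := by
    rintro x y ⟨m₀, h⟩ ⟨m₁, h'⟩
    refine ⟨max m₀ m₁, fun m hm => ?_⟩
    rw [map_add]
    exact add_mem (h m (le_of_max_le_left hm)) (h' m (le_of_max_le_right hm))
  smul_mem' := by
    rintro c x ⟨m₀, h⟩
    refine ⟨m₀, fun m hm => ?_⟩
    rw [map_smul]
    exact Submodule.smul_mem _ c (h m hm)

theorem mem_eventuallyTerminal {n : ℕ} {p : ℤ} {w : List Atom} (hw : IsBasisWord n p w)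
    (ht : Tame w) :
    wd w ∈ eventuallyTerminal k n p := by
  induction w using lower_wellFounded.induction with
  | h w ih =>
    rcases lowering_mem_lowerSpan (k := k) hw.1 ht with h | h
    · refine ⟨0, fun m _ => ?_⟩
      have (i : ℕ) : (lowering ^ i : Module.End k (X k)) (wd w) = wd w := by
        induction i with
        | zero => rfl
        | succ i ihi => rw [pow_succ, Module.End.mul_apply, lowering_terminal h, ihi]
      rw [this]
      exact wd_mem_spanWd ⟨hw, h⟩
    · obtain ⟨m₀, h'⟩ : lowering (wd w) ∈ eventuallyTerminal k n p :=
        map_mem_of_mem_spanWd (f := LinearMap.id) (fun v hv => ih v hv.1.2 hv.2 hv.1.1)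
          (mem_spanWd_and h (lowering_mem (wd_mem_spanWd hw)))
      refine ⟨m₀ + 1, fun m hm => ?_⟩
      obtain ⟨m, rfl⟩ := Nat.exists_eq_add_of_le' hm
      rw [← add_assoc, pow_succ, Module.End.mul_apply]
      exact h' _ (by omega)

/-- The word that represents the `n`-fold product; it is `j` for `n = 0`, because the empty word
describes no operation. -/
def productWord (n : ℕ) : List Atom := if n = 0 then [.br [none]] else List.replicate n .leaf

/-- The sums of coboundaries and, in degree zero, multiples of the `n`-fold product. -/
noncomputable def productsAndBoundaries (k : Type u) [CommRing k] (n : ℕ) (p : ℤ) : Submodule k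
    (X k) :=
  (if p = 0 then Submodule.span k {wd (productWord n)} else ⊥) ⊔
  (spanWd k (IsBasisWord n (p - 1))).map dX

theorem goodWord_leaves (n : ℕ) : GoodWord (List.replicate n .leaf) := by
  rw [goodWord_iff]
  intro a ha
  rw [List.eq_of_mem_replicate ha]
  trivial

theorem tdeg_replicate (n : ℕ) : tdeg (List.replicate n .leaf) = 0 :=
  tdeg_leaves fun _ ha => List.eq_of_mem_replicate ha

theorem leaves_replicate (n : ℕ) : leaves (List.replicate n .leaf) = n := by
  induction n with
  | zero => rfl
  | succ n ih => rw [List.replicate_succ, leaves_leaf_cons, ih]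

theorem dX_leaves (n : ℕ) : dX (wd (k := k) (List.replicate n .leaf)) = 0 := by
  induction n with
  | zero => rw [List.replicate_zero, wd_nil, dX, der_one]
  | succ n ih => rw [List.replicate_succ, wd_cons, dX_mul, ih, dX_leaf]; simp

theorem mem_productsAndBoundaries_of_terminal {n : ℕ} {p : ℤ} {w : List Atom}
    (hw : IsBasisWord n p w)
    (ht : Terminal w) : wd w ∈ productsAndBoundaries k n p := by
  obtain ⟨h₁, h₂, h₃, h₄⟩ := hw
  have hp : wd (productWord n) ∈ productsAndBoundaries k n 0 := by
    refine Submodule.mem_sup_left ?_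
    rw [if_pos rfl]
    exact Submodule.mem_span_singleton_self _
  obtain ⟨m, rfl | rfl⟩ := ht
  · obtain rfl : m = n := (leaves_replicate m).symm.trans h₃
    obtain rfl : 0 = p := (tdeg_replicate m).symm.trans h₄
    rwa [productWord, if_neg (by simpa using h₂)] at hp
  · obtain rfl : m = n := by
      rw [← h₃, leaves_append, leaves_replicate]
      simp [wordStat, Atom.stat, barStat]
    obtain rfl : 0 = p := by
      rw [← h₄, tdeg_append, tdeg_cons, deg_unit, tdeg_replicate]
      simp
    by_cases hm : m = 0
    · subst hm
      exact hp
    · rw [productWord, if_neg hm] at hp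
      have hb : IsBasisWord m 0 (List.replicate m .leaf) :=
        ⟨goodWord_leaves m, by simpa using hm, leaves_replicate m, tdeg_replicate m⟩
      have h : wd (k := k) (List.replicate m .leaf ++ [.br [none]])
          = wd (List.replicate m .leaf) + dX (coneMap (wd (List.replicate m .leaf))) := by
        rw [dX_coneMap (dX_leaves m), wd_append]
        abel
      rw [h]
      exact add_mem hp (Submodule.mem_sup_right ⟨_, coneMap_mem (wd_mem_spanWd hb), rfl⟩)

theorem boundary_mem {n : ℕ} {p : ℤ} {x : X k} (hx : x ∈ spanWd k (IsBasisWord n (p - 1))) :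
    dX x ∈ productsAndBoundaries k n p :=
  Submodule.mem_sup_right (Submodule.mem_map_of_mem hx)

theorem mem_of_lowering_pow_mem {n : ℕ} {p : ℤ} (m : ℕ) {x : X k}
    (hx : x ∈ spanWd k (IsBasisWord n p))
    (hd : dX x = 0)
    (hm : (lowering ^ m : Module.End k (X k)) x ∈ spanWd k fun w => IsBasisWord n p w ∧
      Terminal w) :
    x ∈ productsAndBoundaries k n p := by
  induction m generalizing x with
  | zero =>
    rw [pow_zero, Module.End.one_apply] at hm
    have := map_mem_of_mem_spanWd (f := LinearMap.id (R := k) (M := X k))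
      (N := productsAndBoundaries k n p)
      (fun w hw => mem_productsAndBoundaries_of_terminal hw.1 hw.2) hm
    exact this
  | succ m ih =>
    have e : lowering x = x - dX (homotopy x) := by rw [lowering_apply, hd, map_zero, sub_zero]
    have h := ih (lowering_mem hx) (by rw [e, map_sub, hd, dX_dX, sub_zero])
      (by rwa [pow_succ, Module.End.mul_apply] at hm)
    have h' := add_mem h (boundary_mem (homotopy_mem hx))
    rwa [e, sub_add_cancel] at h'

theorem mul_unit_mem {n : ℕ} {p : ℤ} {x : X k} (hx : x ∈ spanWd k (IsBasisWord n p)) :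
    x * wd [.br [none]] ∈ spanWd k (IsBasisWord n p) ⊓ eventuallyTerminal k n p := by
  refine map_mem_of_mem_spanWd (f := LinearMap.mulRight k (wd [.br [none]])) (fun w hw => ?_) hx
  rw [LinearMap.mulRight_apply, ← wd_append]
  exact ⟨wd_mem_spanWd hw.append_unit, mem_eventuallyTerminal hw.append_unit ⟨w, _, rfl, .inr
    (.inl rfl)⟩⟩

/-- A cocycle of basis words is cohomologous to a multiple of the product of the arguments. -/
theorem mem_productsAndBoundaries {n : ℕ} {p : ℤ} {x : X k} (hx : x ∈ spanWd k (IsBasisWord n p))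
    (hd : dX x = 0) : x ∈ productsAndBoundaries k n p := by
  -- the homotopy decreases the words whose last letter is `j`
  obtain ⟨h₁, m, h₂⟩ := mul_unit_mem hx
  have h := mem_of_lowering_pow_mem m h₁ (by rw [dX_mul, hd, dX_unit, zero_mul, mul_zero,
    add_zero]) (h₂ m le_rfl)
  have h' := sub_mem h (boundary_mem (coneMap_mem hx))
  rwa [dX_coneMap hd, sub_sub_cancel] at h'

end

end OPrime

/-! ### Quasi-isomorphisms -/

/-- The criterion for a quasi-isomorphism in terms of cocycles and coboundaries. -/
theorem quasiIsoAt_of_cocycles {k : Type u} [Ring k] {K L : CochainComplex (ModuleCat.{u} k) ℤ}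
    (f : K ⟶ L)
    {i j l : ℤ} (hi : i + 1 = j) (hl : j + 1 = l)
    (inj : ∀ x : K.X j, K.d j l x = 0 → (∃ y, L.d i j y = f.f j x) → ∃ y, K.d i j y = x)
    (surj : ∀ x : L.X j, L.d j l x = 0 → ∃ y, K.d j l y = 0 ∧ ∃ z, L.d i j z = x - f.f j y) :
    QuasiIsoAt f j := by
  have prev : (ComplexShape.up ℤ).prev j = i := (ComplexShape.up ℤ).prev_eq' hi
  have next : (ComplexShape.up ℤ).next j = l := (ComplexShape.up ℤ).next_eq' hl
  have h₁ (K : CochainComplex (ModuleCat.{u} k) ℤ) (x : K.homology j) : ∃ z, K.homologyπ j z = x :=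
    (ModuleCat.epi_iff_surjective _).1 inferInstance x
  have h₂ (K : CochainComplex (ModuleCat.{u} k) ℤ) (x : K.cycles j) :
      K.homologyπ j x = 0 ↔ ∃ y, K.d i j y = K.iCycles j x := by
    constructor
    · intro h
      obtain ⟨y, rfl⟩ := (ShortComplex.moduleCat_exact_iff _).1
        (ShortComplex.exact_of_g_is_cokernel (.mk _ _ (K.toCycles_comp_homologyπ i j))
          (K.homologyIsCokernel i j prev)) x h
      exact ⟨y, by rw [← ModuleCat.comp_apply, K.toCycles_i]⟩
    · rintro ⟨y, hy⟩
      have : K.toCycles i j y = x := (ModuleCat.mono_iff_injective (K.iCycles j)).1 inferInstance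
        (by
        rw [← hy, ← ModuleCat.comp_apply, K.toCycles_i])
      rw [← this, ← ModuleCat.comp_apply, K.toCycles_comp_homologyπ]
      rfl
  have h₃ (K : CochainComplex (ModuleCat.{u} k) ℤ) (x : K.X j) (hx : K.d j l x = 0) : ∃ z,
      K.iCycles j z = x :=
    (ShortComplex.moduleCat_exact_iff _).1
      (ShortComplex.exact_of_f_is_kernel (.mk _ _ (K.iCycles_d j l))
        (K.cyclesIsKernel j l next)) x hx
  have h₄ (K : CochainComplex (ModuleCat.{u} k) ℤ) (z : K.cycles j) :
      K.d j l (K.iCycles j z) = 0 := by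
    rw [← ModuleCat.comp_apply, K.iCycles_d]
    rfl
  have h₅ (z : K.cycles j) : HomologicalComplex.homologyMap f j (K.homologyπ j z)
      = L.homologyπ j (HomologicalComplex.cyclesMap f j z) := by
    rw [← ModuleCat.comp_apply, ← ModuleCat.comp_apply, HomologicalComplex.homologyπ_naturality]
  have h₆ (z : K.cycles j) : L.iCycles j (HomologicalComplex.cyclesMap f j z) = f.f j
      (K.iCycles j z) := by
    rw [← ModuleCat.comp_apply, ← ModuleCat.comp_apply, HomologicalComplex.cyclesMap_i]
  rw [quasiIsoAt_iff_isIso_homologyMap, ConcreteCategory.isIso_iff_bijective]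
  constructor
  · refine (injective_iff_map_eq_zero (HomologicalComplex.homologyMap f j).hom).2 fun x hx => ?_
    obtain ⟨z, rfl⟩ := h₁ K x
    have hx' := (h₂ L _).1 ((h₅ z).symm.trans hx)
    rw [h₆] at hx'
    exact (h₂ K z).2 (inj _ (h₄ K z) hx')
  · intro x
    obtain ⟨z, rfl⟩ := h₁ L x
    obtain ⟨y, hy, t, ht⟩ := surj _ (h₄ L z)
    obtain ⟨y, rfl⟩ := h₃ K y hy
    refine ⟨K.homologyπ j y, (h₅ y).trans ?_⟩
    rw [← h₆, ← map_sub] at ht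
    exact (sub_eq_zero.1 (by rw [← map_sub]; exact (h₂ L _).2 ⟨t, ht⟩)).symm

namespace OPrime

open DGOperad Presentation

variable {k : Type u} [CommRing k]

/-! ### The cohomology of `O'` -/

/-- The iterated product, as an operation of `O'`; it is `j` in arity `0`. -/
def product (k : Type u) [CommRing k] : (n : ℕ) → (OPrime k).obj n 0
  | 0 => genOp k .j
  | 1 => (OPrime k).one
  | n + 2 => (OPrime k).comp (m := 2) (n := n + 1) 1 (by omega) (by omega) (by omega) (genOp k .m)
      (product k (n + 1))

theorem ev_product (n : ℕ) : ev (product k n) = wd (productWord n) := by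
  induction n using Nat.twoStepInduction with
  | zero => exact lin_wd _ _
  | one =>
    have : ev (OPrime k).one = endOne (wd (k := k) [[.leaf]]) := by
      rw [ev_apply, (action k).map_one]
      rfl
    rw [product, this, ← letter_wd, endOne_letter]
    rfl
  | more n _ ih =>
    have h := ev_comp (k := k) (m := 2) (n := n + 1) (r := n + 2) 1 (by omega) (by omega)
      (zero_add 0) (genOp k .m)
      (product k (n + 1)) [[.leaf]] [] rfl
    rw [List.append_nil, List.singleton_append, ← List.replicate_succ] at h
    rw [product, ev_apply, h, ih, twist_even _ (by simp), wd_nil, mul_one, ← letter_wd]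
    refine (endMul_letter _ _).trans ?_
    rw [productWord, productWord, if_neg (by omega), if_neg (by omega), ← wd_append]
    rfl

theorem proj_product (n : ℕ) : ((proj k).app (product k n)).1 = 1 := by
  induction n using Nat.twoStepInduction with
  | zero => rfl
  | one => exact congrArg Subtype.val (proj k).map_one
  | more n _ ih =>
    rw [product, (proj k).map_comp]
    change (1 : k) * ((proj k).app (product k (n + 1))).1 = 1
    rw [ih, one_mul]

theorem d_product (n : ℕ) {p : ℤ} (h : 0 + 1 = p) : (OPrime k).d h (product k n) = 0 := by
  apply ev_injective
  rw [ev_d, ev_product, map_zero, productWord]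
  split_ifs
  · exact dX_unit
  · exact dX_leaves n

/-- Every cocycle of degree zero is cohomologous to a multiple of the iterated product. -/
theorem exists_eq_product_add_d {n : ℕ} {p q : ℤ} (h : p + 1 = 0) (h' : 0 + 1 = q)
    {c : (OPrime k).obj n 0}
    (hc : (OPrime k).d h' c = 0) : ∃ (a : k) (b : (OPrime k).obj n p), c = a • product k n +
      (OPrime k).d h b := by
  obtain rfl : p = 0 - 1 := by omega
  obtain ⟨y, hy, _, ⟨z, hz, rfl⟩, e⟩ := Submodule.mem_sup.1
    (mem_productsAndBoundaries (ev_mem c) (by rw [← ev_d h' c, hc, map_zero]))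
  obtain ⟨b, rfl⟩ := exists_ev_eq hz
  rw [if_pos rfl] at hy
  obtain ⟨a, rfl⟩ := Submodule.mem_span_singleton.1 hy
  refine ⟨a, b, ev_injective _ _ ?_⟩
  rw [map_add, ev_d, map_smul, ev_product, e]

/-- In nonzero degrees, every cocycle is a coboundary. -/
theorem exists_eq_d {n : ℕ} {p q r : ℤ} (h : p + 1 = q) (h' : q + 1 = r) (hq : q ≠ 0)
    {c : (OPrime k).obj n q}
    (hc : (OPrime k).d h' c = 0) : ∃ b : (OPrime k).obj n p, c = (OPrime k).d h b := by
  obtain rfl : p = q - 1 := by omega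
  obtain ⟨y, hy, _, ⟨z, hz, rfl⟩, e⟩ := Submodule.mem_sup.1
    (mem_productsAndBoundaries (ev_mem c) (by rw [← ev_d h' c, hc, map_zero]))
  obtain ⟨b, rfl⟩ := exists_ev_eq hz
  rw [if_neg hq, Submodule.mem_bot] at hy
  rw [hy, zero_add] at e
  exact ⟨b, ev_injective _ _ (e.symm.trans (ev_d h b).symm)⟩

theorem proj_d {n : ℕ} {p q : ℤ} (h : p + 1 = q) (b : (OPrime k).obj n p) :
    (proj k).app ((OPrime k).d h b) = 0 :=
  (proj k).map_d h b

theorem quasiIsoAt_proj (n : ℕ) (q : ℤ) : QuasiIsoAt ((proj k).complexMap n) q := by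
  have hd (A : DGOperad k) {p q : ℤ} (h : p + 1 = q) (x : A.obj n p) :
      (A.complex n).d p q x = A.d h x := by
    simp only [complex, dif_pos h]
    rfl
  have h : q - 1 + 1 = q := by omega
  refine quasiIsoAt_of_cocycles _ h rfl (fun (c : (OPrime k).obj n q) hc hy => ?_)
    fun (x : (AssocPlus k).obj n q) _ => ?_
  · replace hy : (proj k).app c = 0 := by
      obtain ⟨y, hy⟩ := hy
      exact hy.symm.trans (hd (AssocPlus k) h y)
    rw [hd (OPrime k) rfl c] at hc
    by_cases hq : q = 0
    · subst hq
      obtain ⟨a, b, rfl⟩ := exists_eq_product_add_d h rfl hc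
      rw [map_add, proj_d, add_zero, map_smul] at hy
      have ha : a * ((proj k).app (product k n)).1 = 0 := congrArg Subtype.val hy
      rw [proj_product, mul_one] at ha
      refine ⟨b, (hd _ h b).trans ?_⟩
      rw [ha, zero_smul, zero_add]
    · obtain ⟨b, rfl⟩ := exists_eq_d h rfl hq hc
      exact ⟨b, hd _ h b⟩
  · by_cases hq : q = 0
    · subst hq
      refine ⟨x.1 • product k n, ?_, 0, ?_⟩
      · rw [hd (OPrime k) rfl, map_smul]
        exact (congrArg _ (d_product n _)).trans (smul_zero (A := (OPrime k).obj n (0 + 1)) x.1)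
      · rw [map_zero]
        refine (sub_eq_zero.2 (Subtype.ext ?_)).symm
        change x.1 = ((proj k).app (x.1 • product k n)).1
        rw [map_smul]
        change x.1 = x.1 * ((proj k).app (product k n)).1
        rw [proj_product, mul_one]
    · have : x = 0 := Subtype.ext (x.2 hq)
      exact ⟨0, map_zero _, 0, by rw [this, map_zero, map_zero]; exact (sub_zero _).symm⟩

end OPrime

theorem theorem4p1 (k : Type u) [Field k] : (OPrime.proj k).IsQuasiIso := fun n =>
  ⟨fun q => OPrime.quasiIsoAt_proj n q⟩
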